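/- **Problem.** An instance is a finite list of jobs $j$, each with a processing time $p_j\in\{1,2,\dots\}$, a release time $r_j\in\{0,1,2,\dots\}$ and a weight $w_j\in\{1,2,\dots\}$, all encoded in binary. A schedule on one machine with preemption processes at most one job at a time, no job $j$ before time $r_j$, and every job $j$ for a total of $p_j$ units of time (jobs may be interrupted and resumed at arbitrary real times). If $C_j$ is the completion time of $j$, its flow time is $F_j=C_j-r_j$. For $0<p<\infty$ the goal is to minimize $\big(\sum_j w_jF_j^p\big)^{1/p}$. A polynomial-time $\rho$-approximation algorithm is a program that, on every instance, halts within a number of steps (logarithmic cost, i.e. bit complexity up to a polynomial) polynomial in the encoding length $N$ of the instance, and outputs a schedule, as an explicit list of intervals, whose objective value is at most $\rho$ times that of every schedule. Here $p$ and the accuracy $\varepsilon$ are fixed: the program and the polynomial may depend on them. **Theorem.** Let $0<p<\infty$ and $\varepsilon>0$ be fixed real numbers. There is a polynomial-time $$\Big(\Big(2^p+\frac{4^p}{4^p-3^p}\Big)^{1/p}+\varepsilon\Big)\text{-approximation algorithm}$$ for minimizing $\big(\sum_j w_jF_j^p\big)^{1/p}$ on one machine with preemption, where the constant $p$, being an arbitrary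 real number, is available to the algorithm through its binary expansion: on an instance of encoding length $N$ it is given $\lfloor 2^N p\rfloor$ together with the instance. If $p$ is rational, there is such an algorithm that is given the instance alone. In particular, for $p=1$ there is a polynomial-time $(6+\varepsilon)$-approximation algorithm, given the instance alone, for minimizing the total weighted flow time $\sum_j w_jF_j$. -/

import Mathlib

open scoped ENNReal

namespace FlowTime

/-! ## The machine model: while-programs on binary trees of integers, with logarithmic cost -/

/-- Data: binary trees whose leaves are natural numbers. -/
inductive Val : Type
  | num (n : ℕ) : Val
  | pair (a b : Val) : Val

namespace Val

/-- The size of a datum: one unit per node plus the number of binary digits in its leaves. -/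
def size : Val → ℕ
  | num n => 1 + Nat.size n
  | pair a b => 1 + a.size + b.size

/-- Lists are stored as nested pairs that end in `num 0`. -/
def ofList : List Val → Val
  | [] => num 0
  | v :: l => pair v (ofList l)

end Val

/-- The primitive operations of the machine. -/
inductive Op : Type
  | const (w : Val) : Op
  | id : Op
  | fst : Op
  | snd : Op
  | isNum : Op
  | add : Op
  | sub : Op
  | mul : Op
  | div : Op
  | lt : Op

/-- The value of a primitive operation; the two operands of the arithmetic operations and of the
comparison are the components of a pair of numbers. On data of the wrong shape it is `num 0`. -/
def Op.apply : Op → Val → Val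
  | const w, _ => w
  | id, v => v
  | fst, .pair a _ => a
  | snd, .pair _ b => b
  | isNum, .num _ => .num 1
  | add, .pair (.num a) (.num b) => .num (a + b)
  | sub, .pair (.num a) (.num b) => .num (a - b)
  | mul, .pair (.num a) (.num b) => .num (a * b)
  | div, .pair (.num a) (.num b) => .num (a / b)
  | lt, .pair (.num a) (.num b) => .num (if a < b then 1 else 0)
  | _, _ => .num 0

/-- Programs. Each program transforms a datum:
`seq P Q` runs `P` and then `Q` on the result; `fork P Q` runs `P` and `Q` on the same datum and
pairs the results; `ite P Q R` runs `Q` or `R` according to whether the value of the test `P` is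
different from `num 0`; `while P Q` repeats `Q` as long as the value of the test `P` is different
from `num 0`. -/
inductive Prog : Type
  | prim (o : Op) : Prog
  | seq (P Q : Prog) : Prog
  | fork (P Q : Prog) : Prog
  | ite (P Q R : Prog) : Prog
  | while (P Q : Prog) : Prog

/-- `Runs P v u t`: the program `P`, started on `v`, halts with result `u` after time `t`.
Every operation is charged for the sizes of the data that it reads, copies and writes
(logarithmic cost), so the time agrees up to a polynomial with the time of a Turing machine. -/
inductive Runs : Prog → Val → Val → ℕ → Prop
  | prim (o : Op) (v : Val) : Runs (.prim o) v (o.apply v) (1 + v.size + (o.apply v).size)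
  | seq {P Q : Prog} {v w u : Val} {t₁ t₂ : ℕ} :
      Runs P v w t₁ → Runs Q w u t₂ → Runs (.seq P Q) v u (1 + t₁ + t₂)
  | fork {P Q : Prog} {v a b : Val} {t₁ t₂ : ℕ} :
      Runs P v a t₁ → Runs Q v b t₂ → Runs (.fork P Q) v (.pair a b) (1 + v.size + t₁ + t₂)
  | iteTrue {P Q R : Prog} {v c u : Val} {t₁ t₂ : ℕ} :
      Runs P v c t₁ → c ≠ .num 0 → Runs Q v u t₂ → Runs (.ite P Q R) v u (1 + v.size + t₁ + t₂)
  | iteFalse {P Q R : Prog} {v u : Val} {t₁ t₂ : ℕ} :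
      Runs P v (.num 0) t₁ → Runs R v u t₂ → Runs (.ite P Q R) v u (1 + v.size + t₁ + t₂)
  | whileDone {P Q : Prog} {v : Val} {t : ℕ} :
      Runs P v (.num 0) t → Runs (.while P Q) v v (1 + v.size + t)
  | whileStep {P Q : Prog} {v c w u : Val} {t₁ t₂ t₃ : ℕ} :
      Runs P v c t₁ → c ≠ .num 0 → Runs Q v w t₂ → Runs (.while P Q) w u t₃ →
      Runs (.while P Q) v u (1 + v.size + t₁ + t₂ + t₃)

/-! ## The scheduling problem -/

/-- A job: processing time, release time and weight. -/
structure Job where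
  proc : ℕ
  release : ℕ
  weight : ℕ
  proc_pos : 0 < proc
  weight_pos : 0 < weight

/-- `run j` is the set of times at which the machine works on the job `j` of the instance `I`.
This is a (preemptive) schedule on one machine if the machine works on at most one job at a time,
on no job before its release, and on each job for its processing time, within a bounded
time horizon. -/
structure IsSchedule (I : List Job) (run : Fin I.length → Set ℝ) : Prop where
  measurable : ∀ j, MeasurableSet (run j)
  disjoint : ∀ i j, i ≠ j → Disjoint (run i) (run j)
  released : ∀ j, ∀ x ∈ run j, ((I.get j).release : ℝ) ≤ x
  processed : ∀ j, MeasureTheory.volume (run j) = ((I.get j).proc : ℝ≥0∞)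
  bounded : ∀ j, BddAbove (run j)

/-- The completion time: the first time at which the job has been processed completely. -/
noncomputable def completionTime (I : List Job) (run : Fin I.length → Set ℝ)
    (j : Fin I.length) : ℝ :=
  sInf {x : ℝ | MeasureTheory.volume (run j ∩ Set.Iic x) = ((I.get j).proc : ℝ≥0∞)}

/-- The flow time: completion time minus release time. -/
noncomputable def flowTime (I : List Job) (run : Fin I.length → Set ℝ) (j : Fin I.length) : ℝ :=
  completionTime I run j - ((I.get j).release : ℝ)

/-- The objective `(∑ j, w j * F j ^ p) ^ (1 / p)`. -/
noncomputable def flowNorm (p : ℝ) (I : List Job) (run : Fin I.length → Set ℝ) : ℝ :=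
  (∑ j : Fin I.length, ((I.get j).weight : ℝ) * flowTime I run j ^ p) ^ (1 / p)

/-! ## Inputs and outputs of programs -/

/-- The binary encoding of a job. -/
def Job.encode (j : Job) : Val :=
  .pair (.num j.proc) (.pair (.num j.release) (.num j.weight))

/-- The binary encoding of an instance: the list of its jobs. -/
def encodeInstance (I : List Job) : Val :=
  Val.ofList (I.map Job.encode)

/-- One entry of an explicitly listed schedule of `n` jobs: work on `job` from time `start`
until time `finish`. -/
structure Piece (n : ℕ) where
  job : Fin n
  start : ℕ
  finish : ℕ

/-- The binary encoding of a piece. -/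
def Piece.encode {n : ℕ} (q : Piece n) : Val :=
  .pair (.num q.job) (.pair (.num q.start) (.num q.finish))

/-- The binary encoding of a list of pieces. -/
def encodePieces {n : ℕ} (S : List (Piece n)) : Val :=
  Val.ofList (S.map Piece.encode)

/-- The times at which a listed schedule works on the job `j`. -/
def piecesRun {n : ℕ} (S : List (Piece n)) (j : Fin n) : Set ℝ :=
  {x : ℝ | ∃ q ∈ S, q.job = j ∧ (q.start : ℝ) ≤ x ∧ x < (q.finish : ℝ)}

/-- The program `P`, which receives `input I` on the instance `I`, is a polynomial-time
`ρ`-approximation algorithm for the weighted `p`-norm of the flow times on one machine with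
preemption: in time polynomial in the length of the binary encoding of `I` it prints a schedule
whose objective value is at most `ρ` times that of every schedule. -/
def IsPolyTimeApprox (P : Prog) (input : List Job → Val) (p ρ : ℝ) : Prop :=
  ∃ f : Polynomial ℕ, ∀ I : List Job, ∃ (S : List (Piece I.length)) (t : ℕ),
    Runs P (input I) (encodePieces S) t ∧
    t ≤ f.eval (encodeInstance I).size ∧
    IsSchedule I (piecesRun S) ∧
    ∀ run : Fin I.length → Set ℝ, IsSchedule I run →
      flowNorm p I (piecesRun S) ≤ ρ * flowNorm p I run

/-- The instance together with the integer part and the first `N` binary digits of `p`, where `N` is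
the encoding length of the instance. -/
noncomputable def withDigits (p : ℝ) (I : List Job) : Val :=
  .pair (encodeInstance I) (.num ⌊p * 2 ^ (encodeInstance I).size⌋₊)

end FlowTime

/-!
The algorithm chooses deadlines `D j` for the jobs and then processes the jobs earliest deadline
first. Deadlines can be met if and only if they satisfy the demand condition: for all times
`s ≤ t`, the jobs that are released at `s` or later and due at `t` or earlier need at most `t - s`
units of time (`placed_schedule`, `IsSchedule.demand`). So it remains to choose deadlines that
satisfy this condition at low cost.

Deadlines are built from dyadic segments. For a job `j` and a scale `d = 2 ^ k`, a cell
`[q * d, (q + 1) * d)` is a segment of `j` if `j` is not released after the beginning of the left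
neighbour of the cell, but is released after the beginning of the left neighbour of its parent
cell. Then the cell begins at an age between `d` and `3 * d` of the job, so that the age grows by
a factor between `4 / 3` and `2` along it. The segments of `j` are disjoint and cover all times
from `r j + 1` on. A solution selects a set of segments, the deadline of a job is the latest end
of its selected segments, and a segment that ends at the age `a` costs `w j * a ^ p`. Hence the
cost of a solution bounds the cost of its schedule. Conversely, select for any schedule the
segments that begin before the completion times. For a job of flow time `F`, the last of them
costs at most `(2 * F) ^ p`, and the others sum up geometrically to at most
`4 ^ p / (4 ^ p - 3 ^ p) * F ^ p` (`potential_seg`, `potential_total`). This is where the ratio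
comes from.

An optimal solution is found by dynamic programming over the binary tree of cells. For every cell
and every cost, the table keeps the largest time `H` such that all earlier work may last until
`H`; this number is all that the rest of the tree has to know about the choices inside the cell.
The jobs whose segments are equal to a cell are treated by decreasing release times: either the
segment is selected, or room for the job is reserved before `H`. The tables are sound
(`sound_levels`) and complete (`complete_levels`). To keep them small, costs are rounded to
multiples of a fraction of a guess for the optimal cost; the number of segments is small, so that
little is lost, and trying all powers of two as guesses suffices (`bestSol_spec'`).

Powers `x ^ p` with a real exponent are replaced by approximations that are computed from the
binary length of `x ^ G` for a large constant `G` (`powApprox_le_rpow`, `rpow_le_powApprox`). They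
only need `p` up to an error that is inverse to the logarithm of the largest time, for which the
given digits of `p` suffice.

Running times are treated by a calculus of polynomial-time functions between encoded types
(`PolyTime`), closed under the usual operations on numbers and lists; loops are folds whose
accumulators have polynomial size (`PolyTime.foldl`).
-/

namespace FlowTime

/-! ### Encodings and polynomially bounded quantities -/

/-- A type whose elements are stored as data of the machine. -/
class Enc (α : Type) where
  /-- The datum that represents an element. -/
  enc : α → Val

open Enc

instance : Enc ℕ := ⟨Val.num⟩
instance : Enc Bool := ⟨fun b => .num b.toNat⟩
instance {α β : Type} [Enc α] [Enc β] : Enc (α × β) := ⟨fun x => .pair (enc x.1) (enc x.2)⟩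
instance {α : Type} [Enc α] : Enc (List α) := ⟨fun l => Val.ofList (l.map enc)⟩

/-- The encoding length. -/
def sz {α : Type} [Enc α] (a : α) : ℕ := (enc a).size

section Basic

variable {α β γ σ : Type} [Enc α] [Enc β] [Enc γ] [Enc σ]

theorem sz_nat (n : ℕ) : sz n = 1 + Nat.size n := rfl

theorem sz_pair (a : α) (b : β) : sz (a, b) = 1 + sz a + sz b := rfl

theorem sz_prod (x : α × β) : sz x = 1 + sz x.1 + sz x.2 := rfl

@[simp] theorem sz_nil : sz ([] : List α) = 1 := by
  simp [sz, enc, Val.ofList, Val.size]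

@[simp] theorem sz_cons (a : α) (l : List α) : sz (a :: l) = 1 + sz a + sz l := rfl

theorem Val.one_le_size (v : Val) : 1 ≤ v.size := by
  cases v <;> simp only [Val.size] <;> omega

theorem one_le_sz (a : α) : 1 ≤ sz a := Val.one_le_size _

theorem sz_append (l m : List α) : sz (l ++ m) + 1 = sz l + sz m := by
  induction l with
  | nil => simp; omega
  | cons a l ih => simp only [List.cons_append, sz_cons]; omega

theorem sz_perm {l m : List α} (h : l.Perm m) : sz l = sz m := by
  induction h with
  | nil => rfl
  | cons a _ ih => simp only [sz_cons, ih]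
  | swap a b _ => simp only [sz_cons]; omega
  | trans _ _ h1 h2 => exact h1.trans h2

theorem sz_le_of_mem {a : α} {l : List α} (h : a ∈ l) : sz a ≤ sz l := by
  induction l with
  | nil => simp at h
  | cons b l ih =>
    rcases List.mem_cons.1 h with rfl | h
    · simp only [sz_cons]; omega
    · have := ih h; simp only [sz_cons]; omega

theorem length_le_sz (l : List α) : l.length ≤ sz l := by
  induction l with
  | nil => simp
  | cons b l ih => simp only [sz_cons, List.length_cons]; omega

theorem sz_list_le {l : List α} {B : ℕ} (h : ∀ a ∈ l, sz a ≤ B) :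
    sz l ≤ 1 + l.length * (1 + B) := by
  induction l with
  | nil => simp
  | cons b l ih =>
    have h1 := ih fun a ha => h a (List.mem_cons_of_mem _ ha)
    have h2 := h b List.mem_cons_self
    simp only [sz_cons, List.length_cons, add_mul, one_mul]; omega

theorem sz_sublist {l m : List α} (h : l.Sublist m) : sz l ≤ sz m := by
  induction h with
  | slnil => exact le_rfl
  | cons a _ ih => simp only [sz_cons]; omega
  | cons_cons a _ ih => simp only [sz_cons]; omega

theorem sz_nat_mono {m n : ℕ} (h : m ≤ n) : sz m ≤ sz n := by
  have := Nat.size_le_size h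
  simp only [sz_nat]; omega

theorem sz_nat_le (n : ℕ) : sz n ≤ 1 + n := by
  have : Nat.size n ≤ n := Nat.size_le.2 Nat.lt_two_pow_self
  simp only [sz_nat]; omega

theorem sz_two_pow (k : ℕ) : sz (2 ^ k) = k + 2 := by
  rw [sz_nat, Nat.size_pow]; omega

theorem Runs.size_le {P : Prog} {v u : Val} {t : ℕ} (h : Runs P v u t) : u.size ≤ t := by
  induction h <;> (try simp only [Val.size] at *) <;> omega

/-- A quantity that is bounded by a polynomial in the encoding length. -/
def PolyBdd (g : α → ℕ) : Prop := ∃ k, ∀ a, g a ≤ (sz a + 2) ^ k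

theorem PolyBdd.mono {f g : α → ℕ} (hg : PolyBdd g) (h : ∀ a, f a ≤ g a) : PolyBdd f := by
  obtain ⟨k, hk⟩ := hg
  exact ⟨k, fun a => (h a).trans (hk a)⟩

theorem polyBdd_const (n : ℕ) : PolyBdd fun _ : α => n :=
  ⟨n, fun a => (Nat.lt_two_pow_self.le).trans (Nat.pow_le_pow_left (by omega) n)⟩

theorem polyBdd_sz : PolyBdd fun a : α => sz a := ⟨1, fun a => by simp⟩

theorem PolyBdd.mul {f g : α → ℕ} (hf : PolyBdd f) (hg : PolyBdd g) :
    PolyBdd fun a => f a * g a := by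
  obtain ⟨k, hk⟩ := hf
  obtain ⟨l, hl⟩ := hg
  exact ⟨k + l, fun a => by rw [pow_add]; exact Nat.mul_le_mul (hk a) (hl a)⟩

theorem PolyBdd.add {f g : α → ℕ} (hf : PolyBdd f) (hg : PolyBdd g) :
    PolyBdd fun a => f a + g a := by
  obtain ⟨k, hk⟩ := hf
  obtain ⟨l, hl⟩ := hg
  refine ⟨max k l + 1, fun a => ?_⟩
  have h1 : (sz a + 2) ^ k ≤ (sz a + 2) ^ max k l :=
    Nat.pow_le_pow_right (by omega) (le_max_left _ _)
  have h2 : (sz a + 2) ^ l ≤ (sz a + 2) ^ max k l :=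
    Nat.pow_le_pow_right (by omega) (le_max_right _ _)
  have h3 : (sz a + 2) ^ max k l * 2 ≤ (sz a + 2) ^ max k l * (sz a + 2) :=
    Nat.mul_le_mul_left _ (by omega)
  have h4 := hk a
  have h5 := hl a
  show f a + g a ≤ _
  rw [pow_succ]; omega

theorem PolyBdd.pow {f : α → ℕ} (hf : PolyBdd f) (n : ℕ) : PolyBdd fun a => f a ^ n := by
  obtain ⟨k, hk⟩ := hf
  exact ⟨k * n, fun a => by rw [pow_mul]; exact Nat.pow_le_pow_left (hk a) n⟩

theorem PolyBdd.comp {g : β → ℕ} {f : α → β} (hg : PolyBdd g) (hf : PolyBdd fun a => sz (f a)) :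
    PolyBdd fun a => g (f a) := by
  obtain ⟨k, hk⟩ := hg
  exact ((hf.add (polyBdd_const 2)).pow k).mono fun a => hk (f a)

/-- The function is computed by a program in polynomial time. -/
@[fun_prop]
def PolyTime (f : α → β) : Prop :=
  ∃ (P : Prog) (g : α → ℕ), PolyBdd g ∧ ∀ a, ∃ t ≤ g a, Runs P (enc a) (enc (f a)) t

theorem PolyTime.polyBdd_sz {f : α → β} (h : PolyTime f) : PolyBdd fun a => sz (f a) := by
  obtain ⟨P, g, hg, h⟩ := h
  refine hg.mono fun a => ?_
  obtain ⟨t, ht, hr⟩ := h a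
  exact hr.size_le.trans ht

/-! ### Closure properties of polynomial-time functions -/

namespace PolyTime

/-- A function that a single primitive operation computes. -/
theorem of_op {f : α → β} (o : Op) (h : ∀ a, o.apply (enc a) = enc (f a))
    (hb : PolyBdd fun a => sz (f a)) : PolyTime f := by
  refine ⟨.prim o, fun a => 1 + sz a + sz (f a), ((polyBdd_const 1).add FlowTime.polyBdd_sz).add hb,
    fun a => ⟨_, le_rfl, ?_⟩⟩
  have := Runs.prim o (enc a)
  rw [h a] at this
  exact this

@[fun_prop]
theorem id : PolyTime fun a : α => a :=
  of_op .id (fun _ => rfl) FlowTime.polyBdd_sz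

@[fun_prop]
theorem const (b : β) : PolyTime fun _ : α => b :=
  of_op (.const (enc b)) (fun _ => rfl) (polyBdd_const _)

theorem comp {g : β → γ} {f : α → β} (hg : PolyTime g) (hf : PolyTime f) :
    PolyTime fun a => g (f a) := by
  have hs := hf.polyBdd_sz
  obtain ⟨P, p, hp, hP⟩ := hf
  obtain ⟨Q, q, hq, hQ⟩ := hg
  refine ⟨.seq P Q, fun a => 1 + p a + q (f a), ((polyBdd_const 1).add hp).add (hq.comp hs),
    fun a => ?_⟩
  obtain ⟨t, ht, h1⟩ := hP a
  obtain ⟨u, hu, h2⟩ := hQ (f a)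
  exact ⟨_, by simp only; omega, h1.seq h2⟩

theorem pair {f : α → β} {g : α → γ} (hf : PolyTime f) (hg : PolyTime g) :
    PolyTime fun a => (f a, g a) := by
  obtain ⟨P, p, hp, hP⟩ := hf
  obtain ⟨Q, q, hq, hQ⟩ := hg
  refine ⟨.fork P Q, fun a => 1 + sz a + p a + q a,
    (((polyBdd_const 1).add FlowTime.polyBdd_sz).add hp).add hq, fun a => ?_⟩
  obtain ⟨t, ht, h1⟩ := hP a
  obtain ⟨u, hu, h2⟩ := hQ a
  exact ⟨1 + sz a + t + u, by simp only; omega, h1.fork h2⟩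

theorem fst' : PolyTime fun x : α × β => x.1 :=
  of_op .fst (fun _ => rfl) (FlowTime.polyBdd_sz.mono fun x => by rw [sz_prod]; omega)

theorem snd' : PolyTime fun x : α × β => x.2 :=
  of_op .snd (fun _ => rfl) (FlowTime.polyBdd_sz.mono fun x => by rw [sz_prod]; omega)

theorem fst {f : α → β × γ} (hf : PolyTime f) : PolyTime fun a => (f a).1 := comp fst' hf

theorem snd {f : α → β × γ} (hf : PolyTime f) : PolyTime fun a => (f a).2 := comp snd' hf

attribute [fun_prop] comp pair fst snd

/-- Replace the value of a function by an equal one. -/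
theorem congr {f g : α → β} (hf : PolyTime f) (h : ∀ a, g a = f a) : PolyTime g := by
  rwa [show g = f from funext h]

theorem sz_mul_le (a b : ℕ) : sz (a * b) ≤ sz a + sz b := by
  simp only [sz_nat]
  have : Nat.size (a * b) ≤ Nat.size a + Nat.size b := by
    rw [Nat.size_le, pow_add]
    exact Nat.mul_lt_mul'' (Nat.lt_size_self a) (Nat.lt_size_self b)
  omega

theorem sz_add_le (a b : ℕ) : sz (a + b) ≤ sz a + sz b := by
  simp only [sz_nat]
  have : Nat.size (a + b) ≤ Nat.size a + Nat.size b + 1 := by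
    rw [Nat.size_le]
    have h1 := Nat.lt_size_self a
    have h2 := Nat.lt_size_self b
    have h3 : 2 ^ Nat.size a ≤ 2 ^ (Nat.size a + Nat.size b) :=
      Nat.pow_le_pow_right (by omega) (by omega)
    have h4 : 2 ^ Nat.size b ≤ 2 ^ (Nat.size a + Nat.size b) :=
      Nat.pow_le_pow_right (by omega) (by omega)
    rw [pow_succ]; omega
  omega

@[fun_prop]
theorem add {f g : α → ℕ} (hf : PolyTime f) (hg : PolyTime g) : PolyTime fun a => f a + g a :=
  comp (g := fun x : ℕ × ℕ => x.1 + x.2) (of_op .add (fun _ => rfl)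
    (FlowTime.polyBdd_sz.mono fun x => by
      have := sz_add_le x.1 x.2; rw [sz_prod]; omega)) (pair hf hg)

@[fun_prop]
theorem mul {f g : α → ℕ} (hf : PolyTime f) (hg : PolyTime g) : PolyTime fun a => f a * g a :=
  comp (g := fun x : ℕ × ℕ => x.1 * x.2) (of_op .mul (fun _ => rfl)
    (FlowTime.polyBdd_sz.mono fun x => by
      have := sz_mul_le x.1 x.2; rw [sz_prod]; omega)) (pair hf hg)

@[fun_prop]
theorem sub {f g : α → ℕ} (hf : PolyTime f) (hg : PolyTime g) : PolyTime fun a => f a - g a :=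
  comp (g := fun x : ℕ × ℕ => x.1 - x.2) (of_op .sub (fun _ => rfl)
    (FlowTime.polyBdd_sz.mono fun x => by
      have := sz_nat_mono (Nat.sub_le x.1 x.2); rw [sz_prod]; omega)) (pair hf hg)

@[fun_prop]
theorem div {f g : α → ℕ} (hf : PolyTime f) (hg : PolyTime g) : PolyTime fun a => f a / g a :=
  comp (g := fun x : ℕ × ℕ => x.1 / x.2) (of_op .div (fun _ => rfl)
    (FlowTime.polyBdd_sz.mono fun x => by
      have := sz_nat_mono (Nat.div_le_self x.1 x.2); rw [sz_prod]; omega)) (pair hf hg)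

@[fun_prop]
theorem mod {f g : α → ℕ} (hf : PolyTime f) (hg : PolyTime g) : PolyTime fun a => f a % g a :=
  congr (f := fun a => f a - g a * (f a / g a)) (by fun_prop) fun a => by
    have := Nat.mod_add_div (f a) (g a); omega

theorem pow_const {f : α → ℕ} (hf : PolyTime f) (n : ℕ) : PolyTime fun a => f a ^ n := by
  induction n with
  | zero => simpa using const (α := α) 1
  | succ n ih => simpa only [pow_succ] using mul ih hf

theorem sz_bool_le (b : Bool) : sz b ≤ 2 := by cases b <;> decide

@[fun_prop]
theorem lt {f g : α → ℕ} (hf : PolyTime f) (hg : PolyTime g) :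
    PolyTime fun a => decide (f a < g a) :=
  comp (g := fun x : ℕ × ℕ => decide (x.1 < x.2)) (of_op .lt
    (fun x => by by_cases h : x.1 < x.2 <;> simp [enc, Op.apply, h])
    ((polyBdd_const 2).mono fun x => sz_bool_le _)) (pair hf hg)

theorem cond {c : α → Bool} {f g : α → β} (hc : PolyTime c) (hf : PolyTime f) (hg : PolyTime g) :
    PolyTime fun a => if c a = true then f a else g a := by
  obtain ⟨R, r, hr, hR⟩ := hc
  obtain ⟨P, p, hp, hP⟩ := hf
  obtain ⟨Q, q, hq, hQ⟩ := hg
  refine ⟨.ite R P Q, fun a => 1 + sz a + r a + p a + q a,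
    ((((polyBdd_const 1).add FlowTime.polyBdd_sz).add hr).add hp).add hq, fun a => ?_⟩
  obtain ⟨t, ht, h1⟩ := hR a
  obtain ⟨u, hu, h2⟩ := hP a
  obtain ⟨w, hw, h3⟩ := hQ a
  beta_reduce
  cases h : c a with
  | true =>
    rw [h] at h1
    exact ⟨1 + sz a + t + u, by omega, by
      rw [if_pos rfl]; exact Runs.iteTrue h1 (by simp [enc]) h2⟩
  | false =>
    rw [h] at h1
    exact ⟨1 + sz a + t + w, by omega, by
      rw [if_neg (by decide)]; exact Runs.iteFalse h1 h3⟩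

@[fun_prop]
theorem ite {c : α → Prop} [DecidablePred c] {f g : α → β} (hc : PolyTime fun a => decide (c a))
    (hf : PolyTime f) (hg : PolyTime g) : PolyTime fun a => if c a then f a else g a :=
  congr (cond hc hf hg) fun a => by simp

@[fun_prop]
theorem and {c d : α → Prop} [DecidablePred c] [DecidablePred d]
    (hc : PolyTime fun a => decide (c a)) (hd : PolyTime fun a => decide (d a)) :
    PolyTime fun a => decide (c a ∧ d a) :=
  congr (cond hc hd (const false)) fun a => by by_cases h : c a <;> simp [h]

@[fun_prop]
theorem le {f g : α → ℕ} (hf : PolyTime f) (hg : PolyTime g) :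
    PolyTime fun a => decide (f a ≤ g a) :=
  congr (lt hf (add hg (const 1))) fun a => by simp

@[fun_prop]
theorem natEq {f g : α → ℕ} (hf : PolyTime f) (hg : PolyTime g) :
    PolyTime fun a => decide (f a = g a) :=
  congr (and (le hf hg) (le hg hf)) fun a => by
    by_cases h : f a = g a
    · simp [h]
    · simp only [h, decide_false]; symm; simp only [decide_eq_false_iff_not]; omega

@[fun_prop]
theorem min {f g : α → ℕ} (hf : PolyTime f) (hg : PolyTime g) : PolyTime fun a => min (f a) (g a) :=
  congr (ite (le hf hg) hf hg) fun a => by rw [min_def]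

@[fun_prop]
theorem max {f g : α → ℕ} (hf : PolyTime f) (hg : PolyTime g) : PolyTime fun a => max (f a) (g a) :=
  congr (ite (le hf hg) hg hf) fun a => by rw [max_def]

/-- Every function on an initial segment of the natural numbers is tabulated by a program. -/
theorem table (F : ℕ → ℕ) (n : ℕ) {f : α → ℕ} (hf : PolyTime f) :
    PolyTime fun a => if f a < n then F (f a) else 0 := by
  induction n with
  | zero => simpa using const (α := α) 0
  | succ n ih =>
    refine congr (ite (natEq hf (const n)) (const (F n)) ih) fun a => ?_
    by_cases h : f a = n
    · simp [h]
    · have : f a < n + 1 ↔ f a < n := by omega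
      simp [h, this]

@[fun_prop]
theorem cons {f : α → β} {l : α → List β} (hf : PolyTime f) (hl : PolyTime l) :
    PolyTime fun a => f a :: l a := pair hf hl

/-- Case distinction on a list. -/
theorem listCases {l : α → List β} {f : α → γ} {g : α × β × List β → γ} (hl : PolyTime l)
    (hf : PolyTime f) (hg : PolyTime g) :
    PolyTime fun a => match l a with
      | [] => f a
      | b :: m => g (a, b, m) := by
  have hl' : PolyTime fun a => (a, l a) := pair id hl
  have hs := hl'.polyBdd_sz
  obtain ⟨R, r, hr, hR⟩ := hl'
  obtain ⟨P, p, hp, hP⟩ := (comp hf (fst' (α := α) (β := List β)))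
  obtain ⟨Q, q, hq, hQ⟩ := hg
  -- the two time bounds are polynomial in the size of the pair `(a, l a)`
  obtain ⟨k, hk⟩ := hq
  refine ⟨.seq R (.ite (.seq (.prim .snd) (.prim .isNum)) P Q), fun a =>
    r a + p (a, l a) + (sz (a, l a) + 2) ^ k + (10 * sz (a, l a) + 10),
    ((hr.add (hp.comp hs)).add ((hs.add (polyBdd_const 2)).pow k)).add
      (((polyBdd_const 10).mul hs).add (polyBdd_const 10)), fun a => ?_⟩
  obtain ⟨t, ht, h1⟩ := hR a
  beta_reduce at h1 ⊢
  have hsnd : Runs (.prim .snd) (enc (a, l a)) (enc (l a)) (1 + sz (a, l a) + sz (l a)) :=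
    Runs.prim .snd (enc (a, l a))
  have hnum := Runs.prim .isNum (enc (l a))
  have hsz := sz_pair a (l a)
  cases h : l a with
  | nil =>
    obtain ⟨u, hu, h2⟩ := hP (a, l a)
    rw [h] at hu h2 h1 hsnd hnum hsz
    have := h1.seq (Runs.iteTrue (R := Q) (hsnd.seq hnum)
      (by simp [enc, Val.ofList, Op.apply]) h2)
    refine ⟨_, ?_, this⟩
    have e1 : (Op.isNum.apply (enc ([] : List β))).size = 2 := by
      simp [enc, Val.ofList, Op.apply, Val.size]
    have e2 : (enc ([] : List β)).size = sz ([] : List β) := rfl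
    have e3 : (enc (a, ([] : List β))).size = sz (a, ([] : List β)) := rfl
    rw [e1, e2, e3]; omega
  | cons b m =>
    obtain ⟨u, hu, h2⟩ := hQ (a, b, m)
    rw [h] at h1 hsnd hnum hsz
    have := h1.seq (Runs.iteFalse (Q := P) (hsnd.seq hnum) h2)
    refine ⟨_, ?_, this⟩
    have e1 : (Op.isNum.apply (enc (b :: m))).size = 1 := rfl
    have e2 : (enc (b :: m)).size = sz (b :: m) := rfl
    have e3 : (enc (a, b :: m)).size = sz (a, b :: m) := rfl
    have e4 := hk (a, b, m)
    have e5 : sz (a, b, m) = sz (a, b :: m) := rfl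
    rw [e5] at e4
    rw [e1, e2, e3]; omega

/-- A loop that runs for a polynomial number of rounds on states of polynomial size. -/
theorem loop {init : α → σ} {step : σ → σ} {test : σ → Bool} {n B : α → ℕ}
    (hi : PolyTime init) (hs : PolyTime step) (ht : PolyTime test) (hn : PolyBdd n)
    (hB : PolyBdd B) (hcont : ∀ a, ∀ i < n a, test (step^[i] (init a)) = true)
    (hdone : ∀ a, test (step^[n a] (init a)) = false)
    (hsz : ∀ a, ∀ i ≤ n a, sz (step^[i] (init a)) ≤ B a) :
    PolyTime fun a => step^[n a] (init a) := by
  obtain ⟨P, p, hp, hP⟩ := hi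
  obtain ⟨Q, q, ⟨k, hk⟩, hQ⟩ := hs
  obtain ⟨R, r, ⟨l, hl⟩, hR⟩ := ht
  have key : ∀ a, ∀ m, ∀ i, m + i = n a → ∃ t ≤ (m + 1) * (1 + B a + (B a + 2) ^ k +
      (B a + 2) ^ l),
      Runs (.while R Q) (enc (step^[i] (init a))) (enc (step^[n a] (init a))) t := by
    intro a m
    induction m with
    | zero =>
      intro i him
      obtain rfl : i = n a := by omega
      obtain ⟨t, ht, h1⟩ := hR (step^[n a] (init a))
      rw [hdone a] at h1
      refine ⟨_, ?_, Runs.whileDone h1⟩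
      have e1 := hsz a (n a) le_rfl
      have e2 := (ht.trans (hl _)).trans (Nat.pow_le_pow_left (Nat.add_le_add_right e1 2) l)
      have e3 : (enc (step^[n a] (init a))).size ≤ B a := e1
      omega
    | succ m ih =>
      intro i him
      obtain ⟨t, ht, h1⟩ := hR (step^[i] (init a))
      obtain ⟨u, hu, h2⟩ := hQ (step^[i] (init a))
      obtain ⟨w, hw, h3⟩ := ih (i + 1) (by omega)
      rw [hcont a i (by omega)] at h1
      rw [← Function.iterate_succ_apply' step] at h2
      refine ⟨_, ?_, Runs.whileStep h1 (by simp [enc]) h2 h3⟩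
      have e1 := hsz a i (by omega)
      have e2 := (ht.trans (hl _)).trans (Nat.pow_le_pow_left (Nat.add_le_add_right e1 2) l)
      have e4 := (hu.trans (hk _)).trans (Nat.pow_le_pow_left (Nat.add_le_add_right e1 2) k)
      have e3 : (enc (step^[i] (init a))).size ≤ B a := e1
      rw [add_mul (m + 1), one_mul]; omega
  refine ⟨.seq P (.while R Q), fun a => 1 + p a + (n a + 1) * (1 + B a + (B a + 2) ^ k +
      (B a + 2) ^ l), ((polyBdd_const 1).add hp).add ((hn.add (polyBdd_const 1)).mul
      ((((polyBdd_const 1).add hB).add ((hB.add (polyBdd_const 2)).pow k)).add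
      ((hB.add (polyBdd_const 2)).pow l))), fun a => ?_⟩
  obtain ⟨t, ht, h1⟩ := hP a
  obtain ⟨u, hu, h2⟩ := key a (n a) 0 (by omega)
  exact ⟨_, by simp only; omega, h1.seq h2⟩

/-- Folding over a list, where the accumulators have polynomial size. -/
theorem foldl {l : α → List β} {g : α → σ} {h : α → σ → β → σ} {B : α → ℕ} (hl : PolyTime l)
    (hg : PolyTime g) (hh : PolyTime fun x : α × σ × β => h x.1 x.2.1 x.2.2) (hB : PolyBdd B)
    (hsz : ∀ a, ∀ m, m <+: l a → sz (m.foldl (h a) (g a)) ≤ B a) :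
    PolyTime fun a => (l a).foldl (h a) (g a) := by
  let step : α × List β × σ → α × List β × σ := fun s =>
    match s.2.1 with
    | [] => s
    | b :: m => (s.1, m, h s.1 s.2.2 b)
  have hstep : PolyTime step := by
    refine listCases (g := fun x : (α × List β × σ) × β × List β =>
      (x.1.1, x.2.2, h x.1.1 x.1.2.2 x.2.1)) (by fun_prop) (by fun_prop) ?_
    have h1 : PolyTime fun x : (α × List β × σ) × β × List β => (x.1.1, x.1.2.2, x.2.1) := by
      fun_prop
    have := comp hh h1
    exact pair (by fun_prop) (pair (by fun_prop) this)
  have htest : PolyTime fun s : α × List β × σ => !s.2.1.isEmpty := by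
    refine congr (listCases (l := fun s : α × List β × σ => s.2.1) (f := fun _ => false)
      (g := fun _ => true) (by fun_prop) (const _) (const _)) fun s => ?_
    rcases s with ⟨a, l | l, s⟩ <;> rfl
  have hit : ∀ a i,
      step^[i] (a, l a, g a) = (a, (l a).drop i, ((l a).take i).foldl (h a) (g a)) := by
    intro a i
    induction i with
    | zero => simp
    | succ i ih =>
      rw [Function.iterate_succ_apply', ih]
      by_cases hi : i < (l a).length
      · simp only [step, List.drop_eq_getElem_cons hi]
        rw [List.take_succ_eq_append_getElem hi, List.foldl_append]
        rfl
      · rw [List.drop_eq_nil_of_le (by omega), List.drop_eq_nil_of_le (by omega),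
          List.take_of_length_le (by omega), List.take_of_length_le (by omega)]
  have := loop (init := fun a => (a, l a, g a)) (step := step) (n := fun a => (l a).length)
    (B := fun a => 2 + sz a + sz (l a) + B a) (by fun_prop) hstep htest
    (hl.polyBdd_sz.mono fun a => length_le_sz _)
    ((((polyBdd_const 2).add FlowTime.polyBdd_sz).add hl.polyBdd_sz).add hB) ?_ ?_ ?_
  · refine congr (snd (snd this)) fun a => ?_
    simp [hit]
  · intro a i hi
    simp [hit]; omega
  · intro a
    simp [hit]
  · intro a i hi
    rw [hit, sz_pair, sz_pair]
    have h1 := hsz a _ (List.take_prefix i (l a))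
    have h2 := sz_sublist (List.drop_sublist i (l a))
    omega

end PolyTime

end Basic

section Lists

variable {α β γ : Type} [Enc α] [Enc β] [Enc γ]

namespace PolyTime

/-! ### Operations on lists -/

@[fun_prop]
theorem append {f g : α → List β} (hf : PolyTime f) (hg : PolyTime g) :
    PolyTime fun a => f a ++ g a := by
  have hrev : ∀ {u : α × List β → List β} {v : α × List β → List β}, PolyTime u → PolyTime v →
      PolyTime fun x => (u x).foldl (fun m b => b :: m) (v x) := by
    intro u v hu hv
    refine foldl (h := fun _ m b => b :: m) (B := fun x => sz (u x) + sz (v x)) hu hv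
      (by fun_prop) (hu.polyBdd_sz.add hv.polyBdd_sz) fun x m hm => ?_
    rw [List.foldl_flip_cons_eq_append, List.map_id']
    have h1 := sz_append m.reverse (v x)
    have h2 := sz_perm m.reverse_perm
    have h3 := sz_sublist hm.sublist
    omega
  have h1 := hrev (u := fun x => f x.1) (v := fun _ => []) (by fun_prop) (by fun_prop)
  have h2 := comp (hrev (u := fun x => x.2) (v := fun x => g x.1) (by fun_prop) (by fun_prop))
    (pair id (comp h1 (pair id (const []))))
  refine congr h2 fun a => ?_
  simp [List.foldl_flip_cons_eq_append]

/-- Folding a list into a list by appending what each entry contributes. -/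
@[fun_prop]
theorem flatMap {l : α → List β} {f : α → β → List γ} (hl : PolyTime l)
    (hf : PolyTime fun x : α × β => f x.1 x.2) : PolyTime fun a => (l a).flatMap (f a) := by
  have hb := hf.polyBdd_sz
  obtain ⟨k, hk⟩ := hb
  have key : ∀ a, ∀ m : List β, ∀ m',
      (m.foldl (fun s b => s ++ f a b) m') = m' ++ m.flatMap (f a) := by
    intro a m
    induction m with
    | nil => simp
    | cons b m ih => intro m'; simp [ih]
  have := foldl (h := fun a (s : List γ) b => s ++ f a b) (g := fun _ => [])
    (B := fun a => 1 + sz (l a) * (1 + sz a + sz (l a) + 2) ^ k) hl (by fun_prop)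
    (append (by fun_prop) (comp hf (g := fun x : α × β => f x.1 x.2)
      (f := fun x : α × List γ × β => (x.1, x.2.2)) (by fun_prop)))
    ((polyBdd_const 1).add (hl.polyBdd_sz.mul
      (((((polyBdd_const 1).add FlowTime.polyBdd_sz).add hl.polyBdd_sz).add
      (polyBdd_const 2)).pow k)))
    (fun a m hm => by
      rw [key, List.nil_append]
      have h1 : ∀ b ∈ m, sz (f a b) ≤ (1 + sz a + sz (l a) + 2) ^ k := fun b hb => by
        refine (hk (a, b)).trans (Nat.pow_le_pow_left ?_ k)
        have := sz_le_of_mem (hm.subset hb)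
        rw [sz_pair]; omega
      have h2 : sz (m.flatMap (f a)) ≤ 1 + m.length * (1 + sz a + sz (l a) + 2) ^ k := by
        clear hm
        induction m with
        | nil => simp
        | cons b m ih =>
          have e1 := ih fun b hb => h1 b (List.mem_cons_of_mem _ hb)
          have e2 := h1 b List.mem_cons_self
          have e3 := sz_append (f a b) (m.flatMap (f a))
          rw [List.flatMap_cons, List.length_cons, add_mul, one_mul]; omega
      have h3 := Nat.mul_le_mul_right ((1 + sz a + sz (l a) + 2) ^ k)
        (hm.length_le.trans (length_le_sz (l a)))
      omega)
  refine congr this fun a => ?_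
  simp [key]

@[fun_prop]
theorem map {l : α → List β} {f : α → β → γ} (hl : PolyTime l)
    (hf : PolyTime fun x : α × β => f x.1 x.2) : PolyTime fun a => (l a).map (f a) :=
  congr (flatMap (f := fun a b => [f a b]) hl (cons hf (const []))) fun a => by
    exact List.map_eq_flatMap

@[fun_prop]
theorem filter {l : α → List β} {c : α → β → Bool} (hl : PolyTime l)
    (hc : PolyTime fun x : α × β => c x.1 x.2) : PolyTime fun a => (l a).filter (c a) :=
  congr (flatMap (f := fun a b => if c a b = true then [b] else []) hl
    (cond hc (by fun_prop) (by fun_prop))) fun a => by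
      induction l a with
      | nil => rfl
      | cons b m ih => by_cases h : c a b <;> simp [h, ih]

@[fun_prop]
theorem reverse {l : α → List β} (hl : PolyTime l) : PolyTime fun a => (l a).reverse := by
  refine congr (foldl (g := fun _ => []) (h := fun _ (m : List β) b => b :: m)
    (B := fun a => sz (l a)) hl (by fun_prop) (by fun_prop) hl.polyBdd_sz fun a m hm => ?_)
    fun a => by simp
  have h := sz_sublist hm.sublist
  have h2 := sz_perm m.reverse_perm
  rw [List.foldl_flip_cons_eq_append, List.append_nil, List.map_id']; omega

@[fun_prop]
theorem sum {l : α → List ℕ} (hl : PolyTime l) : PolyTime fun a => (l a).sum := by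
  refine congr (foldl (g := fun _ => 0) (h := fun _ s b => s + b) (B := fun a => sz (l a) + 1) hl
    (by fun_prop) (by fun_prop) (hl.polyBdd_sz.add (polyBdd_const 1)) fun a m hm => ?_)
    fun a => by rw [List.sum_eq_foldl]
  have h := sz_sublist hm.sublist
  have h2 : ∀ s : ℕ, sz (m.foldl (fun s b => s + b) s) ≤ sz m + sz s := by
    clear h hm
    induction m with
    | nil => intro s; simp
    | cons b m ih =>
      intro s
      have h1 := ih (s + b)
      have h2 := sz_add_le s b
      simp only [List.foldl_cons, sz_cons]; omega
  have h3 := h2 0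
  have h4 : sz 0 = 1 := by simp [sz_nat]
  omega

@[fun_prop]
theorem length {l : α → List β} (hl : PolyTime l) : PolyTime fun a => (l a).length :=
  congr (f := fun a => ((l a).map fun _ => 1).sum) (by fun_prop) fun a => by simp

/-- Lists serve as unary numbers: only their length matters. -/
@[fun_prop]
theorem range_length {l : α → List β} (hl : PolyTime l) :
    PolyTime fun a => List.range (l a).length := by
  have key : ∀ m : List β, m.foldl (fun (s : List ℕ) _ => s ++ [s.length]) [] =
      List.range m.length := by
    intro m
    induction m using List.reverseRecOn with
    | nil => rfl
    | append_singleton m b ih => simp [ih, List.range_succ]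
  refine congr (foldl (g := fun _ => []) (h := fun _ (s : List ℕ) (_ : β) => s ++ [s.length])
    (B := fun a => 1 + sz (l a) * (1 + (1 + sz (l a)))) hl (by fun_prop) (by fun_prop) ?_ ?_)
    fun a => (key _).symm
  · have := hl.polyBdd_sz
    exact (polyBdd_const 1).add (this.mul ((polyBdd_const 1).add ((polyBdd_const 1).add this)))
  · intro a m hm
    have h := hm.length_le.trans (length_le_sz (l a))
    rw [key]
    refine (sz_list_le (B := 1 + sz (l a)) fun i hi => ?_).trans ?_
    · have := sz_nat_le i
      have := List.mem_range.1 hi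
      omega
    · rw [List.length_range]
      exact Nat.add_le_add_left (Nat.mul_le_mul_right _ h) _

/-- The binary length of a number, in unary. -/
@[fun_prop]
theorem replicate_size {f : α → ℕ} (hf : PolyTime f) :
    PolyTime fun a => List.replicate (Nat.size (f a)) 0 := by
  have hit : ∀ n i : ℕ, (fun s : ℕ × List ℕ => (s.1 / 2, 0 :: s.2))^[i] (n, []) =
      (n / 2 ^ i, List.replicate i 0) := by
    intro n i
    induction i with
    | zero => simp
    | succ i ih =>
      rw [Function.iterate_succ_apply', ih, Nat.div_div_eq_div_mul, pow_succ, List.replicate_succ]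
  have hz : ∀ i : ℕ, sz (List.replicate i 0) = 2 * i + 1 := by
    intro i
    induction i with
    | zero => simp
    | succ i ih =>
      have : sz 0 = 1 := by simp [sz_nat]
      rw [List.replicate_succ, sz_cons, ih]; omega
  have := loop (init := fun a : ℕ => (a, ([] : List ℕ))) (step := fun s => (s.1 / 2, 0 :: s.2))
    (test := fun s => decide (0 < s.1)) (n := fun a => Nat.size a)
    (B := fun a => 2 + 3 * sz a) (by fun_prop) (by fun_prop) (by fun_prop)
    (FlowTime.polyBdd_sz.mono fun a => by rw [sz_nat]; omega)
    ((polyBdd_const 2).add ((polyBdd_const 3).mul FlowTime.polyBdd_sz)) ?_ ?_ ?_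
  · refine congr (comp (snd this) hf) fun a => ?_
    rw [hit]
  · intro a i hi
    rw [hit, decide_eq_true_eq]
    exact Nat.div_pos (Nat.lt_size.1 hi) (by positivity)
  · intro a
    rw [hit, decide_eq_false_iff_not, Nat.div_eq_of_lt (Nat.lt_size_self a)]
    omega
  · intro a i hi
    have h1 := sz_nat_mono (Nat.div_le_self a (2 ^ i))
    have h2 := sz_nat a
    rw [hit, sz_pair, hz]; omega

@[fun_prop]
theorem two_pow_length {l : α → List β} (hl : PolyTime l) : PolyTime fun a => 2 ^ (l a).length := by
  have key : ∀ m : List β, m.foldl (fun (s : ℕ) _ => 2 * s) 1 = 2 ^ m.length := by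
    intro m
    induction m using List.reverseRecOn with
    | nil => rfl
    | append_singleton m b ih =>
      rw [List.foldl_append, ih, List.length_append, pow_add]
      simp [mul_comm]
  refine congr (foldl (g := fun _ => 1) (h := fun _ (s : ℕ) (_ : β) => 2 * s)
    (B := fun a => sz (l a) + 2) hl (by fun_prop) (by fun_prop)
    (hl.polyBdd_sz.add (polyBdd_const 2)) fun a m hm => ?_) fun a => (key _).symm
  have h := hm.length_le.trans (length_le_sz (l a))
  rw [key, sz_two_pow]; omega

end PolyTime

end Lists

/-! ### Selection and sorting -/

section Sorting

variable {β : Type}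

/-- The first entry of a list that is best for the relation `le`, as a list with at most one
entry. -/
def pick (le : β → β → Bool) (l : List β) : List β :=
  l.foldl (fun s b => if (s.filter fun c => le c b).length = 0 then [b] else s) []

theorem pick_eq (le : β → β → Bool) (l : List β) : pick le l = [] ∨ ∃ b ∈ l, pick le l = [b] := by
  unfold pick
  induction l using List.reverseRecOn with
  | nil => simp
  | append_singleton l b ih =>
    rw [List.foldl_append, List.foldl_cons, List.foldl_nil]
    split_ifs
    · exact .inr ⟨b, by simp, rfl⟩
    · rcases ih with h | ⟨c, hc, h⟩
      · exact .inl h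
      · exact .inr ⟨c, by simp [hc], h⟩

theorem mem_of_mem_pick {le : β → β → Bool} {l : List β} {b : β} (h : b ∈ pick le l) : b ∈ l := by
  rcases pick_eq le l with h' | ⟨c, hc, h'⟩
  · simp [h'] at h
  · rw [h', List.mem_singleton] at h
    rwa [h]

theorem exists_mem_pick {le : β → β → Bool} (hrefl : ∀ a, le a a)
    (htrans : ∀ a b c, le a b → le b c → le a c) (htotal : ∀ a b, ¬ le a b → le b a) {l : List β}
    {b : β} (hb : b ∈ l) : ∃ c ∈ pick le l, le c b := by
  unfold pick
  induction l using List.reverseRecOn with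
  | nil => simp at hb
  | append_singleton l a ih =>
    rw [List.foldl_append, List.foldl_cons, List.foldl_nil]
    rw [List.mem_append, List.mem_singleton] at hb
    change (b ∈ l → ∃ c ∈ pick le l, _) at ih
    change ∃ c ∈ (if ((pick le l).filter _).length = 0 then _ else pick le l), _
    split_ifs with h
    · refine ⟨a, by simp, ?_⟩
      rcases hb with hb | rfl
      · obtain ⟨c, hc, hcb⟩ := ih hb
        rw [List.length_eq_zero_iff, List.filter_eq_nil_iff] at h
        exact htrans _ _ _ (htotal _ _ (h c hc)) hcb
      · exact hrefl _
    · rcases hb with hb | rfl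
      · exact ih hb
      · obtain ⟨c, hc⟩ := List.exists_mem_of_length_pos (Nat.pos_of_ne_zero h)
        rw [List.mem_filter] at hc
        exact ⟨c, hc⟩

@[fun_prop]
theorem PolyTime.pick {α : Type} [Enc α] [Enc β] {l : α → List β} {le : α → β → β → Bool}
    (hl : PolyTime l)
    (hle : PolyTime fun x : α × β × β => le x.1 x.2.1 x.2.2) :
    PolyTime fun a => pick (le a) (l a) := by
  refine foldl (h := fun a (s : List β) b => if (s.filter fun c => le a c b).length = 0 then [b]
    else s) (g := fun _ => []) (B := fun a => 2 + sz (l a)) hl (by fun_prop) ?_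
    ((polyBdd_const 2).add hl.polyBdd_sz) fun a m hm => ?_
  · have := comp hle (f := fun y : (α × List β × β) × β => (y.1.1, y.2, y.1.2.2)) (by fun_prop)
    fun_prop
  · change sz (FlowTime.pick (le a) m) ≤ _
    rcases pick_eq (le a) m with h | ⟨b, hb, h⟩
    · rw [h, sz_nil]; omega
    · have := sz_le_of_mem (hm.subset hb)
      rw [h, sz_cons, sz_nil]; omega

/-- Insertion of an entry into a list that is sorted by a key. -/
def insertKey (key : β → ℕ) (b : β) (l : List β) : List β :=
  l.filter (fun c => key c ≤ key b) ++ b :: l.filter (fun c => key b < key c)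

/-- Insertion sort by a key. -/
def sortKey (key : β → ℕ) (l : List β) : List β := l.foldl (fun s b => insertKey key b s) []

theorem insertKey_perm (key : β → ℕ) (b : β) (l : List β) : (insertKey key b l).Perm (b :: l) := by
  refine List.perm_middle.trans (List.Perm.cons _ ?_)
  refine List.Perm.trans ?_ (List.filter_append_perm (fun c => decide (key c ≤ key b)) l)
  rw [show (fun c => decide (key b < key c)) = fun c => !decide (key c ≤ key b) by
    funext c; rw [← decide_not, decide_eq_decide]; exact not_le.symm]

theorem sortKey_perm (key : β → ℕ) (l : List β) : (sortKey key l).Perm l := by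
  unfold sortKey
  induction l using List.reverseRecOn with
  | nil => simp
  | append_singleton l b ih =>
    rw [List.foldl_append, List.foldl_cons, List.foldl_nil]
    exact (insertKey_perm _ _ _).trans ((ih.cons b).trans (List.perm_append_singleton b l).symm)

theorem sortKey_sorted (key : β → ℕ) (l : List β) :
    (sortKey key l).Pairwise fun a b => key a ≤ key b := by
  unfold sortKey
  induction l using List.reverseRecOn with
  | nil => simp
  | append_singleton l b ih =>
    rw [List.foldl_append, List.foldl_cons, List.foldl_nil, insertKey, List.pairwise_append]
    refine ⟨ih.filter _, List.pairwise_cons.2 ⟨fun c hc => ?_, ih.filter _⟩, fun c hc e he => ?_⟩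
    · simp only [List.mem_filter, decide_eq_true_eq] at hc; exact hc.2.le
    · simp only [List.mem_filter, List.mem_cons, decide_eq_true_eq] at hc he
      rcases he with rfl | he
      · exact hc.2
      · exact hc.2.trans he.2.le

@[fun_prop]
theorem PolyTime.sortKey {α : Type} [Enc α] [Enc β] {l : α → List β} {key : α → β → ℕ}
    (hl : PolyTime l)
    (hk : PolyTime fun x : α × β => key x.1 x.2) : PolyTime fun a => sortKey (key a) (l a) := by
  refine foldl (h := fun a (s : List β) b => insertKey (key a) b s) (g := fun _ => [])
    (B := fun a => sz (l a)) hl (by fun_prop) ?_ hl.polyBdd_sz fun a m hm => ?_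
  · unfold insertKey
    have h1 := comp hk (f := fun y : (α × List β × β) × β => (y.1.1, y.2)) (by fun_prop)
    have h2 := comp hk (f := fun y : (α × List β × β) × β => (y.1.1, y.1.2.2)) (by fun_prop)
    fun_prop
  · exact (sz_perm (sortKey_perm _ _)).trans_le (sz_sublist hm.sublist)

end Sorting

/-! ### The dynamic program over dyadic cells -/

/-- A job as the program stores it: index, processing time, (shifted) release time, weight. -/
abbrev JobData := ℕ × ℕ × ℕ × ℕ

/-- A partial solution for a cell: its scaled cost, the latest time by which all the work that
precedes it has to be finished, and the list of the chosen segments, each given by the index of the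
job and the end of the segment. -/
abbrev Cand := ℕ × ℕ × List (ℕ × ℕ)

/-- For every cost below `u.length`, keep one candidate that leaves most room for earlier work. -/
def prune (u : List ℕ) (t : List Cand) : List Cand :=
  (List.range u.length).flatMap fun c =>
    pick (fun x y : Cand => decide (y.2.1 ≤ x.2.1)) (t.filter fun x => x.1 = c)

/-- Decide on one more job: either its segment with end `e` is chosen and paid for, or the job has
to be processed before the remaining work. -/
def addJob (u : List ℕ) (sc : JobData → ℕ → ℕ) (e : ℕ) (t : List Cand) (j : JobData) : List Cand :=
  prune u (t.flatMap fun x => (x.1 + sc j e, x.2.1, (j.1, e) :: x.2.2) ::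
    if j.2.2.1 + j.2.1 ≤ x.2.1 then [(x.1, x.2.1 - j.2.1, x.2.2)] else [])

/-- Combine the tables of the two halves of a cell. -/
def combine (u : List ℕ) (t₁ t₂ : List Cand) : List Cand :=
  prune u (t₁.flatMap fun x => t₂.map fun y => (x.1 + y.1, min x.2.1 y.2.1, x.2.2 ++ y.2.2))

/-- The table of the cell `[q * d, (q + 1) * d)`. Cells that are not listed have no jobs nearby, so
that there is nothing to choose for them. -/
def lookup (d q : ℕ) (l : List (ℕ × List Cand)) : List Cand :=
  l.foldl (fun s e => if e.1 = q then e.2 else s) [(0, q * d, [])]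

/-- The table of the cell `[q * d, (q + 1) * d)` after the decisions on the jobs whose segments are
equal to this cell. -/
def child (u : List ℕ) (sc : JobData → ℕ → ℕ) (js : List JobData) (d q : ℕ)
    (l : List (ℕ × List Cand)) : List Cand :=
  (js.filter fun j => q / 2 * (2 * d) < j.2.2.1 + 2 * d ∧ j.2.2.1 + d ≤ q * d).foldl
    (addJob u sc ((q + 1) * d)) (lookup d q l)

/-- One step of the dynamic program: from the tables of the cells of length `s.1` to those of the
cells of twice this length. -/
def level (u : List ℕ) (sc : JobData → ℕ → ℕ) (js : List JobData) (s : ℕ × List (ℕ × List Cand)) :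
    ℕ × List (ℕ × List Cand) :=
  (2 * s.1, (js.flatMap fun j => [j.2.2.1 / (2 * s.1), j.2.2.1 / (2 * s.1) + 1]).map fun q =>
    (q, combine u (child u sc js s.1 (2 * q) s.2) (child u sc js s.1 (2 * q + 1) s.2)))

/-- The table of the root cell `[2 ^ K, 2 ^ (K + 1))`, where `K` is the length of `v`. -/
def rootTable (u : List ℕ) (sc : JobData → ℕ → ℕ) (js : List JobData) (v : List ℕ) : List Cand :=
  lookup (v.foldl (fun s _ => level u sc js s) (1, [])).1 1
    (v.foldl (fun s _ => level u sc js s) (1, [])).2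

section Tables

variable {u : List ℕ} {sc : JobData → ℕ → ℕ} {js : List JobData}

theorem mem_prune {t : List Cand} {x : Cand} (h : x ∈ prune u t) : x ∈ t ∧ x.1 < u.length := by
  obtain ⟨c, hc, hx⟩ := List.mem_flatMap.1 h
  have := mem_of_mem_pick hx
  simp only [List.mem_filter, decide_eq_true_eq] at this
  rw [this.2]
  exact ⟨this.1, List.mem_range.1 hc⟩

theorem exists_mem_prune {t : List Cand} {x : Cand} (h : x ∈ t) (hx : x.1 < u.length) :
    ∃ y ∈ prune u t, y.1 = x.1 ∧ x.2.1 ≤ y.2.1 := by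
  obtain ⟨y, hy, hxy⟩ := exists_mem_pick (le := fun x y : Cand => decide (y.2.1 ≤ x.2.1))
    (l := t.filter fun y => y.1 = x.1) (b := x) (fun a => by simp)
    (fun a b c hab hbc => by simp only [decide_eq_true_eq] at *; omega)
    (fun a b hab => by simp only [decide_eq_true_eq] at *; omega) (by simp [h])
  refine ⟨y, List.mem_flatMap.2 ⟨x.1, List.mem_range.2 hx, hy⟩, ?_, by simpa using hxy⟩
  have := mem_of_mem_pick hy
  simp only [List.mem_filter, decide_eq_true_eq] at this
  exact this.2

theorem length_prune (u : List ℕ) (t : List Cand) : (prune u t).length ≤ u.length := by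
  have h : ∀ m : List ℕ, (m.flatMap fun c => pick (fun x y : Cand => decide (y.2.1 ≤ x.2.1))
      (t.filter fun x => x.1 = c)).length ≤ m.length := by
    intro m
    induction m with
    | nil => simp
    | cons c m ih =>
      rw [List.flatMap_cons, List.length_append, List.length_cons]
      have : (pick (fun x y : Cand => decide (y.2.1 ≤ x.2.1))
          (t.filter fun x => x.1 = c)).length ≤ 1 := by
        rcases pick_eq (fun x y : Cand => decide (y.2.1 ≤ x.2.1)) (t.filter fun x => x.1 = c)
          with h | ⟨b, -, h⟩ <;> simp [h]
      omega
  exact (h (List.range u.length)).trans_eq List.length_range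

theorem mem_addJob {e : ℕ} {t : List Cand} {j : JobData} {x : Cand} (h : x ∈ addJob u sc e t j) :
    x.1 < u.length ∧ ∃ y ∈ t, x = (y.1 + sc j e, y.2.1, (j.1, e) :: y.2.2) ∨
      j.2.2.1 + j.2.1 ≤ y.2.1 ∧ x = (y.1, y.2.1 - j.2.1, y.2.2) := by
  obtain ⟨h, hx⟩ := mem_prune h
  refine ⟨hx, ?_⟩
  obtain ⟨y, hy, h⟩ := List.mem_flatMap.1 h
  refine ⟨y, hy, ?_⟩
  rw [List.mem_cons] at h
  refine h.imp_right fun h => ?_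
  split_ifs at h with h'
  · exact ⟨h', List.mem_singleton.1 h⟩
  · simp at h

theorem mem_combine {t₁ t₂ : List Cand} {x : Cand} (h : x ∈ combine u t₁ t₂) :
    x.1 < u.length ∧ ∃ y ∈ t₁, ∃ z ∈ t₂, x = (y.1 + z.1, min y.2.1 z.2.1, y.2.2 ++ z.2.2) := by
  obtain ⟨h, hx⟩ := mem_prune h
  refine ⟨hx, ?_⟩
  obtain ⟨y, hy, h⟩ := List.mem_flatMap.1 h
  obtain ⟨z, hz, h⟩ := List.mem_map.1 h
  exact ⟨y, hy, z, hz, h.symm⟩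

theorem lookup_cases (d q : ℕ) (l : List (ℕ × List Cand)) :
    (lookup d q l = [(0, q * d, [])] ∧ ∀ e ∈ l, e.1 ≠ q) ∨
      ∃ e ∈ l, e.1 = q ∧ lookup d q l = e.2 := by
  unfold lookup
  induction l using List.reverseRecOn with
  | nil => simp
  | append_singleton l b ih =>
    rw [List.foldl_append, List.foldl_cons, List.foldl_nil]
    split_ifs with h
    · exact .inr ⟨b, by simp, h, rfl⟩
    · rcases ih with ⟨h1, h2⟩ | ⟨e, he, h1⟩
      · refine .inl ⟨h1, fun e he => ?_⟩
        rw [List.mem_append, List.mem_singleton] at he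
        rcases he with he | rfl
        · exact h2 e he
        · exact h
      · exact .inr ⟨e, by simp [he], h1⟩

/-- The state of the dynamic program after `i` steps. -/
def levels (u : List ℕ) (sc : JobData → ℕ → ℕ) (js : List JobData) (i : ℕ) :
    List (ℕ × List Cand) := ((level u sc js)^[i] (1, [])).2

theorem iterate_level (i : ℕ) : (level u sc js)^[i] (1, []) = (2 ^ i, levels u sc js i) := by
  refine Prod.ext ?_ rfl
  induction i with
  | zero => rfl
  | succ i ih => rw [Function.iterate_succ_apply', level, ih, pow_succ, mul_comm]

theorem levels_zero : levels u sc js 0 = [] := rfl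

theorem levels_succ (i : ℕ) : levels u sc js (i + 1) =
    (js.flatMap fun j => [j.2.2.1 / 2 ^ (i + 1), j.2.2.1 / 2 ^ (i + 1) + 1]).map fun q =>
      (q, combine u (child u sc js (2 ^ i) (2 * q) (levels u sc js i))
        (child u sc js (2 ^ i) (2 * q + 1) (levels u sc js i))) := by
  rw [levels, Function.iterate_succ_apply', level, iterate_level, ← pow_succ']

theorem rootTable_eq (v : List ℕ) :
    rootTable u sc js v = lookup (2 ^ v.length) 1 (levels u sc js v.length) := by
  rw [rootTable, List.foldl_const, iterate_level]

/-- A property that is preserved by the operations on candidates holds for all candidates that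
occur in the dynamic program; `Y` bounds all times that occur. -/
theorem child_induction {Q : Cand → Prop} {d q Y : ℕ} {l : List (ℕ × List Cand)}
    (hl : ∀ x ∈ lookup d q l, Q x) (hY : (q + 1) * d ≤ Y)
    (hsel : ∀ x, Q x → ∀ j ∈ js, ∀ e ≤ Y, j.2.2.1 ≤ e → x.1 + sc j e < u.length →
      Q (x.1 + sc j e, x.2.1, (j.1, e) :: x.2.2))
    (hskip : ∀ x, Q x → ∀ n, Q (x.1, x.2.1 - n, x.2.2)) : ∀ x ∈ child u sc js d q l, Q x := by
  unfold child
  have h : ∀ m : List JobData, (∀ j ∈ m, j ∈ js ∧ j.2.2.1 ≤ (q + 1) * d) →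
      ∀ x ∈ m.foldl (addJob u sc ((q + 1) * d)) (lookup d q l), Q x := by
    intro m
    induction m using List.reverseRecOn with
    | nil => exact fun _ => hl
    | append_singleton m j ih =>
      intro hm x hx
      rw [List.foldl_append, List.foldl_cons, List.foldl_nil] at hx
      obtain ⟨hu, y, hy, h⟩ := mem_addJob hx
      have ih := ih (fun j hj => hm j (by simp [hj])) y hy
      have hj := hm j (by simp)
      rcases h with rfl | ⟨-, rfl⟩
      · exact hsel y ih j hj.1 _ hY hj.2 hu
      · exact hskip y ih _
  refine h _ fun j hj => ?_
  simp only [List.mem_filter, decide_eq_true_eq] at hj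
  refine ⟨hj.1, ?_⟩
  have := hj.2.2
  rw [add_mul, one_mul]; omega

theorem levels_induction {Q : Cand → Prop} {K Y : ℕ} (hY : ∀ j ∈ js, j.2.2.1 + 4 * 2 ^ K ≤ Y)
    (h0 : ∀ n ≤ Y, Q (0, n, []))
    (hsel : ∀ x, Q x → ∀ j ∈ js, ∀ e ≤ Y, j.2.2.1 ≤ e → x.1 + sc j e < u.length →
      Q (x.1 + sc j e, x.2.1, (j.1, e) :: x.2.2))
    (hskip : ∀ x, Q x → ∀ n, Q (x.1, x.2.1 - n, x.2.2))
    (hcomb : ∀ x y, Q x → Q y → x.1 + y.1 < u.length →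
      Q (x.1 + y.1, min x.2.1 y.2.1, x.2.2 ++ y.2.2)) :
    ∀ i ≤ K, ∀ e ∈ levels u sc js i, e.1 ≤ Y ∧ e.2.length ≤ u.length ∧ ∀ x ∈ e.2, Q x := by
  intro i
  induction i with
  | zero => intro _ e he; simp [levels_zero] at he
  | succ i ih =>
    intro hi e he
    have ih := ih (by omega)
    rw [levels_succ] at he
    obtain ⟨q, hq, rfl⟩ := List.mem_map.1 he
    obtain ⟨j, hj, hq⟩ := List.mem_flatMap.1 hq
    have hq' : q ≤ j.2.2.1 / 2 ^ (i + 1) + 1 := by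
      simp only [List.mem_cons, List.not_mem_nil, or_false] at hq; omega
    have h1 := hY j hj
    have h2 : 2 ^ (i + 1) ≤ 2 ^ K := Nat.pow_le_pow_right (by omega) hi
    have h3 : 1 ≤ 2 ^ i := Nat.one_le_two_pow
    have h4 := Nat.div_mul_le_self j.2.2.1 (2 ^ (i + 1))
    have h5 : q * 2 ^ (i + 1) ≤ (j.2.2.1 / 2 ^ (i + 1) + 1) * 2 ^ (i + 1) :=
      Nat.mul_le_mul_right _ hq'
    rw [add_mul, one_mul] at h5
    have h6 : ∀ q' ≤ 2 * q + 1, (q' + 1) * 2 ^ i ≤ Y := by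
      intro q' hq'
      have := Nat.mul_le_mul_right (2 ^ i) (Nat.add_le_add_right hq' 1)
      rw [show (2 * q + 1 + 1) * 2 ^ i = q * 2 ^ (i + 1) + 2 ^ (i + 1) by ring] at this
      omega
    have hlk : ∀ q' ≤ 2 * q + 1, ∀ x ∈ lookup (2 ^ i) q' (levels u sc js i), Q x := by
      intro q' hq' x hx
      rcases lookup_cases (2 ^ i) q' (levels u sc js i) with ⟨h, -⟩ | ⟨e, he, -, h⟩
      · rw [h, List.mem_singleton] at hx
        rw [hx]
        have := h6 q' hq'
        rw [add_mul] at this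
        exact h0 _ (by omega)
      · rw [h] at hx
        exact (ih e he).2.2 x hx
    have hch : ∀ q' ≤ 2 * q + 1, ∀ x ∈ child u sc js (2 ^ i) q' (levels u sc js i), Q x :=
      fun q' hq' => child_induction (hlk q' hq') (h6 q' hq') hsel hskip
    refine ⟨?_, length_prune _ _, fun x hx => ?_⟩
    · have := Nat.le_mul_of_pos_right q (show 0 < 2 ^ (i + 1) by positivity)
      change q ≤ Y
      omega
    · obtain ⟨hu, y, hy, z, hz, rfl⟩ := mem_combine hx
      exact hcomb y z (hch _ (by omega) y hy) (hch _ (by omega) z hz) hu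

end Tables

/-! ### The dynamic program runs in polynomial time -/

section

variable {α : Type} [Enc α]

@[fun_prop]
theorem PolyTime.prune {u : α → List ℕ} {t : α → List Cand} (hu : PolyTime u) (ht : PolyTime t) :
    PolyTime fun a => prune (u a) (t a) := by
  unfold FlowTime.prune
  fun_prop

theorem PolyTime.addJob {u : α → List ℕ} {sc : α → JobData → ℕ → ℕ} {e : α → ℕ}
    {t : α → List Cand} {j : α → JobData} (hu : PolyTime u)
    (hsc : PolyTime fun x : α × JobData × ℕ => sc x.1 x.2.1 x.2.2) (he : PolyTime e)
    (ht : PolyTime t) (hj : PolyTime j) :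
    PolyTime fun a => addJob (u a) (sc a) (e a) (t a) (j a) := by
  unfold FlowTime.addJob
  have h : PolyTime fun a => sc a (j a) (e a) :=
    comp hsc (f := fun a => (a, j a, e a)) (by fun_prop)
  fun_prop

@[fun_prop]
theorem PolyTime.combine {u : α → List ℕ} {t₁ t₂ : α → List Cand} (hu : PolyTime u)
    (h₁ : PolyTime t₁) (h₂ : PolyTime t₂) : PolyTime fun a => combine (u a) (t₁ a) (t₂ a) := by
  unfold FlowTime.combine
  fun_prop

@[fun_prop]
theorem PolyTime.lookup {d q : α → ℕ} {l : α → List (ℕ × List Cand)} (hd : PolyTime d)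
    (hq : PolyTime q) (hl : PolyTime l) : PolyTime fun a => lookup (d a) (q a) (l a) := by
  have h0 : PolyTime fun a => ([(0, q a * d a, [])] : List Cand) := by fun_prop
  refine foldl (B := fun a => sz ([(0, q a * d a, [])] : List Cand) + sz (l a)) hl h0 (by fun_prop)
    (h0.polyBdd_sz.add hl.polyBdd_sz) fun a m hm => ?_
  change sz (FlowTime.lookup (d a) (q a) m) ≤ _
  rcases lookup_cases (d a) (q a) m with ⟨h, -⟩ | ⟨e, he, -, h⟩
  · rw [h]; omega
  · have h1 := sz_le_of_mem (hm.subset he)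
    rw [sz_prod] at h1
    rw [h]; omega

theorem PolyTime.child {u : α → List ℕ} {sc : α → JobData → ℕ → ℕ} {js : α → List JobData}
    {d q : α → ℕ} {l : α → List (ℕ × List Cand)} (hu : PolyTime u)
    (hsc : PolyTime fun x : α × JobData × ℕ => sc x.1 x.2.1 x.2.2) (hjs : PolyTime js)
    (hd : PolyTime d) (hq : PolyTime q) (hl : PolyTime l) :
    PolyTime fun a => child (u a) (sc a) (js a) (d a) (q a) (l a) := by
  unfold FlowTime.child
  have hlk : PolyTime fun a => FlowTime.lookup (d a) (q a) (l a) := by fun_prop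
  have he : PolyTime fun a => (q a + 1) * d a := by fun_prop
  -- `A` bounds the entries of the initial table and what a step adds to a candidate, and `C`
  -- bounds a candidate
  let A : α → ℕ := fun a => sz (FlowTime.lookup (d a) (q a) (l a)) + sz (u a) + sz (js a) +
    sz ((q a + 1) * d a) + 3
  let C : α → ℕ := fun a => 2 + A a + A a + (A a + sz (js a) * A a)
  have hA : PolyBdd A := (((hlk.polyBdd_sz.add hu.polyBdd_sz).add hjs.polyBdd_sz).add
    he.polyBdd_sz).add (polyBdd_const 3)
  have hC : PolyBdd C := (((polyBdd_const 2).add hA).add hA).add (hA.add (hjs.polyBdd_sz.mul hA))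
  refine foldl (h := fun a t j => FlowTime.addJob (u a) (sc a) ((q a + 1) * d a) t j)
    (B := fun a => 1 + A a * (1 + C a)) ?_ hlk ?_
    ((polyBdd_const 1).add (hA.mul ((polyBdd_const 1).add hC))) fun a m hm => ?_
  · fun_prop
  · refine addJob (sc := fun x : α × List Cand × JobData => sc x.1) (by fun_prop) ?_ (by fun_prop)
      (by fun_prop) (by fun_prop)
    exact comp hsc (f := fun x : (α × List Cand × JobData) × JobData × ℕ => (x.1.1, x.2.1, x.2.2))
      (by fun_prop)
  · have hsub : ∀ j ∈ m, j ∈ js a := fun j hj => (List.mem_filter.1 (hm.subset hj)).1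
    have hlen : m.length ≤ sz (js a) :=
      (hm.length_le.trans (List.length_filter_le _ _)).trans (length_le_sz _)
    clear hm
    have key : (m.foldl (FlowTime.addJob (u a) (sc a) ((q a + 1) * d a))
          (FlowTime.lookup (d a) (q a) (l a))).length ≤ A a ∧
        ∀ x ∈ m.foldl (FlowTime.addJob (u a) (sc a) ((q a + 1) * d a))
          (FlowTime.lookup (d a) (q a) (l a)),
          sz x.1 ≤ A a ∧ sz x.2.1 ≤ A a ∧ sz x.2.2 ≤ A a + m.length * A a := by
      induction m using List.reverseRecOn with
      | nil =>
        refine ⟨?_, fun x hx => ?_⟩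
        · have := length_le_sz (FlowTime.lookup (d a) (q a) (l a))
          simp only [List.foldl_nil, A]; omega
        · have h1 := sz_le_of_mem hx
          rw [List.foldl_nil] at h1
          have h2 := sz_prod x
          have h3 := sz_prod x.2
          simp only [List.length_nil, zero_mul, add_zero, A]
          omega
      | append_singleton m j ih =>
        have ih := (ih (fun j hj => hsub j (by simp [hj]))
          (le_trans (by simp) hlen)).2
        have hj := sz_le_of_mem (hsub j (by simp))
        rw [sz_prod] at hj
        rw [List.foldl_append, List.foldl_cons, List.foldl_nil]
        refine ⟨?_, fun x hx => ?_⟩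
        · have h1 := length_prune (u a) (List.flatMap (fun x => (x.1 + sc a j ((q a + 1) * d a),
            x.2.1, (j.1, (q a + 1) * d a) :: x.2.2) :: if j.2.2.1 + j.2.1 ≤ x.2.1 then
            [(x.1, x.2.1 - j.2.1, x.2.2)] else []) (m.foldl (FlowTime.addJob (u a) (sc a)
            ((q a + 1) * d a)) (FlowTime.lookup (d a) (q a) (l a))))
          have h2 := length_le_sz (u a)
          refine h1.trans ?_
          simp only [A]; omega
        · obtain ⟨hu, y, hy, h⟩ := mem_addJob hx
          obtain ⟨h1, h2, h3⟩ := ih y hy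
          have h4 := sz_nat_le x.1
          have h5 := length_le_sz (u a)
          refine ⟨by simp only [A]; omega, ?_⟩
          rw [List.length_append, List.length_singleton, add_mul, one_mul]
          rcases h with rfl | ⟨-, rfl⟩
          · refine ⟨h2, ?_⟩
            change sz ((j.1, (q a + 1) * d a) :: y.2.2) ≤ _
            rw [sz_cons, sz_pair]
            have : 1 + (1 + sz j.1 + sz ((q a + 1) * d a)) ≤ A a := by simp only [A]; omega
            omega
          · refine ⟨(sz_nat_mono (Nat.sub_le _ _)).trans h2, ?_⟩
            change sz y.2.2 ≤ _
            omega
    refine (sz_list_le (B := C a) fun x hx => ?_).trans ?_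
    · obtain ⟨h1, h2, h3⟩ := key.2 x hx
      have h4 := Nat.mul_le_mul_right (A a) hlen
      rw [sz_prod, sz_prod]
      simp only [C]; omega
    · exact Nat.add_le_add_left (Nat.mul_le_mul_right _ key.1) 1

theorem PolyTime.level {u : α → List ℕ} {sc : α → JobData → ℕ → ℕ} {js : α → List JobData}
    {s : α → ℕ × List (ℕ × List Cand)} (hu : PolyTime u)
    (hsc : PolyTime fun x : α × JobData × ℕ => sc x.1 x.2.1 x.2.2) (hjs : PolyTime js)
    (hs : PolyTime s) : PolyTime fun a => level (u a) (sc a) (js a) (s a) := by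
  unfold FlowTime.level
  have hsc' : PolyTime fun x : (α × ℕ) × JobData × ℕ => sc x.1.1 x.2.1 x.2.2 :=
    comp hsc (f := fun x : (α × ℕ) × JobData × ℕ => (x.1.1, x.2.1, x.2.2)) (by fun_prop)
  have h1 : PolyTime fun x : α × ℕ => FlowTime.child (u x.1) (sc x.1) (js x.1) (s x.1).1 (2 * x.2)
      (s x.1).2 :=
    child (by fun_prop) hsc' (by fun_prop) (by fun_prop) (by fun_prop) (by fun_prop)
  have h2 : PolyTime fun x : α × ℕ => FlowTime.child (u x.1) (sc x.1) (js x.1) (s x.1).1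
      (2 * x.2 + 1) (s x.1).2 :=
    child (by fun_prop) hsc' (by fun_prop) (by fun_prop) (by fun_prop) (by fun_prop)
  fun_prop

/-- Since every chosen segment costs at least one unit, the candidates of the dynamic program have
polynomial size. -/
theorem PolyTime.rootTable {u v : α → List ℕ} {sc : α → JobData → ℕ → ℕ} {js : α → List JobData}
    (hu : PolyTime u) (hsc : PolyTime fun x : α × JobData × ℕ => sc x.1 x.2.1 x.2.2)
    (hone : ∀ a j e, 1 ≤ sc a j e) (hjs : PolyTime js) (hv : PolyTime v) :
    PolyTime fun a => rootTable (u a) (sc a) (js a) (v a) := by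
  unfold FlowTime.rootTable
  -- `Y` bounds the binary length of all times, `C` a candidate and `T` a table
  let Y : α → ℕ := fun a => sz (js a) + sz (v a) + 5
  let C : α → ℕ := fun a => 2 + (1 + sz (u a)) + Y a +
    (1 + sz (u a) * (1 + (1 + sz (js a) + Y a)))
  let T : α → ℕ := fun a => 1 + sz (u a) * (1 + C a)
  have hY : PolyBdd Y := (hjs.polyBdd_sz.add hv.polyBdd_sz).add (polyBdd_const 5)
  have hC : PolyBdd C := (((polyBdd_const 2).add ((polyBdd_const 1).add hu.polyBdd_sz)).add hY).add
    ((polyBdd_const 1).add (hu.polyBdd_sz.mul ((polyBdd_const 1).add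
      (((polyBdd_const 1).add hjs.polyBdd_sz).add hY))))
  have hT : PolyBdd T := (polyBdd_const 1).add (hu.polyBdd_sz.mul ((polyBdd_const 1).add hC))
  have hfold : PolyTime fun a => (v a).foldl (fun s _ => FlowTime.level (u a) (sc a) (js a) s)
      (1, []) := by
    refine foldl (h := fun a s _ => FlowTime.level (u a) (sc a) (js a) s) (g := fun _ => (1, []))
      (B := fun a => 1 + Y a + (1 + (2 * sz (js a)) * (1 + (1 + Y a + T a)))) hv (by fun_prop) ?_
      (((polyBdd_const 1).add hY).add ((polyBdd_const 1).add (((polyBdd_const 2).mul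
        hjs.polyBdd_sz).mul ((polyBdd_const 1).add (((polyBdd_const 1).add hY).add hT)))))
      fun a m hm => ?_
    · refine level (sc := fun x : α × (ℕ × List (ℕ × List Cand)) × ℕ => sc x.1) (by fun_prop) ?_
        (by fun_prop) (by fun_prop)
      exact comp hsc (f := fun x : (α × (ℕ × List (ℕ × List Cand)) × ℕ) × JobData × ℕ =>
        (x.1.1, x.2.1, x.2.2)) (by fun_prop)
    · have hlen := hm.length_le
      have hvs := length_le_sz (v a)
      have hYY : ∀ n ≤ 2 ^ (sz (js a) + (v a).length + 2), sz n ≤ Y a := fun n hn => by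
        have := sz_nat_mono hn
        rw [sz_two_pow] at this
        simp only [Y]; omega
      have hR : ∀ j ∈ js a, j.2.2.1 < 2 ^ sz (js a) := fun j hj => by
        have h1 := sz_le_of_mem hj
        rw [sz_prod, sz_prod, sz_prod, sz_nat j.2.2.1] at h1
        exact (Nat.lt_size_self _).trans_le (Nat.pow_le_pow_right (by omega) (by omega))
      have hind := levels_induction (u := u a) (sc := sc a) (js := js a) (K := (v a).length)
        (Y := 2 ^ (sz (js a) + (v a).length + 2)) (Q := fun x => x.1 ≤ (u a).length ∧
          sz x.2.1 ≤ Y a ∧ x.2.2.length ≤ x.1 ∧ ∀ b ∈ x.2.2, sz b ≤ 1 + sz (js a) + Y a) ?_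
        (fun n hn => ⟨Nat.zero_le _, hYY n hn, le_rfl, by simp⟩) ?_ ?_ ?_ m.length hlen
      · rw [List.foldl_const, iterate_level, sz_pair]
        have h1 := hYY (2 ^ m.length) (Nat.pow_le_pow_right (by omega) (by omega))
        have h2 : (levels (u a) (sc a) (js a) m.length).length ≤ 2 * sz (js a) := by
          have h3 := length_le_sz (js a)
          cases m.length with
          | zero => simp [levels_zero]
          | succ i => simp [levels_succ, List.length_flatMap]; omega
        have h3 := (sz_list_le (B := 1 + Y a + T a) fun e he => ?_).trans
          (Nat.add_le_add_left (Nat.mul_le_mul_right (1 + (1 + Y a + T a)) h2) 1)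
        · omega
        · obtain ⟨h4, h5, h6⟩ := hind e he
          have h7 := hYY _ h4
          have h8 := (sz_list_le (B := C a) fun x hx => ?_).trans (Nat.add_le_add_left
            (Nat.mul_le_mul_right (1 + C a) (h5.trans (length_le_sz (u a)))) 1)
          · rw [sz_prod]; simp only [T]; omega
          · obtain ⟨g1, g2, g3, g4⟩ := h6 x hx
            have g5 := length_le_sz (u a)
            have g6 := (sz_list_le g4).trans (Nat.add_le_add_left (Nat.mul_le_mul_right
              (1 + (1 + sz (js a) + Y a)) (g3.trans (g1.trans g5))) 1)
            have g7 := sz_nat_le x.1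
            rw [sz_prod, sz_prod]
            simp only [C]; omega
      · intro j hj
        have h1 := hR j hj
        have h2 : 2 ^ (sz (js a) + (v a).length + 2) =
          2 ^ sz (js a) * (2 ^ (v a).length * 4) := by ring
        have h3 : 2 ≤ 2 ^ sz (js a) := by
          have := Nat.pow_le_pow_right (n := 2) (by omega) (one_le_sz (js a))
          omega
        have h4 : 1 ≤ 2 ^ (v a).length := Nat.one_le_two_pow
        rw [h2]
        nlinarith
      · rintro x ⟨g1, g2, g3, g4⟩ j hj e he - hlt
        have h1 := hone a j e
        have h2 := sz_le_of_mem hj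
        rw [sz_prod] at h2
        have h3 := hYY e he
        refine ⟨hlt.le, g2, ?_, fun b hb => ?_⟩
        · simp only [List.length_cons]; omega
        · rcases List.mem_cons.1 hb with rfl | hb
          · rw [sz_pair]; omega
          · exact g4 b hb
      · rintro x ⟨g1, g2, g3, g4⟩ n
        exact ⟨g1, (sz_nat_mono (Nat.sub_le _ _)).trans g2, g3, g4⟩
      · rintro x y ⟨g1, g2, g3, g4⟩ ⟨h1, h2, h3, h4⟩ hlt
        refine ⟨hlt.le, (sz_nat_mono (min_le_left _ _)).trans g2, ?_, fun b hb => ?_⟩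
        · simp only [List.length_append]; omega
        · rcases List.mem_append.1 hb with hb | hb
          · exact g4 b hb
          · exact h4 b hb
  fun_prop

end

/-! ### Deadlines, demands, and what the tables say about them -/

/-- The total processing time of the jobs of `L` that are released at time `s` or later and have a
deadline at time `t` or earlier. -/
def dem (L : List JobData) (D : ℕ → ℕ) (s t : ℕ) : ℕ :=
  (L.map fun j => if s ≤ j.2.2.1 ∧ D j.1 ≤ t then j.2.1 else 0).sum

section Dem

variable {L M : List JobData} {D : ℕ → ℕ} {s t : ℕ}

theorem dem_cons (j : JobData) : dem (j :: L) D s t =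
    (if s ≤ j.2.2.1 ∧ D j.1 ≤ t then j.2.1 else 0) + dem L D s t := by simp [dem]

theorem dem_append : dem (L ++ M) D s t = dem L D s t + dem M D s t := by simp [dem]

theorem dem_perm (h : L.Perm M) : dem L D s t = dem M D s t := (h.map _).sum_eq

theorem dem_sublist (h : L.Sublist M) : dem L D s t ≤ dem M D s t :=
  (h.map _).sum_le_sum (by simp)

theorem dem_anti {s' : ℕ} (h : s' ≤ s) : dem L D s t ≤ dem L D s' t := by
  refine List.sum_le_sum fun j _ => ?_
  split_ifs <;> omega

theorem dem_zero (h : ∀ j ∈ L, s ≤ j.2.2.1) : dem L D s t = dem L D 0 t := by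
  refine congrArg List.sum (List.map_congr_left fun j hj => ?_)
  simp [h j hj]

theorem dem_eq_zero (h : ∀ j ∈ L, t < D j.1) : dem L D s t = 0 := by
  refine List.sum_eq_zero fun n hn => ?_
  obtain ⟨j, hj, rfl⟩ := List.mem_map.1 hn
  have := h j hj
  rw [if_neg (by omega)]

end Dem

/-- On the cell `[q * d, (q + 1) * d)`, the jobs of `L` with deadlines `D` can be processed after
all earlier work is finished at time `H`, and the jobs of `L` satisfy the demand condition. -/
def Sound (d q : ℕ) (L : List JobData) (D : ℕ → ℕ) (H : ℕ) : Prop :=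
  ∀ t, q * d ≤ t → t < (q + 1) * d → H + dem L D 0 t ≤ t ∧ ∀ s ≤ t, s + dem L D s t ≤ t

theorem sound_default {d q : ℕ} {L : List JobData} {D : ℕ → ℕ} (h : ∀ j ∈ L, (q + 1) * d ≤ D j.1) :
    Sound d q L D (q * d) := by
  intro t h1 h2
  have : ∀ s, dem L D s t = 0 := fun s => dem_eq_zero fun j hj => h2.trans_le (h j hj)
  simp only [this]
  exact ⟨h1, fun s hs => hs⟩

/-- A job whose segment is chosen has its deadline after the cell. -/
theorem Sound.select {d q : ℕ} {L : List JobData} {D : ℕ → ℕ} {H : ℕ} (h : Sound d q L D H)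
    {j : JobData} (hj : (q + 1) * d ≤ D j.1) : Sound d q (j :: L) D H := by
  intro t h1 h2
  have : ∀ s, dem (j :: L) D s t = dem L D s t := fun s => by
    rw [dem_cons, if_neg (by omega), zero_add]
  simp only [this]
  exact h t h1 h2

/-- A job whose segment is not chosen may be due before the cell; room for it is reserved at the end
of the time for earlier work, after its release. -/
theorem Sound.skip {d q : ℕ} {L : List JobData} {D : ℕ → ℕ} {H : ℕ} (h : Sound d q L D H)
    {j : JobData} (hj : j.2.2.1 + j.2.1 ≤ H) :
    Sound d q (j :: L) D (H - j.2.1) := by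
  intro t h1 h2
  obtain ⟨h3, h4⟩ := h t h1 h2
  have h5 : ∀ s, dem (j :: L) D s t ≤ j.2.1 + dem L D s t := fun s => by
    rw [dem_cons]; split_ifs <;> omega
  refine ⟨by have := h5 0; omega, fun s hs => ?_⟩
  by_cases hsr : s ≤ j.2.2.1
  · have := h5 s
    have := dem_anti (L := L) (D := D) (t := t) (Nat.zero_le s)
    omega
  · rw [dem_cons, if_neg (by omega), zero_add]
    exact h4 s hs

/-- For the target deadlines `D`, the table contains a candidate of cost `c` that leaves at least as
much room for earlier work as the target deadlines do. -/
def Complete (m d q : ℕ) (L : List JobData) (D : ℕ → ℕ) (tab : List Cand) (c : ℕ) : Prop :=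
  c < m → ∃ x ∈ tab, x.1 = c ∧
    ∀ H, (∀ t, q * d ≤ t → t < (q + 1) * d → H + dem L D 0 t ≤ t) → H ≤ x.2.1

section Tables

variable {u : List ℕ} {sc : JobData → ℕ → ℕ} {js : List JobData}

theorem exists_mem_addJob_select {e : ℕ} {t : List Cand} {j : JobData} {x : Cand} (hx : x ∈ t)
    (h : x.1 + sc j e < u.length) :
    ∃ y ∈ addJob u sc e t j, y.1 = x.1 + sc j e ∧ x.2.1 ≤ y.2.1 := by
  unfold addJob
  exact exists_mem_prune (x := (x.1 + sc j e, x.2.1, (j.1, e) :: x.2.2))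
    (List.mem_flatMap.2 ⟨x, hx, by simp⟩) h

theorem exists_mem_addJob_skip {e : ℕ} {t : List Cand} {j : JobData} {x : Cand} (hx : x ∈ t)
    (h : x.1 < u.length) (hj : j.2.2.1 + j.2.1 ≤ x.2.1) :
    ∃ y ∈ addJob u sc e t j, y.1 = x.1 ∧ x.2.1 - j.2.1 ≤ y.2.1 := by
  unfold addJob
  exact exists_mem_prune (x := (x.1, x.2.1 - j.2.1, x.2.2))
    (List.mem_flatMap.2 ⟨x, hx, by simp [hj]⟩) h

theorem exists_mem_combine {t₁ t₂ : List Cand} {x y : Cand} (hx : x ∈ t₁) (hy : y ∈ t₂)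
    (h : x.1 + y.1 < u.length) :
    ∃ z ∈ combine u t₁ t₂, z.1 = x.1 + y.1 ∧ min x.2.1 y.2.1 ≤ z.2.1 := by
  unfold combine
  exact exists_mem_prune (x := (x.1 + y.1, min x.2.1 y.2.1, x.2.2 ++ y.2.2))
    (List.mem_flatMap.2 ⟨x, hx, List.mem_map_of_mem hy⟩) h

/-- Near a cell that is not listed, no jobs are released. -/
theorem le_release_of_not_listed {k q : ℕ} (hne : ∀ e ∈ levels u sc js (k + 1), e.1 ≠ q)
    {j : JobData} (hj : j ∈ js) (hlt : q * 2 ^ (k + 1) < j.2.2.1 + 2 ^ (k + 1)) :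
    (q + 1) * 2 ^ (k + 1) ≤ j.2.2.1 := by
  have hpos : 0 < 2 ^ (k + 1) := by positivity
  have hne' : ∀ q' ∈ [j.2.2.1 / 2 ^ (k + 1), j.2.2.1 / 2 ^ (k + 1) + 1], q' ≠ q := by
    intro q' hq'
    have : ∃ t, (q', t) ∈ levels u sc js (k + 1) := by
      rw [levels_succ]
      exact ⟨_, List.mem_map.2 ⟨q', List.mem_flatMap.2 ⟨j, hj, hq'⟩, rfl⟩⟩
    obtain ⟨t, ht⟩ := this
    exact hne _ ht
  simp only [List.mem_cons, List.not_mem_nil, or_false, forall_eq_or_imp, forall_eq] at hne'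
  have h2 : q < j.2.2.1 / 2 ^ (k + 1) + 2 := by
    by_contra hcon
    have h3 := Nat.lt_div_mul_add hpos (a := j.2.2.1)
    have h4 := Nat.mul_le_mul_right (2 ^ (k + 1)) (not_lt.1 hcon)
    rw [add_mul] at h4
    omega
  exact (Nat.le_div_iff_mul_le hpos).1 (by omega)

/-- The candidate for the target deadlines survives the decision on a job `j` that is released no
later than the jobs decided so far. -/
theorem complete_addJob {d q c : ℕ} {L : List JobData} {D : ℕ → ℕ} {tab : List Cand} {j : JobData}
    (h : Complete u.length d q L D tab c) (hL : ∀ i ∈ L, j.2.2.1 ≤ i.2.2.1) (hD : j.2.2.1 < D j.1)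
    (hdem : ∀ t, j.2.2.1 ≤ t → j.2.2.1 + dem (j :: L) D j.2.2.1 t ≤ t) :
    Complete u.length d q (j :: L) D (addJob u sc ((q + 1) * d) tab j)
      (c + if q * d < D j.1 then sc j ((q + 1) * d) else 0) := by
  intro hc
  obtain ⟨x, hx, hxc, hxH⟩ := h (by omega)
  split_ifs at hc with hsel
  · obtain ⟨y, hy, hy1, hy2⟩ := exists_mem_addJob_select (u := u) (sc := sc) (j := j)
      (e := (q + 1) * d) hx (by rwa [hxc])
    refine ⟨y, hy, by rw [hy1, if_pos hsel, hxc], fun H hH => (hxH H fun t h1 h2 => ?_).trans hy2⟩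
    have := hH t h1 h2
    rw [dem_cons] at this
    omega
  · -- the job has to be finished before the cell; the demand condition leaves room for it
    have hroom : j.2.2.1 + j.2.1 ≤ x.2.1 := by
      refine hxH _ fun t h1 h2 => ?_
      have := hdem t (by omega)
      rw [dem_cons, if_pos ⟨le_rfl, by omega⟩, dem_zero hL] at this
      omega
    obtain ⟨y, hy, hy1, hy2⟩ := exists_mem_addJob_skip (u := u) (sc := sc) (e := (q + 1) * d) hx
      (by rwa [hxc]) hroom
    refine ⟨y, hy, by rw [hy1, if_neg hsel, hxc]; rfl, fun H hH => le_trans ?_ hy2⟩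
    have : H + j.2.1 ≤ x.2.1 := hxH _ fun t h1 h2 => by
      have := hH t h1 h2
      rw [dem_cons, if_pos ⟨Nat.zero_le _, by omega⟩] at this
      omega
    omega

/-- The jobs whose segments are equal to the cell `[q * d, (q + 1) * d)`. -/
def segJobs (js : List JobData) (d q : ℕ) : List JobData :=
  js.filter fun j => q / 2 * (2 * d) < j.2.2.1 + 2 * d ∧ j.2.2.1 + d ≤ q * d

/-- The jobs that are released after the left neighbour of the cell `[q * d, (q + 1) * d)`
begins. -/
def nearJobs (js : List JobData) (d q : ℕ) : List JobData :=
  js.filter fun j => q * d < j.2.2.1 + d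

/-- A job near the parent of a cell is either near the cell or has a segment equal to it. -/
theorem nearJobs_perm (js : List JobData) (d q : ℕ) :
    ((segJobs js d q).reverse ++ nearJobs js d q).Perm (nearJobs js (2 * d) (q / 2)) := by
  have h := List.filter_append_perm (fun j : JobData => decide (j.2.2.1 + d ≤ q * d))
    (nearJobs js (2 * d) (q / 2))
  refine List.Perm.trans ?_ h
  refine (List.Perm.append_right _ (List.reverse_perm _)).trans (List.Perm.of_eq ?_)
  have hq : q / 2 * (2 * d) ≤ q * d := by
    rw [← mul_assoc]; exact Nat.mul_le_mul_right _ (Nat.div_mul_le_self q 2)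
  simp only [segJobs, nearJobs, List.filter_filter]
  congr 1
  · refine List.filter_congr fun j _ => ?_
    rw [← Bool.decide_and, decide_eq_decide]
    exact and_comm
  · refine List.filter_congr fun j _ => ?_
    rw [← decide_not, ← Bool.decide_and, decide_eq_decide]
    omega

theorem sound_child {d q : ℕ} {l : List (ℕ × List Cand)} {D : ℕ → ℕ}
    (h : ∀ x ∈ lookup d q l, (∀ b ∈ x.2.2, b.2 ≤ D b.1) → Sound d q (nearJobs js d q) D x.2.1) :
    ∀ x ∈ child u sc js d q l, (∀ b ∈ x.2.2, b.2 ≤ D b.1) →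
      Sound d q (nearJobs js (2 * d) (q / 2)) D x.2.1 := by
  have key : ∀ m, m <+: segJobs js d q →
      ∀ x ∈ m.foldl (addJob u sc ((q + 1) * d)) (lookup d q l), (∀ b ∈ x.2.2, b.2 ≤ D b.1) →
        Sound d q (m.reverse ++ nearJobs js d q) D x.2.1 := by
    intro m
    induction m using List.reverseRecOn with
    | nil => exact fun _ => h
    | append_singleton m j ih =>
      intro hm x hx hb
      rw [List.foldl_append, List.foldl_cons, List.foldl_nil] at hx
      rw [List.reverse_append, List.reverse_singleton, List.singleton_append, List.cons_append]
      have ih := ih ((List.prefix_append _ _).trans hm)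
      obtain ⟨-, y, hy, rfl | ⟨hj, rfl⟩⟩ := mem_addJob hx
      · refine (ih y hy fun b hb' => hb b (List.mem_cons_of_mem _ hb')).select ?_
        exact hb _ List.mem_cons_self
      · exact (ih y hy hb).skip hj
  intro x hx hb t h1 h2
  have := key _ (List.prefix_rfl) x hx hb t h1 h2
  simpa only [dem_perm (nearJobs_perm js d q)] using this

/-- The dynamic program is sound: all deadlines that are compatible with the segments of a candidate
are feasible on its cell. -/
theorem sound_levels {D : ℕ → ℕ} (hD : ∀ j ∈ js, j.2.2.1 < D j.1) (k : ℕ) : ∀ q,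
    ∀ x ∈ lookup (2 ^ k) q (levels u sc js k), (∀ b ∈ x.2.2, b.2 ≤ D b.1) →
      Sound (2 ^ k) q (nearJobs js (2 ^ k) q) D x.2.1 := by
  induction k with
  | zero =>
    intro q x hx hb
    rw [levels_zero] at hx
    simp only [lookup, List.foldl_nil, List.mem_singleton] at hx
    rw [hx]
    refine sound_default fun j hj => ?_
    simp only [nearJobs, List.mem_filter, decide_eq_true_eq] at hj
    have := hD j hj.1
    omega
  | succ k ih =>
    intro q x hx hb
    rcases lookup_cases (2 ^ (k + 1)) q (levels u sc js (k + 1)) with ⟨h, hne⟩ | ⟨e, he, heq, h⟩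
    · rw [h, List.mem_singleton] at hx
      rw [hx]
      refine sound_default fun j hj => ?_
      simp only [nearJobs, List.mem_filter, decide_eq_true_eq] at hj
      have h1 := hD j hj.1
      have h2 := le_release_of_not_listed hne hj.1 hj.2
      omega
    · rw [h] at hx
      rw [levels_succ] at he
      obtain ⟨q', -, rfl⟩ := List.mem_map.1 he
      obtain rfl : q' = q := heq
      obtain ⟨-, y, hy, z, hz, rfl⟩ := mem_combine hx
      have h1 := sound_child (u := u) (sc := sc) (ih (2 * q')) y hy
        (fun b hb' => hb b (List.mem_append_left _ hb'))
      have h2 := sound_child (u := u) (sc := sc) (ih (2 * q' + 1)) z hz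
        (fun b hb' => hb b (List.mem_append_right _ hb'))
      rw [Nat.mul_div_cancel_left _ (by omega), ← pow_succ'] at h1
      rw [show (2 * q' + 1) / 2 = q' by omega, ← pow_succ'] at h2
      intro t ht1 ht2
      have e1 : 2 * q' * 2 ^ k = q' * 2 ^ (k + 1) := by ring
      have e2 : (2 * q' + 1 + 1) * 2 ^ k = (q' + 1) * 2 ^ (k + 1) := by ring
      rcases lt_or_ge t ((2 * q' + 1) * 2 ^ k) with hlt | hge
      · have := h1 t (by omega) hlt
        refine ⟨?_, this.2⟩
        have h3 := min_le_left y.2.1 z.2.1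
        have h4 := this.1
        change min y.2.1 z.2.1 + _ ≤ t
        omega
      · have := h2 t hge (by omega)
        refine ⟨?_, this.2⟩
        have h3 := min_le_right y.2.1 z.2.1
        have h4 := this.1
        change min y.2.1 z.2.1 + _ ≤ t
        omega

/-- The cost of the segments equal to a cell for the target deadlines `D`: a segment is needed if
it starts before the deadline. -/
def segCost (sc : JobData → ℕ → ℕ) (js : List JobData) (D : ℕ → ℕ) (k q : ℕ) : ℕ :=
  ((segJobs js (2 ^ k) q).map fun j =>
    if q * 2 ^ k < D j.1 then sc j ((q + 1) * 2 ^ k) else 0).sum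

/-- The cost of the segments strictly inside a cell for the target deadlines `D`. -/
def treeCost (sc : JobData → ℕ → ℕ) (js : List JobData) (D : ℕ → ℕ) : ℕ → ℕ → ℕ
  | 0, _ => 0
  | k + 1, q => treeCost sc js D k (2 * q) + segCost sc js D k (2 * q) +
      (treeCost sc js D k (2 * q + 1) + segCost sc js D k (2 * q + 1))

theorem treeCost_eq_zero {D : ℕ → ℕ} {k : ℕ} : ∀ {q},
    (∀ j ∈ js, q * 2 ^ k < j.2.2.1 + 2 ^ k → (q + 1) * 2 ^ k ≤ j.2.2.1) →
    treeCost sc js D k q = 0 := by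
  induction k with
  | zero => exact fun _ => rfl
  | succ k ih =>
    intro q h
    have e : ∀ q', q' * 2 ^ (k + 1) = 2 * (q' * 2 ^ k) := fun q' => by ring
    have hseg : ∀ q', q' / 2 = q → segJobs js (2 ^ k) q' = [] := by
      intro q' hq'
      rw [segJobs, List.filter_eq_nil_iff]
      intro j hj hcon
      rw [decide_eq_true_eq, hq', ← pow_succ'] at hcon
      have h1 := h j hj hcon.1
      have h2 := Nat.mul_le_mul_right (2 ^ k) (show q' ≤ 2 * q + 1 by omega)
      rw [add_mul, one_mul, mul_assoc, ← e] at h2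
      rw [add_mul, one_mul, pow_succ] at h1
      have : 0 < 2 ^ k := by positivity
      rw [pow_succ] at h2
      omega
    rw [treeCost, segCost, segCost, hseg _ (by omega), hseg _ (by omega), ih, ih]
    · simp
    all_goals
      intro j hj
      have := h j hj
      have e1 := e q
      have e2 : 2 * q * 2 ^ k = 2 * (q * 2 ^ k) := by ring
      have e3 : 2 ^ (k + 1) = 2 * 2 ^ k := by ring
      simp only [add_mul, one_mul] at *
      omega

variable (hsort : js.Pairwise fun i j => j.2.2.1 ≤ i.2.2.1)
include hsort

theorem le_of_segJobs {m : List JobData} {j : JobData} {d q : ℕ} (h : m ++ [j] <+: segJobs js d q) :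
    ∀ i ∈ m.reverse ++ nearJobs js d q, j.2.2.1 ≤ i.2.2.1 := by
  intro i hi
  rw [List.mem_append, List.mem_reverse] at hi
  have hj : j ∈ segJobs js d q := h.subset (by simp)
  rcases hi with hi | hi
  · have := (hsort.sublist ((h.sublist).trans List.filter_sublist))
    rw [List.pairwise_append] at this
    exact this.2.2 i hi j (by simp)
  · simp only [segJobs, nearJobs, List.mem_filter, decide_eq_true_eq] at hi hj
    omega

theorem complete_child {k q c : ℕ} {l : List (ℕ × List Cand)} {D : ℕ → ℕ}
    (hD : ∀ j ∈ js, j.2.2.1 < D j.1) (hdem : ∀ t, ∀ s ≤ t, s + dem js D s t ≤ t)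
    (h : Complete u.length (2 ^ k) q (nearJobs js (2 ^ k) q) D (lookup (2 ^ k) q l) c) :
    Complete u.length (2 ^ k) q (nearJobs js (2 * 2 ^ k) (q / 2)) D
      (child u sc js (2 ^ k) q l) (c + segCost sc js D k q) := by
  have key : ∀ m, m <+: segJobs js (2 ^ k) q →
      Complete u.length (2 ^ k) q (m.reverse ++ nearJobs js (2 ^ k) q) D
        (m.foldl (addJob u sc ((q + 1) * 2 ^ k)) (lookup (2 ^ k) q l))
        (c + (m.map fun j => if q * 2 ^ k < D j.1 then sc j ((q + 1) * 2 ^ k) else 0).sum) := by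
    intro m
    induction m using List.reverseRecOn with
    | nil => exact fun _ => h
    | append_singleton m j ih =>
      intro hm
      rw [List.foldl_append, List.foldl_cons, List.foldl_nil, List.reverse_append,
        List.reverse_singleton, List.singleton_append, List.cons_append, List.map_append,
        List.sum_append, List.map_singleton, List.sum_singleton, ← add_assoc]
      have ih := ih ((List.prefix_append _ _).trans hm)
      have hj : j ∈ segJobs js (2 ^ k) q := hm.subset (by simp)
      refine complete_addJob ih (le_of_segJobs hsort hm) (hD j (List.mem_filter.1 hj).1)
        fun t ht => (Nat.add_le_add_left ?_ _).trans (hdem t _ ht)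
      -- the jobs considered so far are part of the instance
      have h1 := dem_sublist (D := D) (s := j.2.2.1) (t := t) hm.sublist
      have h2 := dem_perm (D := D) (s := j.2.2.1) (t := t) (nearJobs_perm js (2 ^ k) q)
      have h3 : dem (nearJobs js (2 * 2 ^ k) (q / 2)) D j.2.2.1 t ≤ dem js D j.2.2.1 t :=
        dem_sublist List.filter_sublist
      have h4 := dem_perm (D := D) (s := j.2.2.1) (t := t) (List.reverse_perm m)
      have h5 := dem_perm (D := D) (s := j.2.2.1) (t := t)
        (List.reverse_perm (segJobs js (2 ^ k) q))
      rw [dem_append] at h1 h2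
      have h6 : dem [j] D j.2.2.1 t + dem m D j.2.2.1 t + dem (nearJobs js (2 ^ k) q) D j.2.2.1 t =
          dem (j :: (m.reverse ++ nearJobs js (2 ^ k) q)) D j.2.2.1 t := by
        rw [dem_cons, dem_cons, dem_append, h4]; simp [dem]; ring
      omega
  have := key _ List.prefix_rfl
  intro hc
  obtain ⟨x, hx, hxc, hxH⟩ := this hc
  refine ⟨x, hx, hxc, fun H hH => hxH H fun t h1 h2 => ?_⟩
  rw [dem_perm (nearJobs_perm js (2 ^ k) q)]
  exact hH t h1 h2

/-- The dynamic program is complete: it finds a candidate at the cost of the target deadlines. -/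
theorem complete_levels {D : ℕ → ℕ} (hD : ∀ j ∈ js, j.2.2.1 < D j.1)
    (hdem : ∀ t, ∀ s ≤ t, s + dem js D s t ≤ t) (k : ℕ) : ∀ q,
    Complete u.length (2 ^ k) q (nearJobs js (2 ^ k) q) D (lookup (2 ^ k) q (levels u sc js k))
      (treeCost sc js D k q) := by
  have hdef : ∀ k q, Complete u.length (2 ^ k) q (nearJobs js (2 ^ k) q) D [(0, q * 2 ^ k, [])] 0 :=
    fun k q _ => ⟨_, List.mem_singleton_self _, rfl, fun H hH => by
      have h1 := hH (q * 2 ^ k) le_rfl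
        (Nat.mul_lt_mul_of_pos_right (Nat.lt_succ_self q) (by positivity))
      change H ≤ q * 2 ^ k
      omega⟩
  induction k with
  | zero => exact fun q => hdef 0 q
  | succ k ih =>
    intro q
    rcases lookup_cases (2 ^ (k + 1)) q (levels u sc js (k + 1)) with ⟨h, hne⟩ | ⟨e, he, heq, h⟩
    · rw [h, treeCost_eq_zero]
      · exact hdef (k + 1) q
      · exact fun j hj hlt => le_release_of_not_listed hne hj hlt
    · rw [levels_succ] at he
      obtain ⟨q', -, rfl⟩ := List.mem_map.1 he
      obtain rfl : q' = q := heq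
      rw [h]
      have h1 := complete_child hsort (sc := sc) hD hdem (ih (2 * q'))
      have h2 := complete_child hsort (sc := sc) hD hdem (ih (2 * q' + 1))
      rw [Nat.mul_div_cancel_left _ (by omega), ← pow_succ'] at h1
      rw [show (2 * q' + 1) / 2 = q' by omega, ← pow_succ'] at h2
      intro hc
      rw [treeCost] at hc
      obtain ⟨y, hy, hyc, hyH⟩ := h1 (by omega)
      obtain ⟨z, hz, hzc, hzH⟩ := h2 (by omega)
      obtain ⟨x, hx, hxc, hxH⟩ := exists_mem_combine (u := u) hy hz (by omega)
      refine ⟨x, hx, by rw [hxc, treeCost, hyc, hzc], fun H hH => (le_min ?_ ?_).trans hxH⟩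
      · refine hyH H fun t ht1 ht2 => hH t ?_ ?_
        · rw [show q' * 2 ^ (k + 1) = 2 * q' * 2 ^ k by ring]; exact ht1
        · rw [show (q' + 1) * 2 ^ (k + 1) = (2 * q' + 1) * 2 ^ k + 2 ^ k by ring]
          exact ht2.trans_le (Nat.le_add_right _ _)
      · refine hzH H fun t ht1 ht2 => hH t ?_ ?_
        · rw [show q' * 2 ^ (k + 1) = 2 * q' * 2 ^ k by ring]
          rw [add_mul] at ht1; omega
        · rw [show (q' + 1) * 2 ^ (k + 1) = (2 * q' + 1 + 1) * 2 ^ k by ring]; exact ht2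

end Tables

/-! ### The cost of the segments of a target solution -/

section TreeCost

variable {u : List ℕ} {sc : JobData → ℕ → ℕ} {js : List JobData} {D : ℕ → ℕ}

theorem segCost_le {ψ : JobData → ℕ → ℝ} (hmono : ∀ j ∈ js, Monotone (ψ j))
    (hseg : ∀ j ∈ js, ∀ k q, q * 2 ^ k < D j.1 → j.2.2.1 + 2 ^ k ≤ q * 2 ^ k →
      q * 2 ^ k < j.2.2.1 + 3 * 2 ^ k →
      (sc j ((q + 1) * 2 ^ k) : ℝ) ≤ ψ j ((q + 1) * 2 ^ k) - ψ j (q * 2 ^ k)) (k q : ℕ) :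
    (segCost sc js D k q : ℝ) ≤ ((segJobs js (2 ^ k) q).map fun j =>
      ψ j ((q + 1) * 2 ^ k) - ψ j (q * 2 ^ k)).sum := by
  rw [segCost, Nat.cast_list_sum, List.map_map]
  refine List.sum_le_sum fun j hj => ?_
  simp only [segJobs, List.mem_filter, decide_eq_true_eq] at hj
  obtain ⟨hj, h1, h2⟩ := hj
  simp only [Function.comp_apply]
  split_ifs with h
  · refine hseg j hj k q h h2 ?_
    have h3 := Nat.mul_le_mul_right (2 ^ k) (show q ≤ q / 2 * 2 + 1 by omega)
    rw [add_mul, one_mul, mul_assoc] at h3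
    omega
  · have := hmono j hj (Nat.mul_le_mul_right (2 ^ k) (Nat.le_succ q))
    simpa using this

/-- If the cost of every segment is bounded by the growth of a potential along the segment, then
the total cost is bounded by the growth of the potentials along the whole cell, since the segments
of a job are disjoint. -/
theorem treeCost_le {ψ : JobData → ℕ → ℝ} (hmono : ∀ j ∈ js, Monotone (ψ j))
    (hseg : ∀ j ∈ js, ∀ k q, q * 2 ^ k < D j.1 → j.2.2.1 + 2 ^ k ≤ q * 2 ^ k →
      q * 2 ^ k < j.2.2.1 + 3 * 2 ^ k →
      (sc j ((q + 1) * 2 ^ k) : ℝ) ≤ ψ j ((q + 1) * 2 ^ k) - ψ j (q * 2 ^ k)) (k : ℕ) : ∀ q,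
    (treeCost sc js D k q : ℝ) ≤ ((nearJobs js (2 ^ k) q).map fun j =>
      ψ j ((q + 1) * 2 ^ k) - ψ j (q * 2 ^ k)).sum := by
  induction k with
  | zero =>
    intro q
    simp only [treeCost, Nat.cast_zero]
    refine List.sum_nonneg fun x hx => ?_
    obtain ⟨j, hj, rfl⟩ := List.mem_map.1 hx
    have := hmono j (List.mem_filter.1 hj).1 (Nat.mul_le_mul_right (2 ^ 0) (Nat.le_succ q))
    simpa using this
  | succ k ih =>
    intro q
    have hchild : ∀ q', (treeCost sc js D k q' + segCost sc js D k q' : ℝ) ≤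
        ((nearJobs js (2 * 2 ^ k) (q' / 2)).map fun j =>
          ψ j ((q' + 1) * 2 ^ k) - ψ j (q' * 2 ^ k)).sum := by
      intro q'
      rw [← ((nearJobs_perm js (2 ^ k) q').map _).sum_eq, List.map_append, List.sum_append,
        ((List.reverse_perm (segJobs js (2 ^ k) q')).map _).sum_eq, add_comm]
      exact add_le_add (segCost_le hmono hseg k q') (ih q')
    have h1 := hchild (2 * q)
    have h2 := hchild (2 * q + 1)
    rw [Nat.mul_div_cancel_left _ (by omega), ← pow_succ'] at h1
    rw [show (2 * q + 1) / 2 = q by omega, ← pow_succ'] at h2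
    rw [treeCost]
    push_cast
    refine (add_le_add h1 h2).trans_eq ?_
    rw [← List.sum_map_add]
    refine congrArg List.sum (List.map_congr_left fun j _ => ?_)
    rw [show 2 * q * 2 ^ k = q * 2 ^ (k + 1) by ring,
      show (2 * q + 1 + 1) * 2 ^ k = (q + 1) * 2 ^ (k + 1) by ring]
    ring

/-- The cost of a candidate bounds any cost of its segments that is dominated by `sc`. -/
theorem rootTable_cost_le {f : ℕ × ℕ → ℝ} {v : List ℕ} (hf : ∀ j ∈ js, ∀ e, f (j.1, e) ≤ sc j e)
    {Y : ℕ} (hY : ∀ j ∈ js, j.2.2.1 + 4 * 2 ^ v.length ≤ Y) :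
    ∀ x ∈ rootTable u sc js v, (x.2.2.map f).sum ≤ x.1 ∧ ∀ b ∈ x.2.2, ∃ j ∈ js, b.1 = j.1 ∧
      j.2.2.1 ≤ b.2 ∧ b.2 ≤ Y := by
  have hind := levels_induction (u := u) (sc := sc) (js := js) (K := v.length)
    (Q := fun x => (x.2.2.map f).sum ≤ x.1 ∧ ∀ b ∈ x.2.2, ∃ j ∈ js, b.1 = j.1 ∧ j.2.2.1 ≤ b.2 ∧
      b.2 ≤ Y) hY (fun n _ => by simp)
    (fun x hx j hj e heY he _ => by
      refine ⟨?_, fun b hb => ?_⟩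
      · have := hf j hj e
        simp only [List.map_cons, List.sum_cons, Nat.cast_add]
        linarith [hx.1]
      · rcases List.mem_cons.1 hb with rfl | hb
        · exact ⟨j, hj, rfl, he, heY⟩
        · exact hx.2 b hb)
    (fun x hx _ => hx)
    (fun x y hx hy _ => by
      refine ⟨?_, fun b hb => ?_⟩
      · simp only [List.map_append, List.sum_append, Nat.cast_add]
        linarith [hx.1, hy.1]
      · rcases List.mem_append.1 hb with hb | hb
        · exact hx.2 b hb
        · exact hy.2 b hb) v.length le_rfl
  intro x hx
  rw [rootTable_eq] at hx
  rcases lookup_cases (2 ^ v.length) 1 (levels u sc js v.length) with ⟨h, -⟩ | ⟨e, he, -, h⟩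
  · rw [h, List.mem_singleton] at hx
    rw [hx]; simp
  · rw [h] at hx
    exact (hind e he).2.2 x hx

end TreeCost

/-! ### Earliest deadline first -/

/-- The time that a job released at `r` with `m` units of work left gets from the free
interval `f`. -/
def takeAmt (r m : ℕ) (f : ℕ × ℕ) : ℕ := if r ≤ f.1 then min m (f.2 - f.1) else 0

/-- Put as much as possible of the job `i` at the beginning of the free interval `f`. The state
consists of the work left, the new free intervals, and the pieces of the schedule. -/
def placeStep (i r : ℕ) (s : ℕ × List (ℕ × ℕ) × List (ℕ × ℕ × ℕ)) (f : ℕ × ℕ) :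
    ℕ × List (ℕ × ℕ) × List (ℕ × ℕ × ℕ) :=
  (s.1 - takeAmt r s.1 f, s.2.1 ++ [(f.1 + takeAmt r s.1 f, f.2)],
    (i, f.1, f.1 + takeAmt r s.1 f) :: s.2.2)

/-- Schedule the jobs of the list `l` one after another, each as early as possible in the intervals
that are still free. -/
def schedule (F : List (ℕ × ℕ)) (l : List JobData) : List (ℕ × ℕ) × List (ℕ × ℕ × ℕ) :=
  l.foldl (fun s j => (s.1.foldl (placeStep j.1 j.2.2.1) (j.2.1, [], s.2)).2) (F, [])

/-- The free intervals that remain after a job has been placed. -/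
def newFree (r : ℕ) : ℕ → List (ℕ × ℕ) → List (ℕ × ℕ)
  | _, [] => []
  | m, f :: F => (f.1 + takeAmt r m f, f.2) :: newFree r (m - takeAmt r m f) F

/-- The pieces of a job that is placed. -/
def newPieces (i r : ℕ) : ℕ → List (ℕ × ℕ) → List (ℕ × ℕ × ℕ)
  | _, [] => []
  | m, f :: F => (i, f.1, f.1 + takeAmt r m f) :: newPieces i r (m - takeAmt r m f) F

/-- The amount of work of a job for which there was no room. -/
def leftOver (r : ℕ) : ℕ → List (ℕ × ℕ) → ℕ
  | m, [] => m
  | m, f :: F => leftOver r (m - takeAmt r m f) F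

theorem foldl_placeStep (i r m : ℕ) (F G : List (ℕ × ℕ)) (P : List (ℕ × ℕ × ℕ)) :
    F.foldl (placeStep i r) (m, G, P) =
      (leftOver r m F, G ++ newFree r m F, (newPieces i r m F).reverse ++ P) := by
  induction F generalizing m G P with
  | nil => simp [leftOver, newFree, newPieces]
  | cons f F ih => simp [placeStep, ih, leftOver, newFree, newPieces]

theorem takeAmt_le (r m : ℕ) (f : ℕ × ℕ) : takeAmt r m f ≤ m ∧ takeAmt r m f ≤ f.2 - f.1 := by
  unfold takeAmt; split_ifs <;> omega

/-- The processing time of the jobs of `A` that are released up to time `x`. -/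
def cum (A : List JobData) (x : ℕ) : ℕ := (A.map fun j => if j.2.2.1 ≤ x then j.2.1 else 0).sum

/-- The processing time of the jobs of `A` that are released at time `s` or later. -/
def late (A : List JobData) (s : ℕ) : ℕ := (A.map fun j => if s ≤ j.2.2.1 then j.2.1 else 0).sum

theorem cum_cons (j : JobData) (A : List JobData) (x : ℕ) :
    cum (j :: A) x = (if j.2.2.1 ≤ x then j.2.1 else 0) + cum A x := by simp [cum]

theorem cum_mono (A : List JobData) {x y : ℕ} (h : x ≤ y) : cum A x ≤ cum A y := by
  refine List.sum_le_sum fun j _ => ?_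
  split_ifs <;> omega

/-- The free intervals `F`, whose right ends cut the time line from `x` on, are those that remain
after the jobs of `A` have been processed without unnecessary idleness, where the time `S` before
`x` has been used for them: in every interval, the time used is the smaller one of its length and of
the backlog. The jobs of `js` are only released at ends of the intervals. -/
def Busy (js A : List JobData) : ℕ → ℕ → List (ℕ × ℕ) → Prop
  | _, _, [] => True
  | S, x, f :: F => x ≤ f.2 ∧ (∀ j ∈ js, x < j.2.2.1 → f.2 ≤ j.2.2.1) ∧
      f.1 = x + min (f.2 - x) (cum A x - S) ∧ Busy js A (S + (f.1 - x)) f.2 F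

/-- Every interval that has been used has only been used until time `t`. -/
def Early (t : ℕ) : ℕ → List (ℕ × ℕ) → Prop
  | _, [] => True
  | x, f :: F => (f.1 = x ∨ f.1 ≤ t) ∧ Early t f.2 F

/-- The last interval begins at time `r` or later and ends after time `t`. -/
def EndsLate (r t : ℕ) : ℕ → List (ℕ × ℕ) → Prop
  | _, [] => False
  | x, [f] => r ≤ x ∧ x < f.2 ∧ t < f.2
  | _, f :: F => EndsLate r t f.2 F

section Place

variable {js A : List JobData}

theorem Busy.bounds {S x : ℕ} {F : List (ℕ × ℕ)} (h : Busy js A S x F) :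
    ∀ f ∈ F, x ≤ f.1 ∧ f.1 ≤ f.2 := by
  induction F generalizing S x with
  | nil => simp
  | cons f F ih =>
    obtain ⟨h1, -, h3, h4⟩ := h
    intro g hg
    rcases List.mem_cons.1 hg with rfl | hg
    · omega
    · have := ih h4 g hg; omega

/-- Placing a job keeps the free intervals busy. Either the release of the job is still ahead, or it
has passed, and then the work placed and the work left add up to the processing time. -/
theorem Busy.place {j : JobData} (hj : j ∈ js) {S S' x m : ℕ} {F : List (ℕ × ℕ)}
    (h : Busy js A S x F) (hS : S ≤ cum A x) (hm : m ≤ j.2.1)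
    (hphase : (x ≤ j.2.2.1 ∧ m = j.2.1 ∧ S' = S) ∨ (j.2.2.1 ≤ x ∧ S' + m = S + j.2.1)) :
    Busy js (j :: A) S' x (newFree j.2.2.1 m F) := by
  induction F generalizing S S' x m with
  | nil => trivial
  | cons f F ih =>
    obtain ⟨h1, h2, h3, h4⟩ := h
    have h5 := h2 j hj
    have h6 := cum_mono A h1
    have h7 := takeAmt_le j.2.2.1 m f
    have h8 : S + (f.1 - x) ≤ cum A f.2 := by omega
    rw [newFree, Busy]
    refine ⟨h1, h2, ?_, ih h4 h8 (by omega) ?_⟩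
    · rw [cum_cons]
      dsimp only
      by_cases hx : j.2.2.1 ≤ x
      · have : takeAmt j.2.2.1 m f = min m (f.2 - f.1) := if_pos (by omega)
        rw [if_pos hx]
        omega
      · have : takeAmt j.2.2.1 m f = 0 := by unfold takeAmt; split_ifs <;> omega
        rw [if_neg hx]
        omega
    · dsimp only
      by_cases hx : j.2.2.1 ≤ x
      · refine .inr ?_
        omega
      · have : takeAmt j.2.2.1 m f = 0 := by unfold takeAmt; split_ifs <;> omega
        refine .inl ?_
        omega

/-- The backlog at the time up to which an interval has been used is due to the jobs released since
some earlier time `s` at which there was no backlog. -/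
theorem Busy.early (hA : ∀ j ∈ A, j ∈ js) {t S x : ℕ} {F : List (ℕ × ℕ)} (h : Busy js A S x F)
    (hS : S ≤ cum A x) (hlate : ∀ s ≤ t, s + late A s ≤ t) (hrel : ∀ j ∈ A, j.2.2.1 < t)
    (hback : ∃ s ≤ x, x + (cum A x - S) + late A (x + 1) ≤ s + late A s) : Early t x F := by
  induction F generalizing S x with
  | nil => trivial
  | cons f F ih =>
    obtain ⟨h1, h2, h3, h4⟩ := h
    obtain ⟨s, hs, hb⟩ := hback
    have hsplit : ∀ y, cum A y + late A (y + 1) = cum A x + late A (x + 1) := fun y => by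
      have : ∀ z, cum A z + late A (z + 1) = (A.map fun j => j.2.1).sum := fun z => by
        rw [cum, late, ← List.sum_map_add]
        refine congrArg List.sum (List.map_congr_left fun j _ => ?_)
        split_ifs <;> omega
      rw [this, this]
    refine ⟨?_, ih h4 (by have := cum_mono A h1; omega) ?_⟩
    · by_cases hx : f.1 = x
      · exact .inl hx
      · refine .inr ?_
        by_cases hst : s ≤ t
        · have := hlate s hst; omega
        · have : late A s = 0 := by
            refine List.sum_eq_zero fun n hn => ?_
            obtain ⟨j, hj, rfl⟩ := List.mem_map.1 hn
            have := hrel j hj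
            rw [if_neg (by omega)]
          omega
    · have h6 := hsplit f.2
      have h7 := cum_mono A h1
      by_cases hfull : f.2 - x ≤ cum A x - S
      · exact ⟨s, by omega, by omega⟩
      · refine ⟨f.2, le_rfl, ?_⟩
        -- the backlog is cleared, so that the new backlog is released at the end of the interval
        have : late A f.2 = late A (x + 1) := by
          refine congrArg List.sum (List.map_congr_left fun j hj => ?_)
          have := h2 j (hA j hj)
          split_ifs <;> omega
        omega

/-- If no interval is used beyond time `t`, then the last interval is not used up, and hence the job
is placed completely. -/
theorem leftOver_eq_zero {r t S x m : ℕ} {F : List (ℕ × ℕ)} (hB : Busy js A S x F)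
    (h : Early t x (newFree r m F)) (hE : EndsLate r t x F) : leftOver r m F = 0 := by
  induction F generalizing S x m with
  | nil => exact hE.elim
  | cons f F ih =>
    obtain ⟨h1, h2⟩ := h
    obtain ⟨h3, -, h5, h6⟩ := hB
    cases F with
    | nil =>
      obtain ⟨e1, e2, e3⟩ := hE
      have : takeAmt r m f = min m (f.2 - f.1) := if_pos (by omega)
      simp only [leftOver] at *
      omega
    | cons g G => exact ih h6 h2 hE

theorem EndsLate.place {r t x m r' : ℕ} {F : List (ℕ × ℕ)} (hE : EndsLate r t x F) :
    EndsLate r t x (newFree r' m F) := by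
  induction F generalizing x m with
  | nil => exact hE
  | cons f F ih =>
    cases F with
    | nil => exact hE
    | cons g G => exact ih (x := f.2) hE

/-- Two pieces do not overlap. -/
def Apart (p q : ℕ × ℕ) : Prop := p.2 ≤ q.1 ∨ q.2 ≤ p.1

theorem newPieces_spec {i r t S x m : ℕ} {F : List (ℕ × ℕ)} (hB : Busy js A S x F)
    (h : Early t x (newFree r m F)) : ∀ q ∈ newPieces i r m F, q.1 = i ∧
      (q.2.1 < q.2.2 → r ≤ q.2.1 ∧ q.2.2 ≤ t) ∧ q.2.1 ≤ q.2.2 ∧ x ≤ q.2.1 ∧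
      (∃ f ∈ F, f.1 = q.2.1 ∧ q.2.2 ≤ f.2) ∧ ∀ f ∈ newFree r m F, Apart q.2 f := by
  induction F generalizing S x m with
  | nil => simp [newPieces]
  | cons f F ih =>
    obtain ⟨h1, h2⟩ := h
    obtain ⟨h3, h4, h5, h6⟩ := hB
    have h7 := takeAmt_le r m f
    intro q hq
    rw [newPieces, List.mem_cons] at hq
    rcases hq with rfl | hq
    · refine ⟨rfl, fun hlt => ⟨?_, ?_⟩, by simp, by dsimp only; omega,
        ⟨f, by simp, rfl, by dsimp only; omega⟩, fun g hg => .inl ?_⟩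
      · by_contra hcon
        simp [takeAmt, hcon] at hlt
      · dsimp only at *; omega
      · have hF : ∀ (F : List (ℕ × ℕ)) m y, (∀ f ∈ F, y ≤ f.1) → ∀ g ∈ newFree r m F, y ≤ g.1 := by
          intro F
          induction F with
          | nil => simp [newFree]
          | cons f F ihF =>
            intro m y hy g hg
            rw [newFree, List.mem_cons] at hg
            rcases hg with rfl | hg
            · have := hy f (by simp); dsimp only; omega
            · exact ihF _ y (fun f hf => hy f (by simp [hf])) g hg
        rw [newFree, List.mem_cons] at hg
        rcases hg with rfl | hg
        · exact le_rfl
        · have := hF F _ f.2 (fun g hg => (h6.bounds g hg).1) g hg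
          dsimp only; omega
    · obtain ⟨e1, e2, e3, e4, ⟨g, hg, e5⟩, e6⟩ := ih h6 h2 q hq
      refine ⟨e1, e2, e3, by omega, ⟨g, by simp [hg], e5⟩, fun g hg => ?_⟩
      rw [newFree, List.mem_cons] at hg
      rcases hg with rfl | hg
      · exact .inr e4
      · exact e6 g hg

/-- The set of times covered by the pieces of the job `i`. -/
def pieceSet (P : List (ℕ × ℕ × ℕ)) (i : ℕ) : Set ℝ :=
  {y | ∃ q ∈ P, q.1 = i ∧ (q.2.1 : ℝ) ≤ y ∧ y < (q.2.2 : ℝ)}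

theorem pieceSet_cons (q : ℕ × ℕ × ℕ) (P : List (ℕ × ℕ × ℕ)) (i : ℕ) : pieceSet (q :: P) i =
    (if q.1 = i then Set.Ico (q.2.1 : ℝ) q.2.2 else ∅) ∪ pieceSet P i := by
  ext y
  by_cases h : q.1 = i <;> simp [pieceSet, h]

theorem measurableSet_pieceSet (P : List (ℕ × ℕ × ℕ)) (i : ℕ) : MeasurableSet (pieceSet P i) := by
  induction P with
  | nil => simp [pieceSet]
  | cons q P ih =>
    rw [pieceSet_cons]
    refine MeasurableSet.union ?_ ih
    split_ifs
    · exact measurableSet_Ico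
    · exact MeasurableSet.empty

theorem pieceSet_append (P Q : List (ℕ × ℕ × ℕ)) (i : ℕ) :
    pieceSet (P ++ Q) i = pieceSet P i ∪ pieceSet Q i := by
  induction P with
  | nil => simp [pieceSet]
  | cons q P ih => rw [List.cons_append, pieceSet_cons, ih, pieceSet_cons, Set.union_assoc]

theorem pieceSet_reverse (P : List (ℕ × ℕ × ℕ)) (i : ℕ) : pieceSet P.reverse i = pieceSet P i := by
  simp [pieceSet]

theorem pieceSet_eq_empty {P : List (ℕ × ℕ × ℕ)} {i : ℕ} (h : ∀ q ∈ P, q.1 ≠ i) :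
    pieceSet P i = ∅ := by
  rw [Set.eq_empty_iff_forall_notMem]
  rintro y ⟨q, hq, hqi, -⟩
  exact h q hq hqi

theorem volume_newPieces {i r S x m : ℕ} {F : List (ℕ × ℕ)} (hB : Busy js A S x F) :
    MeasureTheory.volume (pieceSet (newPieces i r m F) i) = ((m - leftOver r m F : ℕ) : ℝ≥0∞) ∧
      pieceSet (newPieces i r m F) i ⊆ Set.Ici (x : ℝ) ∧ leftOver r m F ≤ m := by
  induction F generalizing S x m with
  | nil => simp [newPieces, leftOver, pieceSet]
  | cons f F ih =>
    obtain ⟨h3, h4, h5, h6⟩ := hB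
    have h7 := takeAmt_le r m f
    obtain ⟨e1, e2, e3⟩ := ih h6 (m := m - takeAmt r m f)
    rw [newPieces, pieceSet_cons, if_pos rfl]
    refine ⟨?_, Set.union_subset ?_ (e2.trans ?_), by rw [leftOver]; omega⟩
    · rw [MeasureTheory.measure_union _ (measurableSet_pieceSet _ _), e1, Real.volume_Ico, leftOver]
      · rw [show ((f.1 + takeAmt r m f : ℕ) : ℝ) - (f.1 : ℝ) = (takeAmt r m f : ℕ) by
            push_cast; ring,
          ENNReal.ofReal_natCast, ← Nat.cast_add]
        congr 1
        omega
      · refine Set.disjoint_left.2 fun y hy hy' => ?_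
        have h8 : (f.2 : ℝ) ≤ y := e2 hy'
        have h9 : ((f.1 + takeAmt r m f : ℕ) : ℝ) ≤ f.2 := by exact_mod_cast (by omega)
        exact absurd hy.2 (not_lt.2 (h9.trans h8))
    · intro y hy
      have h8 : (x : ℝ) ≤ f.1 := by exact_mod_cast (by omega)
      exact h8.trans hy.1
    · refine Set.Ici_subset_Ici.2 ?_
      exact_mod_cast h3

end Place

/-- The time line up to `E`, cut at the release times; the jobs are listed by decreasing release
times. The first component is the earliest release time. -/
def freeIntervals (E : ℕ) (js : List JobData) : ℕ × List (ℕ × ℕ) :=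
  js.foldl (fun s j => (j.2.2.1, (j.2.2.1, s.1) :: s.2)) (E, [])

theorem freeIntervals_spec {E : ℕ} {js : List JobData}
    (hsort : js.Pairwise fun i j => j.2.2.1 ≤ i.2.2.1) (hE : ∀ j ∈ js, j.2.2.1 < E) :
    Busy js [] 0 (freeIntervals E js).1 (freeIntervals E js).2 ∧
      (∀ j ∈ js, (freeIntervals E js).1 ≤ j.2.2.1) ∧
      ∀ j ∈ js, ∀ t < E, EndsLate j.2.2.1 t (freeIntervals E js).1 (freeIntervals E js).2 := by
  have key : ∀ m l, m ++ l = js → Busy js [] 0 (freeIntervals E m).1 (freeIntervals E m).2 ∧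
      (∀ j ∈ m, (freeIntervals E m).1 ≤ j.2.2.1) ∧ (∀ j ∈ l, j.2.2.1 ≤ (freeIntervals E m).1) ∧
      (m ≠ [] → ∀ j ∈ js, ∀ t < E,
        EndsLate j.2.2.1 t (freeIntervals E m).1 (freeIntervals E m).2) := by
    intro m
    induction m using List.reverseRecOn with
    | nil =>
      intro l hl
      simp only [List.nil_append] at hl
      exact ⟨trivial, by simp, fun j hj => (hE j (hl ▸ hj)).le, fun h => absurd rfl h⟩
    | append_singleton m i ih =>
      intro l hl
      rw [List.append_assoc] at hl
      obtain ⟨h1, h2, h3, h4⟩ := ih _ hl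
      have e : freeIntervals E (m ++ [i]) =
          (i.2.2.1, (i.2.2.1, (freeIntervals E m).1) :: (freeIntervals E m).2) := by
        simp [freeIntervals]
      have hs := hsort
      rw [← hl, List.pairwise_append] at hs
      obtain ⟨-, hs2, hs3⟩ := hs
      rw [List.singleton_append, List.pairwise_cons] at hs2
      have hi := h3 i (by simp)
      rw [e]
      refine ⟨⟨hi, fun j hj hlt => ?_, by simp [cum], by simpa using h1⟩, ?_, hs2.1, ?_⟩
      · rw [← hl, List.mem_append] at hj
        rcases hj with hj | hj
        · exact h2 j hj
        · rcases List.mem_cons.1 hj with rfl | hj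
          · exact absurd hlt (lt_irrefl _)
          · exact absurd (hs2.1 j hj) (not_le.2 hlt)
      · intro j hj
        rw [List.mem_append, List.mem_singleton] at hj
        rcases hj with hj | rfl
        · exact hs3 j hj i (by simp)
        · exact le_rfl
      · intro _ j hj t ht
        cases m with
        | nil =>
          have hji : j.2.2.1 ≤ i.2.2.1 := by
            rw [← hl, List.nil_append, List.singleton_append, List.mem_cons] at hj
            rcases hj with rfl | hj
            · exact le_rfl
            · exact hs2.1 j hj
          exact ⟨hji, hE i (by rw [← hl]; simp), ht⟩
        | cons k m =>
          have h5 := h4 (by simp) j hj t ht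
          generalize (freeIntervals E (k :: m)).1 = y at h5 ⊢
          generalize (freeIntervals E (k :: m)).2 = G at h5 ⊢
          cases G with
          | nil => exact h5.elim
          | cons g G => exact h5
  obtain ⟨h1, h2, -, h4⟩ := key js [] (by simp)
  refine ⟨h1, h2, fun j hj => h4 (List.ne_nil_of_mem hj) j hj⟩

theorem newFree_subset {r m : ℕ} {F : List (ℕ × ℕ)} :
    ∀ f ∈ newFree r m F, ∃ g ∈ F, g.1 ≤ f.1 ∧ f.2 = g.2 := by
  induction F generalizing m with
  | nil => simp [newFree]
  | cons f F ih =>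
    intro g hg
    rw [newFree, List.mem_cons] at hg
    rcases hg with rfl | hg
    · exact ⟨f, by simp, by simp⟩
    · obtain ⟨h, hh, h'⟩ := ih g hg
      exact ⟨h, by simp [hh], h'⟩

/-- What is true of the schedule `s`, that is of the free intervals and the pieces, after the jobs
of `A` have been placed. -/
structure Placed (js A : List JobData) (D : ℕ → ℕ) (x : ℕ) (s : List (ℕ × ℕ) × List (ℕ × ℕ × ℕ)) :
    Prop where
  busy : Busy js A 0 x s.1
  ends : ∀ j ∈ js, EndsLate j.2.2.1 (D j.1) x s.1
  index : ∀ q ∈ s.2, ∃ j ∈ A, q.1 = j.1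
  free : ∀ q ∈ s.2, ∀ f ∈ s.1, Apart q.2 f
  volume : ∀ j ∈ A, MeasureTheory.volume (pieceSet s.2 j.1) = (j.2.1 : ℝ≥0∞)
  window : ∀ q ∈ s.2, ∀ j ∈ A, q.1 = j.1 → q.2.1 < q.2.2 → j.2.2.1 ≤ q.2.1 ∧ q.2.2 ≤ D j.1
  apart : ∀ q ∈ s.2, ∀ q' ∈ s.2, q.1 ≠ q'.1 → Apart q.2 q'.2

/-- Among jobs placed in the order of their deadlines, the next one meets its deadline. -/
theorem Placed.step {js A : List JobData} {D : ℕ → ℕ} {x : ℕ}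
    {s : List (ℕ × ℕ) × List (ℕ × ℕ × ℕ)} (h : Placed js A D x s) {j : JobData}
    (hsub : ∃ l, (l ++ j :: A).Perm js) (hnd : ∀ i ∈ A, i.1 ≠ j.1) (hle : ∀ i ∈ A, D i.1 ≤ D j.1)
    (hx : ∀ j ∈ js, x ≤ j.2.2.1) (hD : ∀ j ∈ js, j.2.2.1 < D j.1)
    (hdem : ∀ t, ∀ s ≤ t, s + dem js D s t ≤ t) :
    Placed js (j :: A) D x (newFree j.2.2.1 j.2.1 s.1,
      (newPieces j.1 j.2.2.1 j.2.1 s.1).reverse ++ s.2) := by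
  obtain ⟨l, hl⟩ := hsub
  have hmem : ∀ i ∈ j :: A, i ∈ js := fun i hi => hl.subset (List.mem_append_right _ hi)
  have hj : j ∈ js := hmem j (by simp)
  have hDA : ∀ i ∈ j :: A, D i.1 ≤ D j.1 := by
    intro i hi
    rcases List.mem_cons.1 hi with rfl | hi
    · exact le_rfl
    · exact hle i hi
  have hbusy := h.busy.place hj (S' := 0) (m := j.2.1) (Nat.zero_le _) le_rfl
    (.inl ⟨hx j hj, rfl, rfl⟩)
  have hearly : Early (D j.1) x (newFree j.2.2.1 j.2.1 s.1) := by
    refine hbusy.early hmem (Nat.zero_le _) (fun s hs => ?_)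
      (fun i hi => (hD i (hmem i hi)).trans_le (hDA i hi)) ⟨x, le_rfl, ?_⟩
    · have h1 : late (j :: A) s = dem (j :: A) D s (D j.1) := by
        refine congrArg List.sum (List.map_congr_left fun i hi => ?_)
        have := hDA i hi
        simp [this]
      have h2 := dem_perm (D := D) (s := s) (t := D j.1) hl
      rw [dem_append] at h2
      have := hdem (D j.1) s hs
      omega
    · have : cum (j :: A) x + late (j :: A) (x + 1) = late (j :: A) x := by
        rw [cum, late, late, ← List.sum_map_add]
        refine congrArg List.sum (List.map_congr_left fun i hi => ?_)
        have := hx i (hmem i hi)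
        split_ifs <;> omega
      omega
  have hleft := leftOver_eq_zero h.busy hearly (h.ends j hj)
  have hspec := newPieces_spec (i := j.1) h.busy hearly
  have hvol := (volume_newPieces (i := j.1) (r := j.2.2.1) (m := j.2.1) h.busy).1
  rw [hleft, Nat.sub_zero] at hvol
  have hold : ∀ q ∈ s.2, q.1 ≠ j.1 := by
    intro q hq
    obtain ⟨i, hi, hqi⟩ := h.index q hq
    rw [hqi]
    exact hnd i hi
  -- the new pieces lie in free intervals, and hence apart from the old ones
  have hcross : ∀ q ∈ newPieces j.1 j.2.2.1 j.2.1 s.1, ∀ q' ∈ s.2, Apart q.2 q'.2 := by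
    intro q hq q' hq'
    obtain ⟨-, -, -, -, ⟨f, hf, h1, h2⟩, -⟩ := hspec q hq
    rcases h.free q' hq' f hf with h3 | h3
    · exact .inr (by omega)
    · exact .inl (by omega)
  have hin : ∀ q, q ∈ (newPieces j.1 j.2.2.1 j.2.1 s.1).reverse ++ s.2 →
      q ∈ newPieces j.1 j.2.2.1 j.2.1 s.1 ∨ q ∈ s.2 := by simp
  refine ⟨hbusy, fun i hi => (h.ends i hi).place, fun q hq => ?_, fun q hq f hf => ?_,
    fun i hi => ?_, fun q hq i hi hqi hlt => ?_, fun q hq q' hq' hne => ?_⟩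
  · rcases hin q hq with hq | hq
    · exact ⟨j, by simp, (hspec q hq).1⟩
    · obtain ⟨i, hi, h1⟩ := h.index q hq
      exact ⟨i, by simp [hi], h1⟩
  · rcases hin q hq with hq | hq
    · exact (hspec q hq).2.2.2.2.2 f hf
    · obtain ⟨g, hg, h1, h2⟩ := newFree_subset f hf
      rcases h.free q hq g hg with h3 | h3
      · exact .inl (by omega)
      · exact .inr (by omega)
  · dsimp only
    rw [pieceSet_append, pieceSet_reverse]
    rcases List.mem_cons.1 hi with rfl | hi
    · rw [pieceSet_eq_empty hold, Set.union_empty, hvol]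
    · rw [pieceSet_eq_empty (P := newPieces _ _ _ _) (i := i.1), Set.empty_union, h.volume i hi]
      intro q hq
      rw [(hspec q hq).1]
      exact (hnd i hi).symm
  · rcases hin q hq with hq' | hq'
    · rcases List.mem_cons.1 hi with rfl | hi
      · exact (hspec q hq').2.1 hlt
      · exact absurd (hqi.symm.trans (hspec q hq').1) (hnd i hi)
    · rcases List.mem_cons.1 hi with rfl | hi
      · exact absurd hqi (hold q hq')
      · exact h.window q hq' i hi hqi hlt
  · rcases hin q hq with hq | hq <;> rcases hin q' hq' with hq' | hq'
    · exact absurd ((hspec q hq).1.trans (hspec q' hq').1.symm) hne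
    · exact hcross q hq q' hq'
    · exact (hcross q' hq' q hq).symm
    · exact h.apart q hq q' hq' hne

/-- If the jobs are placed in the order of their deadlines and the demand condition holds, then all
deadlines are met. -/
theorem placed_schedule {js ls : List JobData} {D : ℕ → ℕ} {E : ℕ}
    (hsort : js.Pairwise fun i j => j.2.2.1 ≤ i.2.2.1) (hE : ∀ j ∈ js, D j.1 < E)
    (hD : ∀ j ∈ js, j.2.2.1 < D j.1) (hdem : ∀ t, ∀ s ≤ t, s + dem js D s t ≤ t)
    (hperm : ls.Perm js) (hls : ls.Pairwise fun i j => D i.1 ≤ D j.1)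
    (hnd : (ls.map fun j => j.1).Nodup) :
    Placed js ls.reverse D (freeIntervals E js).1 (schedule (freeIntervals E js).2 ls) := by
  obtain ⟨h1, h2, h3⟩ := freeIntervals_spec hsort fun j hj => (hD j hj).trans (hE j hj)
  have key : ∀ A l, A ++ l = ls →
      Placed js A.reverse D (freeIntervals E js).1 (schedule (freeIntervals E js).2 A) := by
    intro A
    induction A using List.reverseRecOn with
    | nil =>
      exact fun _ _ => ⟨h1, fun j hj => h3 j hj _ (hE j hj), by simp [schedule], by simp [schedule],
        by simp, by simp, by simp [schedule]⟩
    | append_singleton A j ih =>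
      intro l hl
      rw [List.append_assoc] at hl
      have ih := ih _ hl
      rw [← hl, List.map_append, List.nodup_append] at hnd
      rw [← hl, List.pairwise_append] at hls
      rw [schedule, List.foldl_append, List.foldl_cons, List.foldl_nil, ← schedule,
        foldl_placeStep, List.nil_append, List.reverse_append, List.reverse_singleton,
        List.singleton_append]
      refine ih.step ⟨l, ?_⟩ (fun i hi => ?_) (fun i hi => ?_) h2 hD hdem
      · refine List.Perm.trans ?_ hperm
        rw [← hl]
        refine List.perm_append_comm.trans ?_
        rw [List.singleton_append, List.cons_append]
        refine List.Perm.trans ?_ List.perm_middle.symm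
        exact ((List.reverse_perm A).append_right l).cons j
      · exact hnd.2.2 i.1 (List.mem_map_of_mem (List.mem_reverse.1 hi)) j.1 (by simp)
      · exact hls.2.2 i (List.mem_reverse.1 hi) j (by simp)
  exact key ls [] (by simp)

/-! ### The algorithm -/

/-- The jobs of an instance with their indices. -/
def index (I : List (ℕ × ℕ × ℕ)) : List JobData := I.foldl (fun s j => s ++ [(s.length, j)]) []

theorem index_append (I : List (ℕ × ℕ × ℕ)) (j : ℕ × ℕ × ℕ) :
    index (I ++ [j]) = index I ++ [((index I).length, j)] := by simp [index]

theorem length_index (I : List (ℕ × ℕ × ℕ)) : (index I).length = I.length := by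
  induction I using List.reverseRecOn with
  | nil => rfl
  | append_singleton I j ih => simp [index_append, ih]

/-- The unary number `K`, where `2 ^ K` exceeds the sum of all processing and release times. -/
def horizon (I : List (ℕ × ℕ × ℕ)) : List ℕ :=
  List.replicate (Nat.size (I.map fun j => j.1 + j.2.1).sum) 0

/-- The jobs in the order of decreasing release times. All times are shifted by `2 ^ K`, so that
they belong to the root cell `[2 ^ K, 2 ^ (K + 1))`. -/
def jobData (I : List (ℕ × ℕ × ℕ)) : List JobData :=
  (sortKey (fun j => j.2.2.1) ((index I).map fun j =>
    (j.1, j.2.1, j.2.2.1 + 2 ^ (horizon I).length, j.2.2.2))).reverse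

/-- The number `3 * n * (K + 1)` in unary, which bounds the number of segments of a solution. -/
def segBound (I : List (ℕ × ℕ × ℕ)) : List ℕ :=
  I.flatMap fun _ => (0 :: horizon I) ++ (0 :: horizon I) ++ (0 :: horizon I)

/-- The admissible scaled costs in unary: those up to `E + 1` times the bound on the number of
segments. -/
def budget (E : ℕ) (I : List (ℕ × ℕ × ℕ)) : List ℕ :=
  0 :: (segBound I).flatMap fun _ => List.replicate (E + 1) 0

/-- A unary upper bound on the binary length of the cost of all solutions, where `2 ^ (c * (K + 1))`
bounds the cost of a segment of a job of unit weight. -/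
def scaleBound (c : ℕ) (I : List (ℕ × ℕ × ℕ)) : List ℕ :=
  segBound I ++ List.replicate (Nat.size (I.map fun j => j.2.2).sum) 0 ++
    ((0 :: horizon I).flatMap fun _ => List.replicate c 0) ++ [0]

/-- The guesses for the optimal cost: the powers of two. -/
def scales (c : ℕ) (I : List (ℕ × ℕ × ℕ)) : List ℕ :=
  (List.range (scaleBound c I).length).map fun i =>
    2 ^ ((List.range (scaleBound c I).length).filter fun m => m < i).length

/-- The cost of the segment of the job `j` with end `e`, in units of `B / A` and rounded up; `y x`
is the cost of the flow time `x` for a job of unit weight. -/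
def scaledCost (y : ℕ → ℕ) (A B : ℕ) (j : JobData) (e : ℕ) : ℕ :=
  j.2.2.2 * y (e - j.2.2.1) * A / B + 1

/-- The solutions for all guesses, with costs in the same unit. -/
def solutions (y : ℕ → ℕ) (E c : ℕ) (I : List (ℕ × ℕ × ℕ)) : List (ℕ × List (ℕ × ℕ)) :=
  (scales c I).flatMap fun B => (rootTable (budget E I) (scaledCost y ((segBound I).length * E) B)
    (jobData I) (horizon I)).map fun x => (x.1 * B, x.2.2)

/-- The segments of the best solution. -/
def bestSol (y : ℕ → ℕ) (E c : ℕ) (I : List (ℕ × ℕ × ℕ)) : List (ℕ × ℕ) :=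
  (pick (fun x y : ℕ × List (ℕ × ℕ) => decide (x.1 ≤ y.1)) (solutions y E c I)).flatMap
    fun x => x.2

/-- The deadline of a job that a choice of segments entails: the latest end of a segment. -/
def deadline (sol : List (ℕ × ℕ)) (j : JobData) : ℕ :=
  ((sol.filter fun b => b.1 = j.1).map fun b => b.2).foldl (fun s b => max s b) (j.2.2.1 + 1)

/-- The pieces of the earliest-deadline-first schedule for the chosen segments, in shifted time. -/
def edf (sol : List (ℕ × ℕ)) (js : List JobData) : List (ℕ × ℕ × ℕ) :=
  (schedule (freeIntervals ((js.map fun j => deadline sol j).sum + 1) js).2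
    (sortKey (fun j => deadline sol j) js)).2

/-- The whole algorithm: the pieces of the schedule. -/
def solve (y : ℕ → ℕ) (E c : ℕ) (I : List (ℕ × ℕ × ℕ)) : List (ℕ × ℕ × ℕ) :=
  (edf (bestSol y E c I) (jobData I)).map fun q =>
    (q.1, q.2.1 - 2 ^ (horizon I).length, q.2.2 - 2 ^ (horizon I).length)

/-! ### The algorithm runs in polynomial time -/

section

variable {α : Type} [Enc α]

@[fun_prop]
theorem PolyTime.index {I : α → List (ℕ × ℕ × ℕ)} (hI : PolyTime I) :
    PolyTime fun a => index (I a) := by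
  refine foldl (g := fun _ => []) (h := fun _ (s : List JobData) j => s ++ [(s.length, j)])
    (B := fun a => 1 + sz (I a) * (1 + (2 + sz (I a) + sz (I a)))) hI (by fun_prop) (by fun_prop)
    ?_ fun a m hm => ?_
  · have := hI.polyBdd_sz
    exact (polyBdd_const 1).add (this.mul ((polyBdd_const 1).add
      (((polyBdd_const 2).add this).add this)))
  · have h1 : ∀ j ∈ FlowTime.index m, j.1 < m.length ∧ j.2 ∈ m := by
      clear hm
      induction m using List.reverseRecOn with
      | nil => simp [FlowTime.index]
      | append_singleton m i ih =>
        intro j hj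
        rw [index_append, List.mem_append, List.mem_singleton] at hj
        rcases hj with hj | rfl
        · have := ih j hj
          simp only [List.length_append, List.length_singleton, List.mem_append]
          exact ⟨by omega, .inl this.2⟩
        · simp [length_index]
    have h2 := hm.length_le.trans (length_le_sz (I a))
    change sz (FlowTime.index m) ≤ _
    refine (sz_list_le (B := 2 + sz (I a) + sz (I a)) fun j hj => ?_).trans ?_
    · have h3 := h1 j hj
      have h4 := sz_le_of_mem (hm.subset h3.2)
      have h5 := sz_nat_le j.1
      rw [sz_prod]; omega
    · rw [length_index]
      exact Nat.add_le_add_left (Nat.mul_le_mul_right _ h2) 1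

@[fun_prop]
theorem PolyTime.horizon {I : α → List (ℕ × ℕ × ℕ)} (hI : PolyTime I) :
    PolyTime fun a => horizon (I a) := by
  unfold FlowTime.horizon
  fun_prop

@[fun_prop]
theorem PolyTime.jobData {I : α → List (ℕ × ℕ × ℕ)} (hI : PolyTime I) :
    PolyTime fun a => jobData (I a) := by
  unfold FlowTime.jobData
  fun_prop

@[fun_prop]
theorem PolyTime.segBound {I : α → List (ℕ × ℕ × ℕ)} (hI : PolyTime I) :
    PolyTime fun a => segBound (I a) := by
  unfold FlowTime.segBound
  fun_prop

@[fun_prop]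
theorem PolyTime.budget (E : ℕ) {I : α → List (ℕ × ℕ × ℕ)} (hI : PolyTime I) :
    PolyTime fun a => budget E (I a) := by
  unfold FlowTime.budget
  fun_prop

@[fun_prop]
theorem PolyTime.scales (c : ℕ) {I : α → List (ℕ × ℕ × ℕ)} (hI : PolyTime I) :
    PolyTime fun a => scales c (I a) := by
  unfold FlowTime.scales FlowTime.scaleBound
  fun_prop

theorem PolyTime.scaledCost {y : α → ℕ → ℕ} {A B e : α → ℕ} {j : α → JobData}
    (hy : PolyTime fun x : α × ℕ => y x.1 x.2) (hA : PolyTime A) (hB : PolyTime B)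
    (hj : PolyTime j) (he : PolyTime e) :
    PolyTime fun a => scaledCost (y a) (A a) (B a) (j a) (e a) := by
  unfold FlowTime.scaledCost
  have : PolyTime fun a => y a (e a - (j a).2.2.1) :=
    comp hy (f := fun a => (a, e a - (j a).2.2.1)) (by fun_prop)
  fun_prop

theorem PolyTime.solutions {y : α → ℕ → ℕ} (hy : PolyTime fun x : α × ℕ => y x.1 x.2) (E c : ℕ)
    {I : α → List (ℕ × ℕ × ℕ)} (hI : PolyTime I) :
    PolyTime fun a => solutions (y a) E c (I a) := by
  unfold FlowTime.solutions
  have h : PolyTime fun x : α × ℕ => FlowTime.rootTable (FlowTime.budget E (I x.1))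
      (FlowTime.scaledCost (y x.1) ((FlowTime.segBound (I x.1)).length * E) x.2)
      (FlowTime.jobData (I x.1)) (FlowTime.horizon (I x.1)) := by
    refine rootTable (sc := fun x : α × ℕ => FlowTime.scaledCost (y x.1)
      ((FlowTime.segBound (I x.1)).length * E) x.2) (by fun_prop) ?_ (fun a j e => ?_)
      (by fun_prop) (by fun_prop)
    · refine scaledCost (y := fun x : (α × ℕ) × JobData × ℕ => y x.1.1) ?_ (by fun_prop)
        (by fun_prop) (by fun_prop) (by fun_prop)
      exact comp hy (f := fun x : ((α × ℕ) × JobData × ℕ) × ℕ => (x.1.1.1, x.2)) (by fun_prop)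
    · exact Nat.le_add_left 1 _
  fun_prop

theorem PolyTime.bestSol {y : α → ℕ → ℕ} (hy : PolyTime fun x : α × ℕ => y x.1 x.2) (E c : ℕ)
    {I : α → List (ℕ × ℕ × ℕ)} (hI : PolyTime I) :
    PolyTime fun a => bestSol (y a) E c (I a) := by
  unfold FlowTime.bestSol
  have := solutions hy E c hI
  fun_prop

@[fun_prop]
theorem PolyTime.deadline {sol : α → List (ℕ × ℕ)} {j : α → JobData} (hs : PolyTime sol)
    (hj : PolyTime j) : PolyTime fun a => deadline (sol a) (j a) := by
  unfold FlowTime.deadline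
  have hl : PolyTime fun a => ((sol a).filter fun b => b.1 = (j a).1).map fun b => b.2 := by
    fun_prop
  have hg : PolyTime fun a => (j a).2.2.1 + 1 := by fun_prop
  refine foldl (h := fun _ s b => Max.max s b)
    (B := fun a => sz (((sol a).filter fun b => b.1 = (j a).1).map fun b => b.2) +
      sz ((j a).2.2.1 + 1)) hl hg (by fun_prop) (hl.polyBdd_sz.add hg.polyBdd_sz) fun a m hm => ?_
  have h1 := sz_sublist hm.sublist
  have h2 : ∀ s : ℕ, sz (m.foldl (fun s b => Max.max s b) s) ≤ sz m + sz s := by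
    clear hm h1
    induction m with
    | nil => intro s; simp
    | cons b m ih =>
      intro s
      have h3 := ih (Max.max s b)
      have h4 : sz (Max.max s b) ≤ sz s + sz b := by
        rcases max_cases s b with ⟨h, -⟩ | ⟨h, -⟩ <;> rw [h] <;> omega
      simp only [List.foldl_cons, sz_cons]; omega
  have h3 := h2 ((j a).2.2.1 + 1)
  omega

@[fun_prop]
theorem PolyTime.freeIntervals {E : α → ℕ} {js : α → List JobData} (hE : PolyTime E)
    (hjs : PolyTime js) : PolyTime fun a => freeIntervals (E a) (js a) := by
  unfold FlowTime.freeIntervals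
  refine foldl (h := fun _ s (j : JobData) => (j.2.2.1, (j.2.2.1, s.1) :: s.2))
    (g := fun a => (E a, [])) (B := fun a => 1 + (sz (E a) + sz (js a)) +
      (1 + sz (js a) * (1 + (1 + sz (js a) + (sz (E a) + sz (js a)))))) hjs (by fun_prop)
    (by fun_prop) ?_ fun a m hm => ?_
  · have h1 := hE.polyBdd_sz
    have h2 := hjs.polyBdd_sz
    exact ((polyBdd_const 1).add (h1.add h2)).add ((polyBdd_const 1).add (h2.mul
      ((polyBdd_const 1).add (((polyBdd_const 1).add h2).add (h1.add h2)))))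
  · have h1 : sz (FlowTime.freeIntervals (E a) m).1 ≤ sz (E a) + sz (js a) ∧
        (FlowTime.freeIntervals (E a) m).2.length = m.length ∧
        ∀ f ∈ (FlowTime.freeIntervals (E a) m).2,
          sz f ≤ 1 + sz (js a) + (sz (E a) + sz (js a)) := by
      induction m using List.reverseRecOn with
      | nil => simp [FlowTime.freeIntervals]
      | append_singleton m j ih =>
        have ih := ih ((List.prefix_append _ _).trans hm)
        have hj := sz_le_of_mem (hm.subset (show j ∈ m ++ [j] by simp))
        rw [sz_prod, sz_prod, sz_prod] at hj
        rw [FlowTime.freeIntervals, List.foldl_append, List.foldl_cons, List.foldl_nil,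
          ← FlowTime.freeIntervals]
        refine ⟨by dsimp only; omega, by simp [ih.2.1], fun f hf => ?_⟩
        rcases List.mem_cons.1 hf with rfl | hf
        · rw [sz_pair]; omega
        · exact ih.2.2 f hf
    have h2 := sz_list_le h1.2.2
    have h3 := Nat.mul_le_mul_right (1 + (1 + sz (js a) + (sz (E a) + sz (js a))))
      (hm.length_le.trans (length_le_sz (js a)))
    change sz (FlowTime.freeIntervals (E a) m) ≤ _
    rw [sz_prod]
    rw [h1.2.1] at h2
    omega

@[fun_prop]
theorem PolyTime.takeAmt {r m : α → ℕ} {f : α → ℕ × ℕ} (hr : PolyTime r) (hm : PolyTime m)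
    (hf : PolyTime f) : PolyTime fun a => takeAmt (r a) (m a) (f a) := by
  unfold FlowTime.takeAmt
  fun_prop

@[fun_prop]
theorem PolyTime.placeStep {i r : α → ℕ} {s : α → ℕ × List (ℕ × ℕ) × List (ℕ × ℕ × ℕ)}
    {f : α → ℕ × ℕ} (hi : PolyTime i) (hr : PolyTime r) (hs : PolyTime s) (hf : PolyTime f) :
    PolyTime fun a => placeStep (i a) (r a) (s a) (f a) := by
  unfold FlowTime.placeStep
  fun_prop

theorem length_newFree (r m : ℕ) (F : List (ℕ × ℕ)) : (newFree r m F).length = F.length := by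
  induction F generalizing m with
  | nil => rfl
  | cons f F ih => simp [newFree, ih]

theorem length_newPieces (i r m : ℕ) (F : List (ℕ × ℕ)) :
    (newPieces i r m F).length = F.length := by
  induction F generalizing m with
  | nil => rfl
  | cons f F ih => simp [newPieces, ih]

theorem leftOver_le (r m : ℕ) (F : List (ℕ × ℕ)) : leftOver r m F ≤ m := by
  induction F generalizing m with
  | nil => exact le_rfl
  | cons f F ih => exact (ih _).trans (Nat.sub_le _ _)

theorem sz_newFree_le {r m B : ℕ} {F : List (ℕ × ℕ)} (h : ∀ f ∈ F, sz f.1 ≤ B ∧ sz f.2 ≤ B) :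
    (∀ f ∈ newFree r m F, sz f.1 ≤ B ∧ sz f.2 ≤ B) ∧
      ∀ i, ∀ q ∈ newPieces i r m F, q.1 = i ∧ sz q.2.1 ≤ B ∧ sz q.2.2 ≤ B := by
  induction F generalizing m with
  | nil => simp [newFree, newPieces]
  | cons f F ih =>
    have h1 := h f (by simp)
    have h2 : sz (f.1 + FlowTime.takeAmt r m f) ≤ B := by
      have := takeAmt_le r m f
      rcases le_total f.1 f.2 with hle | hle
      · exact (sz_nat_mono (by omega)).trans h1.2
      · exact (sz_nat_mono (by omega)).trans h1.1
    have ih := ih (m := m - FlowTime.takeAmt r m f) fun g hg => h g (by simp [hg])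
    refine ⟨fun g hg => ?_, fun i q hq => ?_⟩
    · rw [newFree, List.mem_cons] at hg
      rcases hg with rfl | hg
      · exact ⟨h2, h1.2⟩
      · exact ih.1 g hg
    · rw [newPieces, List.mem_cons] at hq
      rcases hq with rfl | hq
      · exact ⟨rfl, h1.1, h2⟩
      · exact ih.2 i q hq

/-- Placing one job takes polynomial time. -/
theorem PolyTime.place {j : α → JobData} {s : α → List (ℕ × ℕ) × List (ℕ × ℕ × ℕ)}
    (hj : PolyTime j) (hs : PolyTime s) : PolyTime fun a =>
      (s a).1.foldl (FlowTime.placeStep (j a).1 (j a).2.2.1) ((j a).2.1, [], (s a).2) := by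
  have h1 := hj.polyBdd_sz
  have h2 := hs.polyBdd_sz
  refine foldl (h := fun a t f => FlowTime.placeStep (j a).1 (j a).2.2.1 t f)
    (B := fun a => 2 + sz (j a) + (1 + sz (s a) * (1 + (1 + sz (s a) + sz (s a)))) +
      (1 + sz (s a) * (1 + (2 + sz (j a) + sz (s a) + sz (s a))) + sz (s a)))
    (by fun_prop) (by fun_prop) (by fun_prop) ?_ fun a m hm => ?_
  · exact (((polyBdd_const 2).add h1).add ((polyBdd_const 1).add (h2.mul ((polyBdd_const 1).add
      (((polyBdd_const 1).add h2).add h2))))).add (((polyBdd_const 1).add (h2.mul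
      ((polyBdd_const 1).add ((((polyBdd_const 2).add h1).add h2).add h2)))).add h2)
  · have hsz := sz_prod (s a)
    have hjz := sz_prod (j a)
    have hjz' := sz_prod (j a).2
    have hlen : m.length ≤ sz (s a) :=
      (hm.length_le.trans (length_le_sz (s a).1)).trans (by omega)
    have hF : ∀ f ∈ m, sz f.1 ≤ sz (s a) ∧ sz f.2 ≤ sz (s a) := fun f hf => by
      have h3 := sz_le_of_mem (hm.subset hf)
      rw [sz_prod] at h3
      omega
    have h3 := sz_newFree_le (r := (j a).2.2.1) (m := (j a).2.1) hF
    rw [foldl_placeStep, List.nil_append, sz_pair, sz_pair]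
    have h4 := sz_nat_mono (leftOver_le (j a).2.2.1 (j a).2.1 m)
    have h5 := (sz_list_le (l := newFree (j a).2.2.1 (j a).2.1 m) (B := 1 + sz (s a) + sz (s a))
      fun f hf => by have := h3.1 f hf; rw [sz_prod]; omega).trans
      (Nat.add_le_add_left (Nat.mul_le_mul_right _ ((length_newFree _ _ _).trans_le hlen)) 1)
    have h6 := (sz_list_le (l := newPieces (j a).1 (j a).2.2.1 (j a).2.1 m)
      (B := 2 + sz (j a) + sz (s a) + sz (s a)) fun q hq => by
        obtain ⟨e1, e2, e3⟩ := h3.2 _ q hq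
        rw [sz_prod, sz_prod, e1]; omega).trans
      (Nat.add_le_add_left (Nat.mul_le_mul_right _ ((length_newPieces _ _ _ _).trans_le hlen)) 1)
    have h7 := sz_append (newPieces (j a).1 (j a).2.2.1 (j a).2.1 m).reverse (s a).2
    rw [sz_perm (List.reverse_perm _)] at h7
    omega

@[fun_prop]
theorem PolyTime.schedule {F : α → List (ℕ × ℕ)} {l : α → List JobData} (hF : PolyTime F)
    (hl : PolyTime l) : PolyTime fun a => schedule (F a) (l a) := by
  have h1 := hF.polyBdd_sz
  have h2 := hl.polyBdd_sz
  refine foldl (h := fun _ (s : List (ℕ × ℕ) × List (ℕ × ℕ × ℕ)) (j : JobData) =>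
      (s.1.foldl (FlowTime.placeStep j.1 j.2.2.1) (j.2.1, [], s.2)).2) (g := fun a => (F a, []))
    (B := fun a => 1 + (1 + sz (F a) * (1 + (1 + sz (F a) + sz (F a)))) +
      (1 + sz (l a) * sz (F a) * (1 + (2 + sz (l a) + sz (F a) + sz (F a)))))
    hl (by fun_prop) ?_ ?_ fun a m hm => ?_
  · exact snd (place (j := fun x : α × (List (ℕ × ℕ) × List (ℕ × ℕ × ℕ)) × JobData => x.2.2)
      (s := fun x => x.2.1) (by fun_prop) (by fun_prop))
  · exact ((polyBdd_const 1).add ((polyBdd_const 1).add (h1.mul ((polyBdd_const 1).add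
      (((polyBdd_const 1).add h1).add h1))))).add ((polyBdd_const 1).add ((h2.mul h1).mul
      ((polyBdd_const 1).add ((((polyBdd_const 2).add h2).add h1).add h1))))
  · change sz (FlowTime.schedule (F a) m) ≤ _
    have hlen := hm.length_le.trans (length_le_sz (l a))
    have hFlen := length_le_sz (F a)
    have key : (∀ f ∈ (FlowTime.schedule (F a) m).1, sz f.1 ≤ sz (F a) ∧ sz f.2 ≤ sz (F a)) ∧
        (FlowTime.schedule (F a) m).1.length = (F a).length ∧
        (∀ q ∈ (FlowTime.schedule (F a) m).2, sz q ≤ 2 + sz (l a) + sz (F a) + sz (F a)) ∧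
        (FlowTime.schedule (F a) m).2.length = m.length * (F a).length := by
      clear hlen
      induction m using List.reverseRecOn with
      | nil =>
        refine ⟨fun f hf => ?_, rfl, by simp [FlowTime.schedule], by simp [FlowTime.schedule]⟩
        have h3 : sz f ≤ sz (F a) := sz_le_of_mem hf
        rw [sz_prod] at h3
        omega
      | append_singleton m j ih =>
        obtain ⟨e1, e2, e3, e4⟩ := ih ((List.prefix_append _ _).trans hm)
        have hj := sz_le_of_mem (hm.subset (show j ∈ m ++ [j] by simp))
        rw [sz_prod] at hj
        rw [FlowTime.schedule, List.foldl_append, List.foldl_cons, List.foldl_nil,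
          ← FlowTime.schedule, foldl_placeStep, List.nil_append]
        have h3 := sz_newFree_le (r := j.2.2.1) (m := j.2.1) e1
        refine ⟨h3.1, by simp [length_newFree, e2], fun q hq => ?_, ?_⟩
        · rcases List.mem_append.1 hq with hq | hq
          · obtain ⟨g1, g2, g3⟩ := h3.2 _ q (List.mem_reverse.1 hq)
            rw [sz_prod, sz_prod, g1]; omega
          · exact e3 q hq
        · simp only [List.length_append, List.length_reverse, length_newPieces, e2, e4,
            List.length_singleton]
          ring
    obtain ⟨e1, e2, e3, e4⟩ := key
    have h3 := (sz_list_le (l := (FlowTime.schedule (F a) m).1) (B := 1 + sz (F a) + sz (F a))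
      fun f hf => by have := e1 f hf; rw [sz_prod]; omega).trans
      (Nat.add_le_add_left (Nat.mul_le_mul_right _ (e2.trans_le hFlen)) 1)
    have h4 := (sz_list_le e3).trans (Nat.add_le_add_left (Nat.mul_le_mul_right _
      (e4.trans_le (Nat.mul_le_mul hlen hFlen))) 1)
    rw [sz_prod]
    omega

@[fun_prop]
theorem PolyTime.edf {sol : α → List (ℕ × ℕ)} {js : α → List JobData} (hs : PolyTime sol)
    (hj : PolyTime js) : PolyTime fun a => edf (sol a) (js a) := by
  unfold FlowTime.edf
  fun_prop

theorem PolyTime.solve {y : α → ℕ → ℕ} (hy : PolyTime fun x : α × ℕ => y x.1 x.2) (E c : ℕ)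
    {I : α → List (ℕ × ℕ × ℕ)} (hI : PolyTime I) : PolyTime fun a => solve (y a) E c (I a) :=
  map (edf (bestSol hy E c hI) (by fun_prop)) (by fun_prop)

end

/-! ### Correctness of the algorithm -/

/-- The data of the job with index `i`, in shifted time. -/
def shiftJob (I : List (ℕ × ℕ × ℕ)) (i : Fin I.length) : JobData :=
  (i, (I.get i).1, (I.get i).2.1 + 2 ^ (horizon I).length, (I.get i).2.2)

/-- The weight of the job with index `i`. -/
def wt (I : List (ℕ × ℕ × ℕ)) (i : ℕ) : ℕ := (I.getD i (0, 0, 0)).2.2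

/-- The shifted release time of the job with index `i`. -/
def rl (I : List (ℕ × ℕ × ℕ)) (i : ℕ) : ℕ := (I.getD i (0, 0, 0)).2.1 + 2 ^ (horizon I).length

section Spec

variable {I : List (ℕ × ℕ × ℕ)}

theorem index_eq (I : List (ℕ × ℕ × ℕ)) :
    index I = List.ofFn fun i : Fin I.length => ((i : ℕ), I.get i) := by
  have h : index I = I.mapIdx fun i j => (i, j) := by
    induction I using List.reverseRecOn with
    | nil => rfl
    | append_singleton I j ih => rw [index_append, List.mapIdx_append_one, ih]; simp
  rw [h, List.mapIdx_eq_ofFn]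

theorem jobData_perm (I : List (ℕ × ℕ × ℕ)) : (jobData I).Perm (List.ofFn (shiftJob I)) := by
  refine (List.reverse_perm _).trans ((sortKey_perm _ _).trans (List.Perm.of_eq ?_))
  rw [index_eq, List.map_ofFn]
  rfl

theorem jobData_sorted (I : List (ℕ × ℕ × ℕ)) :
    (jobData I).Pairwise fun i j => j.2.2.1 ≤ i.2.2.1 :=
  List.pairwise_reverse.2 (sortKey_sorted (fun j : JobData => j.2.2.1) _)

theorem mem_jobData {j : JobData} : j ∈ jobData I ↔ ∃ i, shiftJob I i = j := by
  rw [(jobData_perm I).mem_iff, List.mem_ofFn]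

theorem sum_jobData {M : Type} [AddCommMonoid M] (f : JobData → M) :
    ((jobData I).map f).sum = ∑ i, f (shiftJob I i) := by
  rw [((jobData_perm I).map f).sum_eq, List.map_ofFn, List.sum_ofFn]
  rfl

theorem wt_fin (i : Fin I.length) : wt I i = (I.get i).2.2 := by simp [wt]

theorem rl_fin (i : Fin I.length) : rl I i = (I.get i).2.1 + 2 ^ (horizon I).length := by simp [rl]

theorem wt_eq {j : JobData} (hj : j ∈ jobData I) : wt I j.1 = j.2.2.2 := by
  obtain ⟨i, rfl⟩ := mem_jobData.1 hj
  exact wt_fin i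

theorem rl_eq {j : JobData} (hj : j ∈ jobData I) : rl I j.1 = j.2.2.1 := by
  obtain ⟨i, rfl⟩ := mem_jobData.1 hj
  exact rl_fin i

theorem length_segBound (I : List (ℕ × ℕ × ℕ)) :
    (segBound I).length = I.length * (3 * ((horizon I).length + 1)) := by
  simp only [segBound, List.length_flatMap, List.length_append, List.length_cons, List.map_const',
    List.sum_replicate, smul_eq_mul]
  ring

theorem length_budget (E : ℕ) (I : List (ℕ × ℕ × ℕ)) :
    (budget E I).length = (segBound I).length * (E + 1) + 1 := by
  simp [budget, List.length_flatMap]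

theorem length_scaleBound (c : ℕ) (I : List (ℕ × ℕ × ℕ)) :
    (scaleBound c I).length = (segBound I).length + Nat.size (I.map fun j => j.2.2).sum +
      ((horizon I).length + 1) * c + 1 := by
  simp only [scaleBound, List.length_append, List.length_replicate, List.length_flatMap,
    List.map_const', List.sum_replicate, List.length_cons, smul_eq_mul, List.length_nil]

theorem length_filter_range {i n : ℕ} (h : i ≤ n) :
    ((List.range n).filter fun m => m < i).length = i := by
  induction n, h using Nat.le_induction with
  | base => rw [List.filter_eq_self.2 (by simp), List.length_range]
  | succ n hn ih =>
    rw [List.range_succ, List.filter_append, List.length_append, ih]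
    simp [Nat.not_lt.2 hn]

theorem mem_scales {c B : ℕ} : B ∈ scales c I ↔ ∃ i < (scaleBound c I).length, B = 2 ^ i := by
  simp only [scales, List.mem_map, List.mem_range]
  refine exists_congr fun i => and_congr_right fun hi => ?_
  rw [length_filter_range hi.le, eq_comm]

/-- All times that matter belong to the root cell. -/
theorem jobData_bounds {j : JobData} (hj : j ∈ jobData I) : 2 ^ (horizon I).length ≤ j.2.2.1 ∧
    j.2.2.1 + ((jobData I).map fun j => j.2.1).sum < 2 ^ ((horizon I).length + 1) := by
  have hS : (I.map fun j => j.1 + j.2.1).sum < 2 ^ (horizon I).length := by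
    rw [horizon, List.length_replicate]
    exact Nat.lt_size_self _
  have h1 : (I.map fun j => j.1 + j.2.1).sum =
      ((jobData I).map fun j => j.2.1).sum + (I.map fun j => j.2.1).sum := by
    rw [List.sum_map_add, sum_jobData]
    congr 1
    rw [← Fin.sum_univ_getElem]
    exact (Fintype.sum_equiv (finCongr (by simp)) _ _ fun i => by simp [shiftJob])
  obtain ⟨i, rfl⟩ := mem_jobData.1 hj
  have h2 : (I.get i).2.1 ≤ (I.map fun j => j.2.1).sum :=
    List.single_le_sum (by simp) _ (List.mem_map_of_mem (f := fun j : ℕ × ℕ × ℕ => j.2.1)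
      (List.get_mem I i))
  rw [pow_succ]
  simp only [shiftJob] at *
  omega

/-- The demand condition on the root cell implies the demand condition everywhere. -/
theorem demand_of_sound {D : ℕ → ℕ} (hD : ∀ j ∈ jobData I, j.2.2.1 < D j.1) {H : ℕ}
    (h : Sound (2 ^ (horizon I).length) 1 (nearJobs (jobData I) (2 ^ (horizon I).length) 1) D H) :
    ∀ t, ∀ s ≤ t, s + dem (jobData I) D s t ≤ t := by
  have hpos : 0 < 2 ^ (horizon I).length := by positivity
  have hnear : nearJobs (jobData I) (2 ^ (horizon I).length) 1 = jobData I := by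
    refine List.filter_eq_self.2 fun j hj => ?_
    have := (jobData_bounds hj).1
    rw [decide_eq_true_eq]; omega
  rw [hnear] at h
  intro t s hs
  rcases lt_or_ge t (2 ^ (horizon I).length) with ht | ht
  · rw [dem_eq_zero fun j hj => ?_]
    · exact hs
    · exact ht.trans_le ((jobData_bounds hj).1.trans (hD j hj).le)
  rcases lt_or_ge t (2 ^ ((horizon I).length + 1)) with ht' | ht'
  · refine (h t (by omega) ?_).2 s hs
    rw [pow_succ] at ht'
    omega
  by_cases hex : ∃ j ∈ jobData I, s ≤ j.2.2.1
  · obtain ⟨j, hj, hsj⟩ := hex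
    have h1 := (jobData_bounds hj).2
    have h2 : dem (jobData I) D s t ≤ ((jobData I).map fun j => j.2.1).sum :=
      List.sum_le_sum fun j _ => by split_ifs <;> omega
    omega
  · have : dem (jobData I) D s t = 0 := by
      refine List.sum_eq_zero fun n hn => ?_
      obtain ⟨j, hj, rfl⟩ := List.mem_map.1 hn
      rw [if_neg fun h => hex ⟨j, hj, h.1⟩]
    omega

/-- A power of two that is a good approximation of `V` from above. -/
theorem exists_scale {V : ℝ} {M : ℕ} (hV : V ≤ 2 ^ M) :
    ∃ i ≤ M, V ≤ 2 ^ i ∧ (2 : ℝ) ^ i ≤ 2 * max V 1 := by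
  classical
  have hex : ∃ i : ℕ, V ≤ (2 : ℝ) ^ i := ⟨M, hV⟩
  refine ⟨Nat.find hex, Nat.find_min' hex hV, Nat.find_spec hex, ?_⟩
  cases h : Nat.find hex with
  | zero => have := le_max_right V 1; rw [pow_zero]; linarith
  | succ i =>
    have := Nat.find_min hex (m := i) (by omega)
    rw [not_le] at this
    rw [pow_succ]
    have := le_max_left V 1
    linarith

/-- The number of segments of a job is bounded by the growth of the logarithm of the time since its
release to the base `4 / 3`. -/
theorem logb_segment {r d x : ℕ} (h1 : r + d ≤ x) (h2 : x < r + 3 * d) :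
    (1 : ℝ) ≤ Real.logb (4 / 3) (max (((x + d : ℕ) : ℝ) - r) 1) -
      Real.logb (4 / 3) (max ((x : ℝ) - r) 1) := by
  have hd : (1 : ℝ) ≤ d := by exact_mod_cast (by omega)
  have h1' : (r : ℝ) + d ≤ x := by exact_mod_cast h1
  have h2' : (x : ℝ) < r + 3 * d := by exact_mod_cast h2
  rw [max_eq_left (by push_cast; linarith), max_eq_left (by linarith),
    ← Real.logb_div (by push_cast; linarith) (by linarith)]
  rw [Real.le_logb_iff_rpow_le (by norm_num) (div_pos (by push_cast; linarith) (by linarith)),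
    Real.rpow_one, le_div_iff₀ (by linarith)]
  push_cast
  linarith

theorem logb_two_pow_le (k : ℕ) : Real.logb (4 / 3) (2 ^ k) ≤ 3 * k := by
  rw [Real.logb_le_iff_le_rpow (by norm_num) (by positivity),
    show (3 * k : ℝ) = ((3 * k : ℕ) : ℝ) by push_cast; ring, Real.rpow_natCast, pow_mul]
  exact pow_le_pow_left₀ (by norm_num) (by norm_num) k

theorem logb_mono (r : ℕ) : Monotone fun x : ℕ => Real.logb (4 / 3) (max ((x : ℝ) - r) 1) := by
  intro x x' h
  have : (x : ℝ) ≤ x' := by exact_mod_cast h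
  exact Real.logb_le_logb_of_le (by norm_num) (lt_of_lt_of_le one_pos (le_max_right _ _))
    (max_le_max (by linarith) le_rfl)

theorem logb_root_le {j : JobData} (hj : j ∈ jobData I) :
    Real.logb (4 / 3) (max (((2 ^ ((horizon I).length + 1) : ℕ) : ℝ) - j.2.2.1) 1) -
      Real.logb (4 / 3) (max (((2 ^ (horizon I).length : ℕ) : ℝ) - j.2.2.1) 1) ≤
      3 * ((horizon I).length + 1) := by
  have h1 : ((2 ^ (horizon I).length : ℕ) : ℝ) ≤ j.2.2.1 := by exact_mod_cast (jobData_bounds hj).1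
  rw [max_eq_right (a := ((2 ^ (horizon I).length : ℕ) : ℝ) - j.2.2.1) (by linarith),
    Real.logb_one, sub_zero]
  refine le_trans ?_ ((logb_two_pow_le ((horizon I).length + 1)).trans_eq (by push_cast; ring))
  refine Real.logb_le_logb_of_le (by norm_num) (lt_of_lt_of_le one_pos (le_max_right _ _))
    (max_le ?_ ?_)
  · push_cast
    linarith [Nat.cast_nonneg (α := ℝ) j.2.2.1]
  · exact one_le_pow₀ (by norm_num)

/-- The chosen segments are feasible, and their cost is close to that of every solution whose
segment costs are bounded by the growth of potentials `ψ`, provided that its cost is in the range of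
the guesses. -/
theorem bestSol_spec {y : ℕ → ℕ} {E c : ℕ} (hE : 1 ≤ E) {D : ℕ → ℕ}
    (hD : ∀ j ∈ jobData I, j.2.2.1 < D j.1)
    (hdem : ∀ t, ∀ s ≤ t, s + dem (jobData I) D s t ≤ t) {ψ : JobData → ℕ → ℝ}
    (hmono : ∀ j ∈ jobData I, Monotone (ψ j))
    (hseg : ∀ j ∈ jobData I, ∀ k q, q * 2 ^ k < D j.1 → j.2.2.1 + 2 ^ k ≤ q * 2 ^ k →
      q * 2 ^ k < j.2.2.1 + 3 * 2 ^ k →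
      ((j.2.2.2 * y ((q + 1) * 2 ^ k - j.2.2.1) : ℕ) : ℝ) ≤
        ψ j ((q + 1) * 2 ^ k) - ψ j (q * 2 ^ k)) {V : ℝ}
    (hV : ((jobData I).map fun j =>
      ψ j (2 ^ ((horizon I).length + 1)) - ψ j (2 ^ (horizon I).length)).sum ≤ V)
    (hV' : V ≤ 2 ^ ((scaleBound c I).length - 1)) :
    (∀ D', (∀ j ∈ jobData I, j.2.2.1 < D' j.1) → (∀ b ∈ bestSol y E c I, b.2 ≤ D' b.1) →
      ∀ t, ∀ s ≤ t, s + dem (jobData I) D' s t ≤ t) ∧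
    (∀ b ∈ bestSol y E c I, b.1 < I.length ∧ rl I b.1 ≤ b.2 ∧
      b.2 ≤ 2 ^ ((horizon I).length + 3)) ∧
    ((bestSol y E c I).map fun b => ((wt I b.1 * y (b.2 - rl I b.1) : ℕ) : ℝ)).sum ≤
      V + 2 * max V 1 / E := by
  -- the guess for the cost of the target solution
  obtain ⟨i, hi, hVi, hiV⟩ := exists_scale hV'
  have hlen := length_scaleBound c I
  have hB : 2 ^ i ∈ scales c I := mem_scales.2 ⟨i, by omega, rfl⟩
  set A := (segBound I).length * E with hA
  set K := (horizon I).length with hK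
  -- the target solution with scaled costs
  have hBpos : (0 : ℝ) < 2 ^ i := by positivity
  have htree := treeCost_le (sc := scaledCost y A (2 ^ i)) (js := jobData I) (D := D)
    (ψ := fun j x => A / 2 ^ i * ψ j x + Real.logb (4 / 3) (max ((x : ℝ) - j.2.2.1) 1))
    (fun j hj => ((hmono j hj).const_mul (by positivity)).add (logb_mono _)) ?_ K 1
  swap
  · intro j hj k q h1 h2 h3
    have h4 := hseg j hj k q h1 h2 h3
    have h5 := logb_segment h2 h3
    rw [show q * 2 ^ k + 2 ^ k = (q + 1) * 2 ^ k by ring] at h5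
    have h6 : ((scaledCost y A (2 ^ i) j ((q + 1) * 2 ^ k) : ℕ) : ℝ) ≤
        A / 2 ^ i * ((j.2.2.2 * y ((q + 1) * 2 ^ k - j.2.2.1) : ℕ) : ℝ) + 1 := by
      rw [scaledCost, Nat.cast_add, Nat.cast_one]
      refine add_le_add_left (Nat.cast_div_le.trans_eq ?_) 1
      push_cast
      ring
    have h7 := mul_le_mul_of_nonneg_left h4 (show (0 : ℝ) ≤ A / 2 ^ i by positivity)
    linarith
  have hτ : (treeCost (scaledCost y A (2 ^ i)) (jobData I) D K 1 : ℝ) ≤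
      A / 2 ^ i * V + (segBound I).length := by
    refine htree.trans ?_
    have hsub : nearJobs (jobData I) (2 ^ K) 1 = jobData I := by
      refine List.filter_eq_self.2 fun j hj => ?_
      have : 2 ^ K ≤ j.2.2.1 := (jobData_bounds hj).1
      have hpos : 0 < 2 ^ K := by positivity
      rw [decide_eq_true_eq]; omega
    rw [hsub]
    refine le_trans (b := A / 2 ^ i * ((jobData I).map fun j =>
      ψ j (2 ^ (K + 1)) - ψ j (2 ^ K)).sum + ((jobData I).map fun _ => (3 * (K + 1) : ℝ)).sum) ?_ ?_
    · rw [← List.sum_map_mul_left, ← List.sum_map_add]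
      refine List.sum_le_sum fun j hj => ?_
      have h1 := logb_root_le hj
      rw [show (1 + 1) * 2 ^ K = 2 ^ (K + 1) by ring, one_mul]
      linarith
    · refine add_le_add (mul_le_mul_of_nonneg_left hV (by positivity)) (le_of_eq ?_)
      rw [List.map_const', List.sum_replicate, (jobData_perm I).length_eq, List.length_ofFn,
        length_segBound, nsmul_eq_mul]
      push_cast
      rfl
  have hτ' : treeCost (scaledCost y A (2 ^ i)) (jobData I) D K 1 < (budget E I).length := by
    rw [length_budget, Nat.lt_succ_iff]
    have h1 : (A : ℝ) / 2 ^ i * V ≤ A := by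
      rw [div_mul_eq_mul_div, div_le_iff₀ hBpos]
      exact mul_le_mul_of_nonneg_left hVi (Nat.cast_nonneg _)
    have h2 : (treeCost (scaledCost y A (2 ^ i)) (jobData I) D K 1 : ℝ) ≤
        ((segBound I).length * (E + 1) : ℕ) := by
      refine hτ.trans ((add_le_add_left h1 _).trans_eq ?_)
      rw [hA]; push_cast; ring
    exact_mod_cast h2
  obtain ⟨x, hx, hxc, -⟩ := complete_levels (u := budget E I) (sc := scaledCost y A (2 ^ i))
    (jobData_sorted I) hD hdem K 1 hτ'
  rw [hK, ← rootTable_eq] at hx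
  have hxs : (x.1 * 2 ^ i, x.2.2) ∈ solutions y E c I :=
    List.mem_flatMap.2 ⟨_, hB, List.mem_map.2 ⟨x, hx, rfl⟩⟩
  -- the best of all solutions
  obtain ⟨z, hz, hzx⟩ := exists_mem_pick
    (le := fun x y : ℕ × List (ℕ × ℕ) => decide (x.1 ≤ y.1)) (fun a => by simp)
    (fun a b c h1 h2 => by simp only [decide_eq_true_eq] at *; omega)
    (fun a b h => by simp only [decide_eq_true_eq] at *; omega) hxs
  have hsol : bestSol y E c I = z.2 := by
    unfold bestSol
    rcases pick_eq (fun x y : ℕ × List (ℕ × ℕ) => decide (x.1 ≤ y.1)) (solutions y E c I)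
      with h | ⟨b, -, h⟩
    · rw [h] at hz; simp at hz
    · rw [h, List.mem_singleton] at hz
      rw [h, hz]; simp
  have hzs := mem_of_mem_pick hz
  obtain ⟨B, hBs, hzB⟩ := List.mem_flatMap.1 hzs
  obtain ⟨x', hx', rfl⟩ := List.mem_map.1 hzB
  rw [decide_eq_true_eq] at hzx
  change x'.1 * B ≤ x.1 * 2 ^ i at hzx
  rw [hsol]
  change (∀ D' : ℕ → ℕ, (∀ j ∈ jobData I, j.2.2.1 < D' j.1) → (∀ b ∈ x'.2.2, b.2 ≤ D' b.1) → _) ∧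
    (∀ b ∈ x'.2.2, _) ∧ (x'.2.2.map _).sum ≤ _
  obtain ⟨m, -, hBm⟩ := mem_scales.1 hBs
  have hBpos' : (0 : ℝ) < B := by rw [hBm]; positivity
  have hcost := rootTable_cost_le (u := budget E I) (sc := scaledCost y A B) (js := jobData I)
    (v := horizon I)
    (f := fun b => A / B * ((wt I b.1 * y (b.2 - rl I b.1) : ℕ) : ℝ)) (fun j hj e => by
      dsimp only
      rw [wt_eq hj, rl_eq hj, scaledCost]
      have h1 := Nat.lt_div_mul_add (a := j.2.2.2 * y (e - j.2.2.1) * A) (b := B)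
        (by exact_mod_cast hBpos')
      have h2 : ((j.2.2.2 * y (e - j.2.2.1) * A : ℕ) : ℝ) <
          ((j.2.2.2 * y (e - j.2.2.1) * A / B * B + B : ℕ) : ℝ) := by exact_mod_cast h1
      rw [div_mul_eq_mul_div, div_le_iff₀ hBpos']
      push_cast at h2 ⊢
      linarith) (Y := 2 ^ (K + 3)) (fun j hj => by
      have h1 := (jobData_bounds hj).2
      have h2 : 2 ^ (K + 3) = 8 * 2 ^ K := by ring
      have h3 : 2 ^ (K + 1) = 2 * 2 ^ K := by ring
      rw [← hK] at h1 ⊢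
      omega) x' hx'
  have hmem : ∀ b ∈ x'.2.2, b.1 < I.length ∧ rl I b.1 ≤ b.2 ∧ b.2 ≤ 2 ^ (K + 3) := fun b hb => by
    obtain ⟨j, hj, hbj, hle⟩ := hcost.2 b hb
    rw [hbj, rl_eq hj]
    obtain ⟨i, rfl⟩ := mem_jobData.1 hj
    exact ⟨i.2, hle⟩
  refine ⟨fun D' hD' hb => ?_, hmem, ?_⟩
  · rw [rootTable_eq] at hx'
    exact demand_of_sound hD' (sound_levels (u := budget E I) hD' K 1 x' hx' hb)
  · -- without jobs there are no segments
    rcases Nat.eq_zero_or_pos I.length with hn | hn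
    · have : x'.2.2 = [] := by
        rw [List.eq_nil_iff_forall_not_mem]
        intro b hb
        have := (hmem b hb).1
        omega
      have h0 : jobData I = [] := by
        rw [← List.length_eq_zero_iff, (jobData_perm I).length_eq, List.length_ofFn, hn]
      rw [h0] at hV
      simp only [List.map_nil, List.sum_nil] at hV
      rw [this]
      simp only [List.map_nil, List.sum_nil]
      positivity
    · have hQ : (1 : ℝ) ≤ (segBound I).length := by
        rw [length_segBound]
        exact_mod_cast Nat.mul_pos hn (by omega)
      have hEr : (1 : ℝ) ≤ E := by exact_mod_cast hE
      have hAr : (A : ℝ) = (segBound I).length * E := by rw [hA]; push_cast; ring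
      have hApos : (0 : ℝ) < A := by rw [hAr]; positivity
      have h1 := hcost.1
      rw [List.sum_map_mul_left, div_mul_eq_mul_div, div_le_iff₀ hBpos'] at h1
      have h2 : (x'.1 * B : ℝ) ≤ x.1 * 2 ^ i := by exact_mod_cast hzx
      have h3 : (x.1 * 2 ^ i : ℝ) ≤ A * V + (segBound I).length * 2 ^ i := by
        rw [hxc]
        refine (mul_le_mul_of_nonneg_right hτ hBpos.le).trans_eq ?_
        field_simp
      have h4 : (segBound I).length * (2 : ℝ) ^ i ≤ A * (2 * max V 1 / E) := by
        rw [hAr]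
        refine (mul_le_mul_of_nonneg_left hiV (by positivity)).trans_eq ?_
        field_simp
      have h5 := (h1.trans h2).trans (h3.trans (add_le_add_right h4 _))
      rw [← mul_add] at h5
      exact le_of_mul_le_mul_left h5 hApos

/-- The deadline `2 ^ (K + 1)` is feasible for all jobs together. -/
theorem demand_const (t s : ℕ) (hs : s ≤ t) :
    s + dem (jobData I) (fun _ => 2 ^ ((horizon I).length + 1)) s t ≤ t := by
  rcases lt_or_ge t (2 ^ ((horizon I).length + 1)) with ht | ht
  · rw [dem_eq_zero fun j hj => ht]
    exact hs
  by_cases hex : ∃ j ∈ jobData I, s ≤ j.2.2.1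
  · obtain ⟨j, hj, hsj⟩ := hex
    have h1 := (jobData_bounds hj).2
    have h2 : dem (jobData I) (fun _ => 2 ^ ((horizon I).length + 1)) s t ≤
        ((jobData I).map fun j => j.2.1).sum :=
      List.sum_le_sum fun j _ => by split_ifs <;> omega
    omega
  · have : dem (jobData I) (fun _ => 2 ^ ((horizon I).length + 1)) s t = 0 := by
      refine List.sum_eq_zero fun n hn => ?_
      obtain ⟨j, hj, rfl⟩ := List.mem_map.1 hn
      rw [if_neg fun h => hex ⟨j, hj, h.1⟩]
    omega

/-- The chosen segments are feasible, and their cost is close to that of every solution whose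
segment costs are bounded by the growth of potentials `ψ`. If the latter cost exceeds all guesses,
then it exceeds the cost of selecting every segment. -/
theorem bestSol_spec' {y : ℕ → ℕ} {E c : ℕ} (hE : 1 ≤ E)
    (hy : ∀ x ≤ 2 ^ ((horizon I).length + 2), y x ≤ 2 ^ (((horizon I).length + 1) * c)) {D : ℕ → ℕ}
    (hD : ∀ j ∈ jobData I, j.2.2.1 < D j.1)
    (hdem : ∀ t, ∀ s ≤ t, s + dem (jobData I) D s t ≤ t) {ψ : JobData → ℕ → ℝ}
    (hmono : ∀ j ∈ jobData I, Monotone (ψ j))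
    (hseg : ∀ j ∈ jobData I, ∀ k q, q * 2 ^ k < D j.1 → j.2.2.1 + 2 ^ k ≤ q * 2 ^ k →
      q * 2 ^ k < j.2.2.1 + 3 * 2 ^ k →
      ((j.2.2.2 * y ((q + 1) * 2 ^ k - j.2.2.1) : ℕ) : ℝ) ≤
        ψ j ((q + 1) * 2 ^ k) - ψ j (q * 2 ^ k)) {V : ℝ}
    (hV : ((jobData I).map fun j =>
      ψ j (2 ^ ((horizon I).length + 1)) - ψ j (2 ^ (horizon I).length)).sum ≤ V) :
    (∀ D', (∀ j ∈ jobData I, j.2.2.1 < D' j.1) → (∀ b ∈ bestSol y E c I, b.2 ≤ D' b.1) →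
      ∀ t, ∀ s ≤ t, s + dem (jobData I) D' s t ≤ t) ∧
    (∀ b ∈ bestSol y E c I, b.1 < I.length ∧ rl I b.1 ≤ b.2 ∧
      b.2 ≤ 2 ^ ((horizon I).length + 3)) ∧
    ((bestSol y E c I).map fun b => ((wt I b.1 * y (b.2 - rl I b.1) : ℕ) : ℝ)).sum ≤
      V + 2 * max V 1 / E := by
  rcases le_or_gt V (2 ^ ((scaleBound c I).length - 1)) with hV' | hV'
  · exact bestSol_spec hE hD hdem hmono hseg hV hV'
  set K := (horizon I).length with hK
  have hlen := length_scaleBound c I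
  set W := (I.map fun j => j.2.2).sum with hW
  set V₁ : ℝ := W * 2 ^ ((K + 1) * c) * (3 * (K + 1)) with hV₁
  have hV₁' : V₁ ≤ 2 ^ ((scaleBound c I).length - 1) := by
    rcases Nat.eq_zero_or_pos I.length with hn | hn
    · rw [List.length_eq_zero_iff] at hn
      have : W = 0 := by rw [hW, hn]; rfl
      rw [hV₁, this]
      simp only [Nat.cast_zero, zero_mul]
      positivity
    have h1 : (W : ℝ) ≤ 2 ^ Nat.size W := by exact_mod_cast (Nat.lt_size_self W).le
    have h2 : (3 * (K + 1) : ℝ) ≤ 2 ^ (segBound I).length := by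
      have h3 : 3 * (K + 1) ≤ 2 ^ (3 * (K + 1)) := Nat.lt_two_pow_self.le
      have h4 : 2 ^ (3 * (K + 1)) ≤ 2 ^ (segBound I).length := by
        refine Nat.pow_le_pow_right two_pos ?_
        rw [length_segBound]
        exact Nat.le_mul_of_pos_left _ hn
      exact_mod_cast h3.trans h4
    rw [hlen, Nat.add_sub_cancel, pow_add, pow_add, hV₁]
    calc (W : ℝ) * 2 ^ ((K + 1) * c) * (3 * (K + 1))
        ≤ 2 ^ Nat.size W * 2 ^ ((K + 1) * c) * 2 ^ (segBound I).length := by gcongr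
      _ = _ := by ring
  have hspec := bestSol_spec (I := I) (y := y) (E := E) (c := c) (V := V₁) hE
    (D := fun _ => 2 ^ (K + 1))
    (fun j hj => by have := (jobData_bounds hj).2; rw [← hK] at this; omega) demand_const
    (ψ := fun j x => j.2.2.2 * 2 ^ ((K + 1) * c) *
      Real.logb (4 / 3) (max ((x : ℝ) - j.2.2.1) 1))
    (fun j hj => (logb_mono _).const_mul (by positivity)) (fun j hj k q h1 h2 h3 => ?_) ?_ hV₁'
  · refine ⟨hspec.1, hspec.2.1, hspec.2.2.trans ?_⟩
    have : V₁ ≤ V := hV₁'.trans hV'.le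
    gcongr
  · have h5 := logb_segment h2 h3
    rw [show q * 2 ^ k + 2 ^ k = (q + 1) * 2 ^ k by ring] at h5
    have h6 : y ((q + 1) * 2 ^ k - j.2.2.1) ≤ 2 ^ ((K + 1) * c) := by
      refine hy _ ?_
      have h7 : (q + 1) * 2 ^ k = q * 2 ^ k + 2 ^ k := by ring
      have h8 : 2 ^ (K + 2) = 2 * 2 ^ (K + 1) := by ring
      omega
    rw [← mul_sub]
    refine le_trans ?_ (mul_le_mul_of_nonneg_left h5 (by positivity))
    rw [mul_one, Nat.cast_mul]
    have h9 : (y ((q + 1) * 2 ^ k - j.2.2.1) : ℝ) ≤ 2 ^ ((K + 1) * c) := by exact_mod_cast h6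
    exact mul_le_mul_of_nonneg_left h9 (Nat.cast_nonneg _)
  · have h1 : ((jobData I).map fun j => (j.2.2.2 : ℝ)).sum = W := by
      rw [sum_jobData, hW, ← Fin.sum_univ_getElem, Nat.cast_sum]
      exact (Fintype.sum_equiv (finCongr (by simp)) _ _ fun i => by simp [shiftJob])
    rw [hV₁, ← h1, mul_assoc, ← List.sum_map_mul_right]
    refine List.sum_le_sum fun j hj => ?_
    rw [← mul_sub, mul_assoc]
    exact mul_le_mul_of_nonneg_left (mul_le_mul_of_nonneg_left (logb_root_le hj) (by positivity))
      (Nat.cast_nonneg _)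

end Spec

section Spec

variable {I : List (ℕ × ℕ × ℕ)}

/-- The deadlines that a choice of segments entails, in terms of the job index. -/
def deadlineOf (I : List (ℕ × ℕ × ℕ)) (sol : List (ℕ × ℕ)) (i : ℕ) : ℕ :=
  deadline sol (i, 0, rl I i, 0)

theorem deadline_eq (sol : List (ℕ × ℕ)) {j : JobData} (hj : j ∈ jobData I) :
    deadline sol j = deadlineOf I sol j.1 := by
  simp only [deadlineOf, deadline, rl_eq hj]

theorem foldl_max_spec (l : List ℕ) (s : ℕ) : s ≤ l.foldl (fun s b => max s b) s ∧
    (∀ b ∈ l, b ≤ l.foldl (fun s b => max s b) s) ∧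
    (l.foldl (fun s b => max s b) s = s ∨ l.foldl (fun s b => max s b) s ∈ l) := by
  induction l generalizing s with
  | nil => simp
  | cons a l ih =>
    obtain ⟨h1, h2, h3⟩ := ih (max s a)
    simp only [List.foldl_cons, List.mem_cons, forall_eq_or_imp]
    refine ⟨(le_max_left _ _).trans h1, ⟨(le_max_right _ _).trans h1, h2⟩, ?_⟩
    rcases h3 with h3 | h3
    · rw [h3]
      rcases max_choice s a with h | h <;> simp [h]
    · exact .inr (.inr h3)

theorem deadlineOf_spec (sol : List (ℕ × ℕ)) (i : ℕ) : rl I i < deadlineOf I sol i ∧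
    (∀ b ∈ sol, b.1 = i → b.2 ≤ deadlineOf I sol i) ∧
    (deadlineOf I sol i = rl I i + 1 ∨ (i, deadlineOf I sol i) ∈ sol) := by
  obtain ⟨h1, h2, h3⟩ := foldl_max_spec ((sol.filter fun b => b.1 = i).map fun b => b.2)
    (rl I i + 1)
  refine ⟨h1, fun b hb hbi => h2 _ (List.mem_map.2 ⟨b, by simp [hb, hbi], rfl⟩),
    h3.imp id fun h => ?_⟩
  obtain ⟨b, hb, hbe⟩ := List.mem_map.1 h
  rw [List.mem_filter, decide_eq_true_eq] at hb
  rw [deadlineOf, deadline, ← hbe, ← hb.2]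
  exact hb.1

/-- The cost of the deadlines is bounded by the cost of the chosen segments. -/
theorem deadlineOf_cost (y : ℕ → ℕ) {sol : List (ℕ × ℕ)} (hsol : ∀ b ∈ sol, b.1 < I.length) :
    (∑ i : Fin I.length, ((wt I i * y (deadlineOf I sol i - rl I i) : ℕ) : ℝ)) ≤
      (∑ i : Fin I.length, ((wt I i * y 1 : ℕ) : ℝ)) +
        (sol.map fun b => ((wt I b.1 * y (b.2 - rl I b.1) : ℕ) : ℝ)).sum := by
  have h1 : ∀ l : List (ℕ × ℕ), (∀ b ∈ l, b.1 < I.length) →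
      (l.map fun b => ((wt I b.1 * y (b.2 - rl I b.1) : ℕ) : ℝ)).sum =
      ∑ i : Fin I.length, (l.map fun b => if b.1 = (i : ℕ) then
        ((wt I b.1 * y (b.2 - rl I b.1) : ℕ) : ℝ) else 0).sum := by
    intro l hl
    induction l with
    | nil => simp
    | cons b l ih =>
      simp only [List.map_cons, List.sum_cons]
      rw [Finset.sum_add_distrib, ih fun b hb => hl b (by simp [hb])]
      congr 1
      rw [Finset.sum_eq_single (⟨b.1, hl b (by simp)⟩ : Fin I.length)]
      · rw [if_pos rfl]
      · intro i _ hi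
        rw [if_neg fun h => hi (Fin.ext h.symm)]
      · simp
  rw [h1 sol hsol, ← Finset.sum_add_distrib]
  refine Finset.sum_le_sum fun i _ => ?_
  have h0 : ∀ z ∈ sol.map fun b => if b.1 = (i : ℕ) then
      ((wt I b.1 * y (b.2 - rl I b.1) : ℕ) : ℝ) else 0, 0 ≤ z := by
    intro z hz
    obtain ⟨b, -, rfl⟩ := List.mem_map.1 hz
    split_ifs
    · exact Nat.cast_nonneg _
    · exact le_rfl
  rcases (deadlineOf_spec (I := I) sol i).2.2 with h | h
  · rw [h, Nat.add_sub_cancel_left]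
    exact le_add_of_nonneg_right (List.sum_nonneg h0)
  · refine le_trans ?_ (le_add_of_nonneg_left (Nat.cast_nonneg _))
    refine le_trans (le_of_eq ?_) (List.single_le_sum h0 _ (List.mem_map.2 ⟨_, h, rfl⟩))
    rw [if_pos rfl]

/-- If the deadlines that the chosen segments entail are feasible, then the pieces form a schedule
in which every job is processed completely between its release and its deadline. -/
theorem edf_spec {sol : List (ℕ × ℕ)} (hdem : ∀ t, ∀ s ≤ t,
      s + dem (jobData I) (deadlineOf I sol) s t ≤ t) :
    (∀ q ∈ edf sol (jobData I), q.1 < I.length) ∧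
    (∀ i : Fin I.length, MeasureTheory.volume (pieceSet (edf sol (jobData I)) i) =
      ((I.get i).1 : ℝ≥0∞)) ∧
    (∀ q ∈ edf sol (jobData I), q.2.1 < q.2.2 → rl I q.1 ≤ q.2.1 ∧
      q.2.2 ≤ deadlineOf I sol q.1) ∧
    ∀ q ∈ edf sol (jobData I), ∀ q' ∈ edf sol (jobData I), q.1 ≠ q'.1 → Apart q.2 q'.2 := by
  have hperm := sortKey_perm (fun j => deadline sol j) (jobData I)
  have hmem : ∀ j, j ∈ (sortKey (fun j => deadline sol j) (jobData I)).reverse ↔ j ∈ jobData I :=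
    fun j => by rw [List.mem_reverse, hperm.mem_iff]
  have hsorted : (sortKey (fun j => deadline sol j) (jobData I)).Pairwise
      fun i j => deadlineOf I sol i.1 ≤ deadlineOf I sol j.1 :=
    (sortKey_sorted (fun j => deadline sol j) (jobData I)).imp_of_mem fun hi hj h => by
      rwa [deadline_eq sol (hperm.mem_iff.1 hi), deadline_eq sol (hperm.mem_iff.1 hj)] at h
  have hnd : ((sortKey (fun j => deadline sol j) (jobData I)).map fun j => j.1).Nodup := by
    rw [((hperm.trans (jobData_perm I)).map _).nodup_iff, List.map_ofFn, List.nodup_ofFn]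
    exact fun i j h => Fin.ext h
  have h := placed_schedule (js := jobData I) (ls := sortKey (fun j => deadline sol j) (jobData I))
    (D := deadlineOf I sol) (E := ((jobData I).map fun j => deadline sol j).sum + 1)
    (jobData_sorted I) (fun j hj => Nat.lt_succ_of_le ?_)
    (fun j hj => by rw [← rl_eq hj]; exact (deadlineOf_spec sol j.1).1) hdem hperm hsorted hnd
  · refine ⟨fun q hq => ?_, fun i => ?_, fun q hq hlt => ?_, h.apart⟩
    · obtain ⟨j, hj, e⟩ := h.index q hq
      obtain ⟨i, rfl⟩ := mem_jobData.1 ((hmem j).1 hj)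
      rw [e]
      exact i.2
    · exact h.volume _ ((hmem _).2 (mem_jobData.2 ⟨i, rfl⟩))
    · obtain ⟨j, hj, e⟩ := h.index q hq
      have := h.window q hq j hj e hlt
      rwa [e, rl_eq ((hmem j).1 hj)]
  · rw [← deadline_eq sol hj]
    exact List.single_le_sum (by simp) _ (List.mem_map_of_mem (f := fun j => deadline sol j) hj)

/-- Correctness of the algorithm: its output is a schedule that meets deadlines whose cost is close
to that of every feasible choice of deadlines `D`, measured by potentials. -/
theorem solve_spec {y : ℕ → ℕ} {E c : ℕ} (hE : 1 ≤ E)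
    (hy : ∀ x ≤ 2 ^ ((horizon I).length + 2), y x ≤ 2 ^ (((horizon I).length + 1) * c)) {D : ℕ → ℕ}
    (hD : ∀ j ∈ jobData I, j.2.2.1 < D j.1)
    (hdem : ∀ t, ∀ s ≤ t, s + dem (jobData I) D s t ≤ t) {ψ : JobData → ℕ → ℝ}
    (hmono : ∀ j ∈ jobData I, Monotone (ψ j))
    (hseg : ∀ j ∈ jobData I, ∀ k q, q * 2 ^ k < D j.1 → j.2.2.1 + 2 ^ k ≤ q * 2 ^ k →
      q * 2 ^ k < j.2.2.1 + 3 * 2 ^ k →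
      ((j.2.2.2 * y ((q + 1) * 2 ^ k - j.2.2.1) : ℕ) : ℝ) ≤
        ψ j ((q + 1) * 2 ^ k) - ψ j (q * 2 ^ k)) {V : ℝ}
    (hV : ((jobData I).map fun j =>
      ψ j (2 ^ ((horizon I).length + 1)) - ψ j (2 ^ (horizon I).length)).sum ≤ V) :
    (∀ q ∈ solve y E c I, q.1 < I.length) ∧
    (∀ i : Fin I.length, MeasureTheory.volume (pieceSet (solve y E c I) i) =
      ((I.get i).1 : ℝ≥0∞)) ∧
    (∀ i i', i ≠ i' → Disjoint (pieceSet (solve y E c I) i) (pieceSet (solve y E c I) i')) ∧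
    ∃ f : Fin I.length → ℕ,
      (∀ i : Fin I.length, 1 ≤ f i ∧ f i ≤ 2 ^ ((horizon I).length + 3) ∧
        pieceSet (solve y E c I) i ⊆ Set.Ico ((I.get i).2.1 : ℝ) ((I.get i).2.1 + f i)) ∧
      ∑ i, ((I.get i).2.2 : ℝ) * y (f i) ≤
        (∑ i, ((I.get i).2.2 : ℝ) * y 1) + (V + 2 * max V 1 / E) := by
  obtain ⟨h1, h2, h3⟩ := bestSol_spec' hE hy hD hdem hmono hseg hV
  set sol := bestSol y E c I with hsol
  set K := (horizon I).length with hK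
  obtain ⟨e1, e2, e3, e4⟩ := edf_spec (I := I) (sol := sol)
    (h1 _ (fun j hj => by rw [← rl_eq hj]; exact (deadlineOf_spec sol j.1).1)
      fun b hb => (deadlineOf_spec sol b.1).2.1 b hb rfl)
  have hrl : ∀ i : Fin I.length, rl I i = (I.get i).2.1 + 2 ^ K := fun i => rl_fin i
  -- the shift of time does not cut off anything
  have hset : ∀ i, pieceSet (solve y E c I) i =
      (fun x : ℝ => x + ((2 ^ K : ℕ) : ℝ)) ⁻¹' pieceSet (edf sol (jobData I)) i := by
    intro i
    ext x
    simp only [solve, pieceSet, Set.mem_ofPred_eq, Set.mem_preimage, List.mem_map, ← hK, ← hsol]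
    constructor
    · rintro ⟨_, ⟨q, hq, rfl⟩, hi, hx1, hx2⟩
      have hlt : q.2.1 < q.2.2 := by
        have : ((q.2.1 - 2 ^ K : ℕ) : ℝ) < (q.2.2 - 2 ^ K : ℕ) := hx1.trans_lt hx2
        have := Nat.cast_lt.1 this
        omega
      have h4 := (e3 q hq hlt).1
      rw [hrl ⟨q.1, e1 q hq⟩] at h4
      rw [Nat.cast_sub (by omega)] at hx1 hx2
      exact ⟨q, hq, hi, by linarith, by linarith⟩
    · rintro ⟨q, hq, hi, hx1, hx2⟩
      have hlt : q.2.1 < q.2.2 := by exact_mod_cast hx1.trans_lt hx2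
      have h4 := (e3 q hq hlt).1
      rw [hrl ⟨q.1, e1 q hq⟩] at h4
      refine ⟨_, ⟨q, hq, rfl⟩, hi, ?_, ?_⟩
      · dsimp only
        rw [Nat.cast_sub (by omega)]; linarith
      · dsimp only
        rw [Nat.cast_sub (by omega)]; linarith
  refine ⟨fun q hq => ?_, fun i => ?_, fun i i' hii => ?_,
    fun i => deadlineOf I sol i - rl I i, fun i => ⟨?_, ?_, ?_⟩, ?_⟩
  · obtain ⟨q', hq', rfl⟩ := List.mem_map.1 hq
    exact e1 q' hq'
  · rw [hset, MeasureTheory.measure_preimage_add_right, e2]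
  · rw [hset, hset]
    refine Disjoint.preimage _ (Set.disjoint_left.2 ?_)
    rintro x ⟨q, hq, rfl, hx1, hx2⟩ ⟨q', hq', rfl, hx1', hx2'⟩
    rcases e4 q hq q' hq' hii with h | h
    · have : (q.2.2 : ℝ) ≤ q'.2.1 := by exact_mod_cast h
      linarith
    · have : (q'.2.2 : ℝ) ≤ q.2.1 := by exact_mod_cast h
      linarith
  · exact Nat.sub_pos_of_lt (deadlineOf_spec (I := I) sol i).1
  · rcases (deadlineOf_spec (I := I) sol i).2.2 with h | h
    · have : 1 ≤ 2 ^ (K + 3) := Nat.one_le_two_pow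
      simp only [h]; omega
    · exact (Nat.sub_le _ _).trans (h2 _ h).2.2
  · rw [hset]
    rintro x ⟨q, hq, hi, hx1, hx2⟩
    have hlt : q.2.1 < q.2.2 := by exact_mod_cast hx1.trans_lt hx2
    obtain ⟨h4, h5⟩ := e3 q hq hlt
    rw [hi] at h4 h5
    have h6 := hrl i
    have h7 := (deadlineOf_spec (I := I) sol i).1
    have h8 : (rl I i : ℝ) ≤ q.2.1 := by exact_mod_cast h4
    have h9 : (q.2.2 : ℝ) ≤ deadlineOf I sol i := by exact_mod_cast h5
    have h10 : (rl I i : ℝ) = (I.get i).2.1 + (2 ^ K : ℕ) := by exact_mod_cast h6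
    rw [Nat.cast_sub h7.le]
    constructor <;> linarith
  · have h4 := (deadlineOf_cost y fun b hb => (h2 b hb).1).trans (add_le_add_right h3 _)
    simpa only [wt_fin, Nat.cast_mul] using h4

end Spec

/-! ### Approximate powers -/

/-- The smallest integer that is at least `C * 2 ^ (i / G)`: the mantissas of the approximate
powers. -/
noncomputable def mantissa (G C i : ℕ) : ℕ := ⌈(C : ℝ) * 2 ^ ((i : ℝ) / G)⌉₊

/-- An approximation of a multiple of `x ^ p` for `p` close to `num / den`. The binary length of
`x ^ G`, divided by `G`, approximates the binary logarithm of `x`. The bound `B` on the exponent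
`p` only serves to bound the running time. -/
noncomputable def powApprox (G C B num den x : ℕ) : ℕ :=
  2 ^ ((List.range ((List.replicate (Nat.size (x ^ G)) 0).flatMap
      fun _ => List.replicate B 0).length).filter fun m => m <
        min (num * (List.replicate (Nat.size (x ^ G)) 0).length / den)
          (B * (List.replicate (Nat.size (x ^ G)) 0).length) / G).length *
    if min (num * (List.replicate (Nat.size (x ^ G)) 0).length / den)
        (B * (List.replicate (Nat.size (x ^ G)) 0).length) % G < G then
      mantissa G C (min (num * (List.replicate (Nat.size (x ^ G)) 0).length / den)
        (B * (List.replicate (Nat.size (x ^ G)) 0).length) % G) else 0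

theorem PolyTime.powApprox {α : Type} [Enc α] (G C B : ℕ) {num den x : α → ℕ} (hn : PolyTime num)
    (hd : PolyTime den) (hx : PolyTime x) :
    PolyTime fun a => powApprox G C B (num a) (den a) (x a) := by
  have hG : PolyTime fun a => x a ^ G := pow_const hx G
  have hL : PolyTime fun a => List.replicate (Nat.size (x a ^ G)) 0 := replicate_size hG
  have key : ∀ {L : α → List ℕ}, PolyTime L → PolyTime fun a => 2 ^ ((List.range ((L a).flatMap
      fun _ => List.replicate B 0).length).filter fun m => m <
        Min.min (num a * (L a).length / den a) (B * (L a).length) / G).length *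
      if Min.min (num a * (L a).length / den a) (B * (L a).length) % G < G then
        mantissa G C (Min.min (num a * (L a).length / den a) (B * (L a).length) % G) else 0 :=
    fun {L} hL => mul (two_pow_length (by fun_prop)) (table _ _ (by fun_prop))
  exact key hL

/-- The exponent of the approximate power, in units of `1 / G`. -/
def powExp (G B num den x : ℕ) : ℕ :=
  min (num * Nat.size (x ^ G) / den) (B * Nat.size (x ^ G))

theorem powApprox_eq {G : ℕ} (hG : 0 < G) (C B num den x : ℕ) : powApprox G C B num den x =
    2 ^ (powExp G B num den x / G) * mantissa G C (powExp G B num den x % G) := by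
  have h : powExp G B num den x / G ≤ Nat.size (x ^ G) * B :=
    (Nat.div_le_self _ _).trans ((min_le_right _ _).trans_eq (mul_comm _ _))
  simp only [powApprox, List.length_replicate, List.length_flatMap, List.map_const',
    List.sum_replicate, smul_eq_mul]
  rw [← powExp, length_filter_range h, if_pos (Nat.mod_lt _ hG)]

theorem powApprox_bounds {G : ℕ} (hG : 0 < G) (C B num den x : ℕ) :
    C * (2 : ℝ) ^ ((powExp G B num den x : ℝ) / G) ≤ powApprox G C B num den x ∧
      (powApprox G C B num den x : ℝ) ≤ (C + 1) * (2 : ℝ) ^ ((powExp G B num den x : ℝ) / G) := by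
  set e := powExp G B num den x
  have hGr : (0 : ℝ) < G := by exact_mod_cast hG
  have he : (e : ℝ) / G = (e / G : ℕ) + ((e % G : ℕ) : ℝ) / G := by
    have : (e : ℝ) = G * (e / G : ℕ) + (e % G : ℕ) := by exact_mod_cast (Nat.div_add_mod e G).symm
    rw [this]
    field_simp
  rw [powApprox_eq hG, he, Real.rpow_add two_pos, Real.rpow_natCast, Nat.cast_mul, Nat.cast_pow,
    Nat.cast_ofNat]
  have h1 : (1 : ℝ) ≤ 2 ^ (((e % G : ℕ) : ℝ) / G) :=
    Real.one_le_rpow (by norm_num) (by positivity)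
  have h2 : (C : ℝ) * 2 ^ (((e % G : ℕ) : ℝ) / G) ≤ mantissa G C (e % G) := Nat.le_ceil _
  have h3 : (mantissa G C (e % G) : ℝ) ≤ C * 2 ^ (((e % G : ℕ) : ℝ) / G) + 1 :=
    (Nat.ceil_lt_add_one (by positivity)).le
  have h4 : (0 : ℝ) < 2 ^ (e / G) := by positivity
  constructor
  · rw [mul_left_comm]
    exact mul_le_mul_of_nonneg_left h2 h4.le
  · rw [mul_left_comm]
    refine mul_le_mul_of_nonneg_left (h3.trans ?_) h4.le
    linarith

theorem size_pow_le {G K x : ℕ} (hx : x ≤ 2 ^ K) : Nat.size (x ^ G) ≤ G * K + 1 := by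
  rw [Nat.size_le]
  refine (Nat.pow_le_pow_left hx G).trans_lt ?_
  rw [← pow_mul, mul_comm K]
  exact Nat.pow_lt_pow_right (by omega) (by omega)

/-- The approximate powers have a length that is bounded in terms of the length of the base. -/
theorem powApprox_le {G : ℕ} (hG : 0 < G) (C B num den : ℕ) {K x : ℕ} (hx : x ≤ 2 ^ (K + 2)) :
    powApprox G C B num den x ≤ 2 ^ ((K + 1) * (3 * B + C + 1)) := by
  have h1 := (powApprox_bounds hG C B num den x).2
  have hGr : (1 : ℝ) ≤ G := by exact_mod_cast hG
  have h2 : (powExp G B num den x : ℝ) / G ≤ ((B * (K + 3) : ℕ) : ℝ) := by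
    rw [div_le_iff₀ (by linarith)]
    have h3 : powExp G B num den x ≤ B * (K + 3) * G := by
      refine (min_le_right _ _).trans ?_
      rw [mul_assoc]
      refine Nat.mul_le_mul_left _ ((size_pow_le hx).trans ?_)
      nlinarith
    exact_mod_cast h3
  have h4 : (powApprox G C B num den x : ℝ) ≤ ((C + 1) * 2 ^ (B * (K + 3)) : ℕ) := by
    refine h1.trans ?_
    push_cast
    refine mul_le_mul_of_nonneg_left ?_ (by positivity)
    rw [← Real.rpow_natCast]
    exact Real.rpow_le_rpow_of_exponent_le (by norm_num) h2
  refine (Nat.cast_le.1 h4).trans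
    ((Nat.mul_le_mul_right _ (Nat.lt_two_pow_self (n := C + 1)).le).trans ?_)
  rw [← pow_add]
  refine Nat.pow_le_pow_right two_pos ?_
  nlinarith [Nat.zero_le (K * B), Nat.zero_le (K * C)]

/-- The binary length of `x ^ G` approximates `G` times the binary logarithm of `x`. -/
theorem size_pow_logb (G : ℕ) {x : ℕ} (hx : 1 ≤ x) :
    G * Real.logb 2 x ≤ Nat.size (x ^ G) ∧ Nat.size (x ^ G) ≤ G * Real.logb 2 x + 1 := by
  set L := Nat.size (x ^ G) with hL
  have hxG : 0 < x ^ G := pow_pos hx G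
  have hL1 : 1 ≤ L := Nat.size_pos.2 hxG
  constructor
  · have : ((x ^ G : ℕ) : ℝ) ≤ (2 : ℝ) ^ (L : ℝ) := by
      rw [Real.rpow_natCast]; exact_mod_cast (Nat.lt_size_self (x ^ G)).le
    rw [← Real.logb_pow, ← Nat.cast_pow]
    exact (Real.logb_le_iff_le_rpow (by norm_num) (by exact_mod_cast hxG)).2 this
  · have h5 : 2 ^ (L - 1) ≤ x ^ G := Nat.lt_size.1 (by omega)
    have h6 : (2 : ℝ) ^ ((L - 1 : ℕ) : ℝ) ≤ (x ^ G : ℕ) := by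
      rw [Real.rpow_natCast]; exact_mod_cast h5
    have h7 := (Real.le_logb_iff_rpow_le (by norm_num) (by exact_mod_cast hxG)).2 h6
    rw [Nat.cast_sub hL1, Nat.cast_pow, Real.logb_pow, Nat.cast_one] at h7
    linarith

theorem rpow_eq_two_rpow (p : ℝ) {x : ℕ} (hx : 1 ≤ x) :
    (x : ℝ) ^ p = 2 ^ (p * Real.logb 2 x) := by
  rw [mul_comm, Real.rpow_mul (by norm_num),
    Real.rpow_logb two_pos (by norm_num) (by exact_mod_cast hx)]

theorem powApprox_le_rpow {G : ℕ} (hG : 0 < G) (C B : ℕ) {num den : ℕ} {p : ℝ} (hp : 0 < p)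
    (h1 : (num : ℝ) / den ≤ p) {x : ℕ} (hx : 1 ≤ x) :
    (powApprox G C B num den x : ℝ) ≤ (C + 1) * (2 : ℝ) ^ (p / G) * (x : ℝ) ^ p := by
  have hGr : (0 : ℝ) < G := by exact_mod_cast hG
  have h4 := (size_pow_logb G hx).2
  have h5 : (powExp G B num den x : ℝ) ≤ p * Nat.size (x ^ G) := by
    have : (powExp G B num den x : ℝ) ≤ (num * Nat.size (x ^ G) / den : ℕ) := by
      exact_mod_cast min_le_left _ _
    refine this.trans (Nat.cast_div_le.trans ?_)
    rw [Nat.cast_mul, mul_div_right_comm]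
    exact mul_le_mul_of_nonneg_right h1 (Nat.cast_nonneg _)
  refine (powApprox_bounds hG C B num den x).2.trans ?_
  rw [mul_assoc, rpow_eq_two_rpow p hx, ← Real.rpow_add two_pos]
  refine mul_le_mul_of_nonneg_left (Real.rpow_le_rpow_of_exponent_le (by norm_num) ?_)
    (by positivity)
  rw [div_le_iff₀ hGr, add_mul, div_mul_cancel₀ _ hGr.ne']
  nlinarith

/-- The approximate powers are precise if `num / den` approximates `p` with a precision that
suffices for the logarithm of the base. -/
theorem rpow_le_powApprox {G : ℕ} (hG : 0 < G) (C : ℕ) {B num den K : ℕ} {p : ℝ} (hp : 0 < p)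
    (hB : p ≤ B) (h1 : (num : ℝ) / den ≤ p) (h2 : (p - num / den) * (G * K + 1) ≤ 1) {x : ℕ}
    (hx : 1 ≤ x) (hxK : x ≤ 2 ^ K) :
    C * (2 : ℝ) ^ (-(2 / G) : ℝ) * (x : ℝ) ^ p ≤ powApprox G C B num den x := by
  have hGr : (0 : ℝ) < G := by exact_mod_cast hG
  have h3 := (size_pow_logb G hx).1
  have hLK : (Nat.size (x ^ G) : ℝ) ≤ G * K + 1 := by exact_mod_cast size_pow_le hxK
  set L := Nat.size (x ^ G) with hL
  have hLr : (0 : ℝ) ≤ L := Nat.cast_nonneg L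
  have h6 : p * L - 2 ≤ powExp G B num den x := by
    rw [powExp, Nat.cast_min, le_min_iff]
    constructor
    · have h7 : (p - num / den) * L ≤ 1 :=
        (mul_le_mul_of_nonneg_left hLK (by linarith)).trans h2
      rcases Nat.eq_zero_or_pos den with h0 | h0
      · rw [h0] at h7 ⊢
        simp only [Nat.cast_zero, div_zero, sub_zero, Nat.div_zero] at h7 ⊢
        linarith
      · have h8 : num * L < (num * L / den + 1) * den := by
          rw [add_mul, one_mul]; exact Nat.lt_div_mul_add h0
        have h9 : ((num * L : ℕ) : ℝ) < ((num * L / den : ℕ) + 1) * den := by exact_mod_cast h8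
        have hd : (0 : ℝ) < den := by exact_mod_cast h0
        rw [← div_lt_iff₀ hd, Nat.cast_mul, mul_div_right_comm] at h9
        linarith
    · push_cast
      have := mul_le_mul_of_nonneg_right hB hLr
      rw [← hL]
      linarith
  refine le_trans ?_ (powApprox_bounds hG C B num den x).1
  rw [mul_assoc, rpow_eq_two_rpow p hx, ← Real.rpow_add two_pos]
  refine mul_le_mul_of_nonneg_left (Real.rpow_le_rpow_of_exponent_le (by norm_num) ?_)
    (Nat.cast_nonneg _)
  rw [le_div_iff₀ hGr, add_mul, neg_mul, div_mul_cancel₀ _ hGr.ne']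
  nlinarith

/-! ### Completion times of schedules -/

section Schedule

open MeasureTheory

variable {I : List Job} {run : Fin I.length → Set ℝ}

theorem IsSchedule.volume_le (h : IsSchedule I run) (j : Fin I.length) (x : ℝ) :
    volume (run j ∩ Set.Iic x) ≤ ((I.get j).proc : ℝ≥0∞) :=
  (measure_mono Set.inter_subset_left).trans_eq (h.processed j)

theorem IsSchedule.bddBelow (h : IsSchedule I run) (j : Fin I.length) :
    ((I.get j).release : ℝ) ∈
      lowerBounds {x : ℝ | volume (run j ∩ Set.Iic x) = ((I.get j).proc : ℝ≥0∞)} := by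
  intro x hx
  by_contra hlt
  rw [not_le] at hlt
  have : run j ∩ Set.Iic x = ∅ := by
    ext z
    simp only [Set.mem_inter_iff, Set.mem_Iic, Set.mem_empty_iff_false, iff_false, not_and, not_le]
    exact fun hz => hlt.trans_le (h.released j z hz)
  have hx' : volume (run j ∩ Set.Iic x) = ((I.get j).proc : ℝ≥0∞) := hx
  rw [this, measure_empty] at hx'
  have := (I.get j).proc_pos
  exact absurd hx'.symm (by exact_mod_cast this.ne')

theorem completionTime_le {j : Fin I.length} (h : IsSchedule I run) {x : ℝ}
    (hx : ∀ z ∈ run j, z ≤ x) : completionTime I run j ≤ x := by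
  refine csInf_le ⟨_, h.bddBelow j⟩ ?_
  change volume (run j ∩ Set.Iic x) = _
  rw [Set.inter_eq_left.2 (show run j ⊆ Set.Iic x from fun z hz => hx z hz)]
  exact h.processed j

theorem IsSchedule.nonempty (h : IsSchedule I run) (j : Fin I.length) :
    {x : ℝ | volume (run j ∩ Set.Iic x) = ((I.get j).proc : ℝ≥0∞)}.Nonempty := by
  obtain ⟨b, hb⟩ := h.bounded j
  refine ⟨b, ?_⟩
  change volume (run j ∩ Set.Iic b) = _
  rw [Set.inter_eq_left.2 (show run j ⊆ Set.Iic b from fun z hz => hb hz)]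
  exact h.processed j

theorem IsSchedule.release_le (h : IsSchedule I run) (j : Fin I.length) :
    ((I.get j).release : ℝ) ≤ completionTime I run j :=
  le_csInf (h.nonempty j) (h.bddBelow j)

/-- The job is completed at all times from its completion time on. -/
theorem IsSchedule.volume_eq (h : IsSchedule I run) (j : Fin I.length) {x : ℝ}
    (hx : completionTime I run j ≤ x) :
    volume (run j ∩ Set.Iic x) = ((I.get j).proc : ℝ≥0∞) := by
  refine le_antisymm (h.volume_le j x) (ENNReal.le_of_forall_pos_le_add fun δ hδ _ => ?_)
  obtain ⟨z, hz, hzx⟩ := exists_lt_of_csInf_lt (h.nonempty j)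
    (show completionTime I run j < x + δ by have := NNReal.coe_pos.2 hδ; linarith)
  have hz' : volume (run j ∩ Set.Iic z) = ((I.get j).proc : ℝ≥0∞) := hz
  rw [← hz']
  refine (measure_mono (t := run j ∩ Set.Iic x ∪ Set.Ioc x (x + δ)) fun a ha => ?_).trans
    ((measure_union_le _ _).trans (add_le_add_right ?_ _))
  · rcases le_or_gt a x with hax | hax
    · exact .inl ⟨ha.1, hax⟩
    · exact .inr ⟨hax, (show a ≤ z from ha.2).trans hzx.le⟩
  · rw [Real.volume_Ioc, add_sub_cancel_left]
    simp

/-- The machine processes at most the amount `t - s` of work between the times `s` and `t`. -/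
theorem IsSchedule.sum_proc_le (h : IsSchedule I run) {S : Finset (Fin I.length)} {s t : ℝ}
    (hst : s ≤ t) (hS : ∀ j ∈ S, s ≤ (I.get j).release ∧ completionTime I run j ≤ t) :
    ∑ j ∈ S, ((I.get j).proc : ℝ) ≤ t - s := by
  have h1 : volume (⋃ j ∈ S, run j ∩ Set.Iic t) = ∑ j ∈ S, ((I.get j).proc : ℝ≥0∞) := by
    rw [measure_biUnion_finset (fun i _ j _ hij =>
      (h.disjoint i j hij).mono Set.inter_subset_left Set.inter_subset_left)
      fun j _ => (h.measurable j).inter measurableSet_Iic]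
    exact Finset.sum_congr rfl fun j hj => h.volume_eq j (hS j hj).2
  have h2 : volume (⋃ j ∈ S, run j ∩ Set.Iic t) ≤ volume (Set.Icc s t) := by
    refine measure_mono (Set.iUnion₂_subset fun j hj z hz => ⟨?_, hz.2⟩)
    exact (hS j hj).1.trans (h.released j z hz.1)
  rw [h1, Real.volume_Icc, ← Nat.cast_sum, ← ENNReal.ofReal_natCast,
    ENNReal.ofReal_le_ofReal_iff (by linarith)] at h2
  exact_mod_cast h2

theorem IsSchedule.proc_le_flowTime (h : IsSchedule I run) (j : Fin I.length) :
    ((I.get j).proc : ℝ) ≤ flowTime I run j := by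
  have := h.sum_proc_le (S := {j}) (h.release_le j) (by simp)
  simpa [flowTime] using this

theorem IsSchedule.one_le_flowTime (h : IsSchedule I run) (j : Fin I.length) :
    1 ≤ flowTime I run j :=
  le_trans (by exact_mod_cast (I.get j).proc_pos) (h.proc_le_flowTime j)

/-- The numbers that describe a job. -/
def Job.triple (j : Job) : ℕ × ℕ × ℕ := (j.proc, j.release, j.weight)

/-- The numbers that describe the jobs of an instance. -/
def triples (I : List Job) : List (ℕ × ℕ × ℕ) := I.map Job.triple

theorem length_triples (I : List Job) : (triples I).length = I.length := List.length_map _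

theorem get_triples (I : List Job) (i : Fin (triples I).length) :
    (triples I).get i = (I.get (i.cast (length_triples I))).triple :=
  List.getElem_map _

theorem sum_triples {M : Type} [AddCommMonoid M] (I : List Job) (f : Fin (triples I).length → M) :
    ∑ i, f i = ∑ i : Fin I.length, f (i.cast (length_triples I).symm) :=
  Fintype.sum_equiv (finCongr (length_triples I)) _ _ fun _ => rfl

/-- Sums over the data of the jobs. -/
theorem sum_jobData_triples {M : Type} [AddCommMonoid M] (I : List Job) (f : JobData → M) :
    ((jobData (triples I)).map f).sum = ∑ i : Fin I.length, f (i, (I.get i).proc,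
      (I.get i).release + 2 ^ (horizon (triples I)).length, (I.get i).weight) := by
  rw [sum_jobData, sum_triples]
  refine Finset.sum_congr rfl fun i _ => ?_
  rw [shiftJob, get_triples]
  rfl

theorem mem_jobData_triples {I : List Job} {j : JobData} : j ∈ jobData (triples I) ↔
    ∃ i : Fin I.length, j = (↑i, (I.get i).proc,
      (I.get i).release + 2 ^ (horizon (triples I)).length, (I.get i).weight) := by
  rw [mem_jobData]
  constructor
  · rintro ⟨i, rfl⟩
    exact ⟨i.cast (length_triples I), by rw [shiftJob, get_triples]; rfl⟩
  · rintro ⟨i, rfl⟩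
    exact ⟨i.cast (length_triples I).symm, by rw [shiftJob, get_triples]; rfl⟩

/-- The demand condition is necessary. -/
theorem IsSchedule.demand (h : IsSchedule I run) (D : ℕ → ℕ)
    (hD : ∀ j : Fin I.length, completionTime I run j + 2 ^ (horizon (triples I)).length ≤ D j)
    (t s : ℕ) (hs : s ≤ t) : s + dem (jobData (triples I)) D s t ≤ t := by
  rw [dem, sum_jobData_triples, ← Finset.sum_filter]
  have h1 := h.sum_proc_le (S := Finset.univ.filter fun i : Fin I.length =>
      s ≤ (I.get i).release + 2 ^ (horizon (triples I)).length ∧ D i ≤ t)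
    (s := s - 2 ^ (horizon (triples I)).length) (t := t - 2 ^ (horizon (triples I)).length)
    (by have : (s : ℝ) ≤ t := by exact_mod_cast hs
        linarith) fun j hj => by
      obtain ⟨h2, h3⟩ := (Finset.mem_filter.1 hj).2
      have h4 : (s : ℝ) ≤ (I.get j).release + 2 ^ (horizon (triples I)).length := by
        exact_mod_cast h2
      have h5 : (D j : ℝ) ≤ t := by exact_mod_cast h3
      have := hD j
      constructor <;> linarith
  rw [← Nat.cast_sum] at h1
  have h2 : ((s + ∑ i ∈ Finset.univ.filter fun i : Fin I.length =>
      s ≤ (I.get i).release + 2 ^ (horizon (triples I)).length ∧ D i ≤ t, (I.get i).proc : ℕ) : ℝ)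
      ≤ t := by
    rw [Nat.cast_add]
    linarith
  exact_mod_cast h2

end Schedule

/-! ### The approximation ratio -/

section Ratio

/-- The constant `4 ^ p / (4 ^ p - 3 ^ p)`, the price of covering a flow time by segments that are
geometrically spaced. -/
noncomputable def kappa (p : ℝ) : ℝ := (4 : ℝ) ^ p / ((4 : ℝ) ^ p - (3 : ℝ) ^ p)

variable {p : ℝ}

theorem kappa_eq (hp : 0 < p) : kappa p * (1 - (3 / 4 : ℝ) ^ p) = 1 := by
  have h1 : (3 : ℝ) ^ p < 4 ^ p := Real.rpow_lt_rpow (by norm_num) (by norm_num) hp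
  have h2 : (0 : ℝ) < 4 ^ p := by positivity
  rw [kappa, Real.div_rpow (by norm_num) (by norm_num)]
  field_simp [h2.ne', (sub_pos.2 h1).ne']

theorem one_le_kappa (hp : 0 < p) : 1 ≤ kappa p := by
  have h1 : (3 : ℝ) ^ p < 4 ^ p := Real.rpow_lt_rpow (by norm_num) (by norm_num) hp
  have h2 : (0 : ℝ) < 3 ^ p := by positivity
  rw [kappa, le_div_iff₀ (sub_pos.2 h1)]
  linarith

/-- The potential that pays for the segments of a job of flow time `F` at the age `a`: segments that
end before the completion are paid by the growth of the power of the age, the segment during which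
the job is completed is paid at its completion. -/
noncomputable def potential (p F a : ℝ) : ℝ :=
  kappa p * (max 1 (min a F)) ^ p + if F ≤ a then (2 * F) ^ p else 0

theorem potential_mono (hp : 0 < p) {F : ℝ} (hF : 1 ≤ F) : Monotone (potential p F) := by
  intro a b hab
  have hk := one_le_kappa hp
  have h1 : (max 1 (min a F)) ^ p ≤ (max 1 (min b F)) ^ p :=
    Real.rpow_le_rpow (le_max_of_le_left zero_le_one)
      (max_le_max le_rfl (min_le_min hab le_rfl)) hp.le
  refine add_le_add (mul_le_mul_of_nonneg_left h1 (by linarith)) ?_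
  have h2 : 0 ≤ (2 * F) ^ p := by positivity
  split_ifs with h3 h4
  · exact le_rfl
  · linarith
  · exact h2
  · exact le_rfl

/-- The growth of the potential pays for a segment. -/
theorem potential_seg (hp : 0 < p) {F a d : ℝ} (hd : 1 ≤ d) (h1 : d ≤ a) (h2 : a < 3 * d)
    (haF : a < F) : (a + d) ^ p ≤ potential p F (a + d) - potential p F a := by
  have hk := one_le_kappa hp
  have hmin : max 1 (min a F) = a := by rw [min_eq_left haF.le, max_eq_right (by linarith)]
  rw [potential, potential, hmin, if_neg (not_le.2 haF)]
  rcases lt_or_ge (a + d) F with h3 | h3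
  · rw [if_neg (not_le.2 h3), min_eq_left h3.le, max_eq_right (by linarith)]
    have h4 : a ^ p ≤ (3 / 4 : ℝ) ^ p * (a + d) ^ p := by
      rw [← Real.mul_rpow (by norm_num) (by linarith)]
      exact Real.rpow_le_rpow (by linarith) (by linarith) hp.le
    have h5 := mul_le_mul_of_nonneg_left h4 (show 0 ≤ kappa p by linarith)
    have h6 : (a + d) ^ p = kappa p * (1 - (3 / 4 : ℝ) ^ p) * (a + d) ^ p := by
      rw [kappa_eq hp, one_mul]
    linarith
  · rw [if_pos h3, min_eq_right h3, max_eq_right (by linarith)]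
    have h4 : a ^ p ≤ F ^ p := Real.rpow_le_rpow (by linarith) haF.le hp.le
    have h5 := mul_le_mul_of_nonneg_left h4 (show 0 ≤ kappa p by linarith)
    have h6 : (a + d) ^ p ≤ (2 * F) ^ p := Real.rpow_le_rpow (by linarith) (by linarith) hp.le
    linarith

theorem potential_total (hp : 0 < p) {F a b : ℝ} (hF : 1 ≤ F) (ha : a ≤ 0) :
    potential p F b - potential p F a ≤ (2 ^ p + kappa p) * F ^ p - kappa p := by
  have hk := one_le_kappa hp
  have h1 : potential p F a = kappa p := by
    rw [potential, min_eq_left (by linarith), max_eq_left (by linarith), Real.one_rpow, mul_one,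
      if_neg (by linarith), add_zero]
  have h2 : (max 1 (min b F)) ^ p ≤ F ^ p :=
    Real.rpow_le_rpow (le_max_of_le_left zero_le_one) (max_le hF (min_le_right _ _)) hp.le
  have h3 : (if F ≤ b then (2 * F) ^ p else 0) ≤ 2 ^ p * F ^ p := by
    rw [← Real.mul_rpow (by norm_num) (by linarith)]
    split_ifs
    · exact le_rfl
    · positivity
  rw [h1, potential]
  have := mul_le_mul_of_nonneg_left h2 (show 0 ≤ kappa p by linarith)
  linarith

/-- The cost of the schedule that the algorithm finds, compared with any schedule `run`. -/
theorem solve_ratio (hp : 0 < p) {I : List Job} {y : ℕ → ℕ} {E c : ℕ} (hE : 1 ≤ E)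
    (hy : ∀ x ≤ 2 ^ ((horizon (triples I)).length + 2),
      y x ≤ 2 ^ (((horizon (triples I)).length + 1) * c)) {lo hi : ℝ} (hlo : 0 ≤ lo) (hhi : 1 ≤ hi)
    (hy₁ : ∀ x : ℕ, 1 ≤ x → y x ≤ hi * (x : ℝ) ^ p)
    (hy₂ : ∀ x : ℕ, 1 ≤ x → x ≤ 2 ^ ((horizon (triples I)).length + 3) → lo * (x : ℝ) ^ p ≤ y x)
    {run : Fin I.length → Set ℝ} (hrun : IsSchedule I run) :
    (∀ q ∈ solve y E c (triples I), q.1 < I.length) ∧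
    IsSchedule I (fun i => pieceSet (solve y E c (triples I)) i) ∧
    lo * ∑ i, ((I.get i).weight : ℝ) *
        flowTime I (fun i => pieceSet (solve y E c (triples I)) i) i ^ p ≤
      hi * (1 + 2 / E) * (2 ^ p + kappa p) *
        ∑ i, ((I.get i).weight : ℝ) * flowTime I run i ^ p := by
  set K := (horizon (triples I)).length with hK
  have hmem : ∀ j ∈ jobData (triples I), ∃ i : Fin I.length,
      j = (↑i, (I.get i).proc, (I.get i).release + 2 ^ K, (I.get i).weight) :=
    fun j hj => mem_jobData_triples.1 hj
  have hk := one_le_kappa hp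
  have hF : ∀ i, 1 ≤ flowTime I run i := hrun.one_le_flowTime
  -- the flow times and the rounded completion times of `run`, as functions of the job index
  let F : ℕ → ℝ := fun i => if h : i < I.length then flowTime I run ⟨i, h⟩ else 1
  let D : ℕ → ℕ := fun i => if h : i < I.length then ⌈completionTime I run ⟨i, h⟩⌉₊ + 2 ^ K else 0
  have hFi : ∀ i : Fin I.length, F i = flowTime I run i := fun i => dif_pos i.2
  have hDi : ∀ i : Fin I.length, D i = ⌈completionTime I run i⌉₊ + 2 ^ K := fun i => dif_pos i.2
  set Z := ∑ i, ((I.get i).weight : ℝ) * flowTime I run i ^ p with hZ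
  set W := ∑ i, ((I.get i).weight : ℝ) with hW
  obtain ⟨h1, h2, h3, f, h4, h5⟩ := solve_spec (I := triples I) (y := y) (E := E) (c := c) hE hy
    (D := D)
    (ψ := fun j x => j.2.2.2 * hi * potential p (F j.1) ((x : ℝ) - j.2.2.1))
    (V := hi * ((2 ^ p + kappa p) * Z - kappa p * W))
    (fun j hj => by
      obtain ⟨i, rfl⟩ := hmem j hj
      have h6 : (I.get i).release < ⌈completionTime I run i⌉₊ := by
        rw [Nat.lt_ceil]
        have := hF i
        rw [flowTime] at this
        linarith
      simp only [hDi]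
      omega)
    (hrun.demand D fun i => by
      rw [hDi]
      push_cast
      exact add_le_add_left (Nat.le_ceil _) _)
    (fun j hj => by
      obtain ⟨i, rfl⟩ := hmem j hj
      intro x x' hx
      refine mul_le_mul_of_nonneg_left (potential_mono hp ?_ ?_) (by positivity)
      · rw [hFi]; exact hF i
      · have : (x : ℝ) ≤ x' := by exact_mod_cast hx
        linarith)
    (fun j hj k q g1 g2 g3 => by
      obtain ⟨i, rfl⟩ := hmem j hj
      simp only [hDi, hFi] at g1 g2 g3 ⊢
      have hd : 1 ≤ 2 ^ k := Nat.one_le_two_pow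
      have e : (q + 1) * 2 ^ k = q * 2 ^ k + 2 ^ k := by ring
      rw [e]
      generalize q * 2 ^ k = x at *
      generalize 2 ^ k = d at *
      have g4 : x - 2 ^ K < ⌈completionTime I run i⌉₊ := by omega
      rw [Nat.lt_ceil, Nat.cast_sub (by omega)] at g4
      have g5 : ((I.get i).release + 2 ^ K + d : ℝ) ≤ x := by exact_mod_cast g2
      have g6 : (x : ℝ) < (I.get i).release + 2 ^ K + 3 * d := by exact_mod_cast g3
      have g7 : (1 : ℝ) ≤ d := by exact_mod_cast hd
      push_cast at g4 ⊢
      have g8 := potential_seg hp (F := flowTime I run i) (a := x - ((I.get i).release + 2 ^ K))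
        (d := d) g7 (by linarith) (by linarith) (by rw [flowTime]; linarith)
      have g9 := hy₁ (x + d - ((I.get i).release + 2 ^ K)) (by omega)
      rw [Nat.cast_sub (by omega)] at g9
      push_cast at g9
      rw [show (x : ℝ) + d - ((I.get i).release + 2 ^ K) = x - ((I.get i).release + 2 ^ K) + d by
        ring] at g9 ⊢
      rw [← mul_sub, mul_assoc]
      exact mul_le_mul_of_nonneg_left
        (g9.trans (mul_le_mul_of_nonneg_left g8 (by linarith))) (Nat.cast_nonneg _))
    (by
      rw [sum_jobData_triples, hZ, hW, Finset.mul_sum, Finset.mul_sum, ← Finset.sum_sub_distrib,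
        Finset.mul_sum]
      refine Finset.sum_le_sum fun i _ => ?_
      rw [← mul_sub, mul_assoc, hFi]
      have g1 := potential_total hp (F := flowTime I run i) (hF i)
        (a := ((2 ^ (horizon (triples I)).length : ℕ) : ℝ) -
          (((I.get i).release + 2 ^ (horizon (triples I)).length : ℕ) : ℝ))
        (b := ((2 ^ ((horizon (triples I)).length + 1) : ℕ) : ℝ) -
          (((I.get i).release + 2 ^ (horizon (triples I)).length : ℕ) : ℝ)) (by
            push_cast
            linarith [Nat.cast_nonneg (α := ℝ) (I.get i).release])
      refine (mul_le_mul_of_nonneg_left (mul_le_mul_of_nonneg_left g1 (by linarith))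
        (Nat.cast_nonneg _)).trans_eq ?_
      ring)
  have hsched : IsSchedule I (fun i => pieceSet (solve y E c (triples I)) i) := by
    have hcast : ∀ i : Fin I.length,
        (triples I).get (i.cast (length_triples I).symm) = (I.get i).triple :=
      fun i => get_triples I _
    refine ⟨fun i => measurableSet_pieceSet _ _, fun i j hij => h3 _ _ fun h => hij (Fin.ext h),
      fun i x hx => ?_, fun i => ?_, fun i => ?_⟩
    · have := ((h4 (i.cast (length_triples I).symm)).2.2 hx).1
      rwa [hcast] at this
    · have := h2 (i.cast (length_triples I).symm)
      rwa [hcast] at this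
    · exact ⟨_, fun x hx => ((h4 (i.cast (length_triples I).symm)).2.2 hx).2.le⟩
  refine ⟨fun q hq => by rw [← length_triples I]; exact h1 q hq, hsched, ?_⟩
  rw [sum_triples, sum_triples] at h5
  have hW0 : 0 ≤ W := Finset.sum_nonneg fun i _ => Nat.cast_nonneg _
  have hZ0 : W ≤ Z := by
    refine Finset.sum_le_sum fun i _ => le_mul_of_one_le_right (Nat.cast_nonneg _) ?_
    exact Real.one_le_rpow (hF i) hp.le
  -- the cost of the algorithm is bounded by that of its deadlines
  have h6 : lo * ∑ i, ((I.get i).weight : ℝ) *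
      flowTime I (fun i => pieceSet (solve y E c (triples I)) i) i ^ p ≤
      ∑ i : Fin I.length, ((I.get i).weight : ℝ) * y (f (i.cast (length_triples I).symm)) := by
    rw [Finset.mul_sum]
    refine Finset.sum_le_sum fun i _ => ?_
    obtain ⟨g1, g2, g3⟩ := h4 (i.cast (length_triples I).symm)
    rw [mul_left_comm]
    refine mul_le_mul_of_nonneg_left (le_trans (mul_le_mul_of_nonneg_left ?_ hlo) (hy₂ _ g1 g2))
      (Nat.cast_nonneg _)
    refine Real.rpow_le_rpow (by linarith [hsched.one_le_flowTime i]) ?_ hp.le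
    rw [get_triples] at g3
    have := completionTime_le (j := i) hsched fun z hz => (g3 hz).2.le
    rw [flowTime]
    simp only [Job.triple] at this
    rw [sub_le_iff_le_add']
    exact this
  have h7 : ∑ i : Fin I.length, ((I.get i).weight : ℝ) * y (f (i.cast (length_triples I).symm)) ≤
      W * y 1 + (hi * ((2 ^ p + kappa p) * Z - kappa p * W) +
        2 * max (hi * ((2 ^ p + kappa p) * Z - kappa p * W)) 1 / E) := by
    simp only [get_triples] at h5
    refine h5.trans (add_le_add_left (le_of_eq ?_) _)
    rw [hW, Finset.sum_mul]
    rfl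
  have h8 : (y 1 : ℝ) ≤ hi := by simpa using hy₁ 1 le_rfl
  have h2p : (0 : ℝ) < 2 ^ p := by positivity
  rcases Nat.eq_zero_or_pos I.length with hn | hn
  · have : IsEmpty (Fin I.length) := by rw [hn]; infer_instance
    rw [hZ]
    simp
  -- with at least one job, the rounding is small compared with the cost
  have hW1 : 1 ≤ W := by
    refine le_trans ?_ (Finset.single_le_sum (f := fun i => ((I.get i).weight : ℝ))
      (fun i _ => Nat.cast_nonneg _) (Finset.mem_univ ⟨0, hn⟩))
    exact_mod_cast (I.get ⟨0, hn⟩).weight_pos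
  have hXZ : 1 ≤ (2 ^ p + kappa p) * Z := by nlinarith
  have hhiXZ : 1 ≤ hi * ((2 ^ p + kappa p) * Z) := by nlinarith
  have hmax : max (hi * ((2 ^ p + kappa p) * Z - kappa p * W)) 1 ≤
      hi * ((2 ^ p + kappa p) * Z) := by
    refine max_le (mul_le_mul_of_nonneg_left ?_ (by linarith)) hhiXZ
    have : 0 ≤ kappa p * W := by positivity
    linarith
  have h9 : W * y 1 ≤ hi * (kappa p * W) := by
    rw [mul_comm]
    have : W ≤ kappa p * W := le_mul_of_one_le_left hW0 hk
    exact mul_le_mul h8 this hW0 (by linarith)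
  refine (h6.trans h7).trans ?_
  have h10 : 2 * max (hi * ((2 ^ p + kappa p) * Z - kappa p * W)) 1 / E ≤
      2 / E * (hi * ((2 ^ p + kappa p) * Z)) := by
    rw [mul_div_right_comm]
    exact mul_le_mul_of_nonneg_left hmax (by positivity)
  refine (add_le_add h9 (add_le_add_right h10 _)).trans_eq ?_
  ring

end Ratio

/-! ### From the algorithm to programs -/

/-- Every instance has a schedule: the jobs are processed one after the other, after all
releases. -/
theorem exists_isSchedule (I : List Job) : ∃ run : Fin I.length → Set ℝ, IsSchedule I run := by
  set s : ℕ → ℕ := fun i => (I.map fun j => j.release).sum + ((I.take i).map fun j => j.proc).sum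
    with hs
  have hsucc : ∀ i : Fin I.length, s (i + 1) = s i + (I.get i).proc := fun i => by
    simp only [hs]
    rw [List.take_add_one, List.map_append, List.sum_append, List.getElem?_eq_getElem i.2]
    simp [add_assoc]
  have hmono : Monotone s := fun i j hij => by
    refine Nat.add_le_add_left ?_ _
    exact ((List.take_sublist_take_left hij).map _).sum_le_sum (by simp)
  refine ⟨fun i => Set.Ico (s i) (s (i + 1)), fun i => measurableSet_Ico, fun i j hij => ?_,
    fun i x hx => ?_, fun i => ?_, fun i => bddAbove_Ico⟩
  · have key : ∀ i j : Fin I.length, i < j →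
        Disjoint (Set.Ico (s i : ℝ) (s (i + 1))) (Set.Ico (s j : ℝ) (s (j + 1))) := by
      intro i j hij
      rw [Set.disjoint_left]
      intro x hx hx'
      have h1 : s (i + 1) ≤ s j := hmono hij
      have h2 : (s (i + 1) : ℝ) ≤ s j := by exact_mod_cast h1
      linarith [hx.2, hx'.1]
    rcases lt_or_gt_of_ne hij with h | h
    · exact key i j h
    · exact (key j i h).symm
  · refine le_trans ?_ hx.1
    have h1 : (I.get i).release ≤ (I.map fun j => j.release).sum :=
      List.single_le_sum (by simp) _ (List.mem_map_of_mem (f := fun j : Job => j.release)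
        (List.get_mem I i))
    exact_mod_cast h1.trans (Nat.le_add_right _ _)
  · rw [Real.volume_Ico, hsucc, Nat.cast_add, add_sub_cancel_left, ENNReal.ofReal_natCast]

theorem enc_triples (I : List Job) : Enc.enc (triples I) = encodeInstance I := by
  change Val.ofList ((I.map Job.triple).map Enc.enc) = Val.ofList (I.map Job.encode)
  rw [List.map_map]
  rfl

/-- A list of triples with valid job indices is a list of pieces. -/
theorem exists_pieces {n : ℕ} (L : List (ℕ × ℕ × ℕ)) (hL : ∀ q ∈ L, q.1 < n) :
    ∃ S : List (Piece n), encodePieces S = Enc.enc L ∧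
      ∀ j : Fin n, piecesRun S j = pieceSet L j := by
  induction L with
  | nil => exact ⟨[], rfl, fun j => by simp [piecesRun, pieceSet]⟩
  | cons q L ih =>
    obtain ⟨S, h1, h2⟩ := ih fun q hq => hL q (by simp [hq])
    refine ⟨⟨⟨q.1, hL q (by simp)⟩, q.2.1, q.2.2⟩ :: S, ?_, fun j => ?_⟩
    · change Val.pair _ (encodePieces S) = Val.pair _ (Enc.enc L)
      rw [h1]
      rfl
    · ext x
      have h3 := Set.ext_iff.1 (h2 j) x
      simp only [piecesRun, pieceSet, Set.mem_ofPred_eq, List.mem_cons, exists_eq_or_imp] at h3 ⊢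
      rw [h3, Fin.ext_iff]

/-- The loss that rounding causes vanishes in the limit. -/
theorem exists_precision {p X ε : ℝ} (hp : 0 < p) (hX : 0 < X) (hε : 0 < ε) : ∃ n : ℕ, 0 < n ∧
    ((((n : ℝ) + 1) * 2 ^ (p / n)) / (n * 2 ^ (-(2 / n) : ℝ)) * (1 + 2 / n) * X) ^ (1 / p) ≤
      X ^ (1 / p) + ε := by
  have h0 : Filter.Tendsto (fun n : ℕ => (1 : ℝ) / n) Filter.atTop (nhds 0) :=
    tendsto_one_div_atTop_nhds_zero_nat
  have h1 : Filter.Tendsto (fun n : ℕ => ((1 + (1 : ℝ) / n) * 2 ^ ((p + 2) * ((1 : ℝ) / n)) *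
      (1 + 2 * ((1 : ℝ) / n)) * X) ^ (1 / p)) Filter.atTop
      (nhds (((1 + 0) * 2 ^ ((p + 2) * (0 : ℝ)) * (1 + 2 * 0) * X) ^ (1 / p))) := by
    have hc : Continuous fun z : ℝ =>
        ((1 + z) * 2 ^ ((p + 2) * z) * (1 + 2 * z) * X) ^ (1 / p) := by
      refine Continuous.rpow_const ?_ fun _ => .inr (by positivity)
      have : Continuous fun z : ℝ => (2 : ℝ) ^ ((p + 2) * z) :=
        Continuous.rpow continuous_const (by fun_prop) fun _ => .inl (by norm_num)
      fun_prop
    exact (hc.tendsto 0).comp h0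
  simp only [add_zero, mul_zero, Real.rpow_zero, mul_one, one_mul] at h1
  obtain ⟨n, hn, hn0⟩ := ((h1.eventually (ge_mem_nhds (show X ^ (1 / p) < X ^ (1 / p) + ε by
    linarith))).and (Filter.eventually_gt_atTop 0)).exists
  refine ⟨n, hn0, le_trans (le_of_eq ?_) hn⟩
  have hnr : (0 : ℝ) < n := by exact_mod_cast hn0
  congr 1
  rw [Real.rpow_neg (by norm_num), show (p + 2) * (1 / (n : ℝ)) = p / n + 2 / n by ring,
    Real.rpow_add two_pos]
  field_simp

/-- The algorithm, given a good approximation of the exponent that is computed from the input. -/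
theorem approx_of_exponent {α : Type} [Enc α] {p X ε : ℝ} (hp : 0 < p) (hX : X = 2 ^ p + kappa p)
    (hε : 0 < ε) {jobs : α → List (ℕ × ℕ × ℕ)} (hjobs : PolyTime jobs) {input : List Job → α}
    (hinput : ∀ I, jobs (input I) = triples I) {b : ℕ}
    (hsz : ∀ I, sz (input I) ≤ 2 * (encodeInstance I).size + b)
    (hexp : ∀ G : ℕ, ∃ num den : α → ℕ, PolyTime num ∧ PolyTime den ∧ ∀ I,
      (num (input I) : ℝ) / den (input I) ≤ p ∧
      (p - num (input I) / den (input I)) * (G * ((horizon (triples I)).length + 3 : ℕ) + 1) ≤ 1) :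
    ∃ P : Prog, IsPolyTimeApprox P (fun I => Enc.enc (input I)) p (X ^ (1 / p) + ε) := by
  have hk := one_le_kappa hp
  have h2p : (0 : ℝ) < 2 ^ p := by positivity
  obtain ⟨n, hn, hprec⟩ := exists_precision hp (X := X) (by rw [hX]; linarith) hε
  obtain ⟨num, den, hnum, hden, hnd⟩ := hexp n
  set y : α → ℕ → ℕ := fun a x => powApprox n n ⌈p⌉₊ (num a) (den a) x with hy
  have hyP : PolyTime fun x : α × ℕ => y x.1 x.2 := by
    refine PolyTime.powApprox n n ⌈p⌉₊ (num := fun x : α × ℕ => num x.1)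
      (den := fun x : α × ℕ => den x.1) ?_ ?_ (by fun_prop)
    · exact PolyTime.comp hnum (by fun_prop)
    · exact PolyTime.comp hden (by fun_prop)
  obtain ⟨P, g, ⟨k, hg⟩, hP⟩ := PolyTime.solve hyP n (3 * ⌈p⌉₊ + n + 1) hjobs
  have hnr : (0 : ℝ) < n := by exact_mod_cast hn
  set lo : ℝ := n * 2 ^ (-(2 / n) : ℝ) with hlo
  set hi : ℝ := ((n : ℝ) + 1) * 2 ^ (p / n) with hhi
  have hlo0 : 0 < lo := by positivity
  have hhi1 : 1 ≤ hi := by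
    have : (1 : ℝ) ≤ 2 ^ (p / n) := Real.one_le_rpow (by norm_num) (by positivity)
    nlinarith
  have hratio : ∀ (I : List Job) (run : Fin I.length → Set ℝ), IsSchedule I run → _ :=
    fun I run hrun => solve_ratio hp (I := I) (y := y (input I)) (E := n)
      (c := 3 * ⌈p⌉₊ + n + 1) hn (fun x hx => powApprox_le hn n _ _ _ hx) hlo0.le hhi1
      (fun x hx => powApprox_le_rpow hn n _ hp (hnd I).1 hx)
      (fun x hx hxK => rpow_le_powApprox hn n hp (Nat.le_ceil p) (hnd I).1 (hnd I).2 hx hxK) hrun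
  refine ⟨P, (2 * Polynomial.X + Polynomial.C (b + 2)) ^ k, fun I => ?_⟩
  obtain ⟨run₀, hrun₀⟩ := exists_isSchedule I
  obtain ⟨hlt, hsched, -⟩ := hratio I run₀ hrun₀
  obtain ⟨S, hS, hSrun⟩ := exists_pieces _ hlt
  have hrunS : piecesRun S = fun i : Fin I.length =>
      pieceSet (solve (y (input I)) n (3 * ⌈p⌉₊ + n + 1) (triples I)) i := funext hSrun
  obtain ⟨t, ht, hPt⟩ := hP (input I)
  beta_reduce at hPt
  rw [hinput] at hPt
  refine ⟨S, t, by rw [hS]; exact hPt, ?_, by rw [hrunS]; exact hsched, fun run hrun => ?_⟩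
  · refine (ht.trans (hg _)).trans ?_
    simp only [Polynomial.eval_pow, Polynomial.eval_add, Polynomial.eval_mul, Polynomial.eval_ofNat,
      Polynomial.eval_X, Polynomial.eval_C]
    exact Nat.pow_le_pow_left (by have := hsz I; omega) k
  · have h1 := (hratio I run hrun).2.2
    rw [← hrunS, ← hX, mul_comm lo, ← le_div_iff₀ hlo0] at h1
    have h2 : ∀ {run : Fin I.length → Set ℝ}, IsSchedule I run →
        0 ≤ ∑ i, ((I.get i).weight : ℝ) * flowTime I run i ^ p := fun h =>
      Finset.sum_nonneg fun i _ => mul_nonneg (Nat.cast_nonneg _)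
        (Real.rpow_nonneg (by linarith [h.one_le_flowTime i]) _)
    rw [flowNorm, flowNorm]
    have h3 := Real.rpow_le_rpow (h2 (by rw [hrunS]; exact hsched)) h1
      (show 0 ≤ 1 / p by positivity)
    refine h3.trans ?_
    rw [show hi * (1 + 2 / n) * X * (∑ i, ((I.get i).weight : ℝ) * flowTime I run i ^ p) / lo =
      hi / lo * (1 + 2 / n) * X * ∑ i, ((I.get i).weight : ℝ) * flowTime I run i ^ p by ring]
    rw [Real.mul_rpow (by rw [hX]; positivity) (h2 hrun)]
    exact mul_le_mul_of_nonneg_right hprec (Real.rpow_nonneg (h2 hrun) _)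

theorem approx_of_rat {p ε : ℝ} (hp : 0 < p) (hε : 0 < ε) (hq : ∃ q : ℚ, (q : ℝ) = p) :
    ∃ P : Prog, IsPolyTimeApprox P encodeInstance p ((2 ^ p + kappa p) ^ (1 / p) + ε) := by
  obtain ⟨q, rfl⟩ := hq
  have hq0 : 0 < q := by exact_mod_cast hp
  have h := approx_of_exponent (α := List (ℕ × ℕ × ℕ)) hp rfl hε (jobs := fun l => l)
    (by fun_prop) (input := triples) (fun _ => rfl) (b := 0)
    (fun I => by rw [sz, enc_triples]; omega)
    (fun G => ⟨fun _ => q.num.toNat, fun _ => q.den, by fun_prop, by fun_prop, fun I => by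
      have h1 : ((q.num.toNat : ℕ) : ℝ) / (q.den : ℝ) = q := by
        have h2 : ((q.num.toNat : ℕ) : ℤ) = q.num := Int.toNat_of_nonneg (Rat.num_nonneg.2 hq0.le)
        have h3 : ((q.num.toNat : ℕ) : ℝ) = (q.num : ℝ) := by exact_mod_cast h2
        rw [h3, Rat.cast_def]
      rw [h1]
      simp⟩)
  simpa only [enc_triples] using h

/-- A unary representation of the encoding length of an instance. -/
def unarySize (l : List (ℕ × ℕ × ℕ)) : List ℕ :=
  0 :: l.flatMap fun j => List.replicate 6 0 ++ (List.replicate (Nat.size j.1) 0 ++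
    (List.replicate (Nat.size j.2.1) 0 ++ List.replicate (Nat.size j.2.2) 0))

theorem length_unarySize (l : List (ℕ × ℕ × ℕ)) : (unarySize l).length = sz l := by
  induction l with
  | nil => simp [unarySize]
  | cons j l ih =>
    simp only [unarySize, List.length_cons, List.flatMap_cons, List.length_append,
      List.length_replicate] at ih ⊢
    rw [sz_cons, ← ih, sz_prod, sz_prod, sz_nat, sz_nat, sz_nat]
    omega

/-- All times of an instance have a binary length that is at most its encoding length. -/
theorem horizon_le (l : List (ℕ × ℕ × ℕ)) : (horizon l).length ≤ sz l := by
  rw [horizon, List.length_replicate, Nat.size_le]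
  induction l with
  | nil => simp
  | cons j l ih =>
    rw [List.map_cons, List.sum_cons, sz_cons, sz_prod, sz_prod, sz_nat, sz_nat]
    have h1 : ∀ n m, n ≤ m → 2 ^ n ≤ 2 ^ m := fun n m h => Nat.pow_le_pow_right two_pos h
    have h2 := (Nat.lt_size_self j.1).trans_le
      (h1 _ (Nat.size j.1 + Nat.size j.2.1 + sz l) (by omega))
    have h3 := (Nat.lt_size_self j.2.1).trans_le
      (h1 _ (Nat.size j.1 + Nat.size j.2.1 + sz l) (by omega))
    have h4 := ih.trans_le (h1 _ (Nat.size j.1 + Nat.size j.2.1 + sz l) (by omega))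
    have h5 := h1 (Nat.size j.1 + Nat.size j.2.1 + sz l + 2)
      (1 + (1 + (1 + Nat.size j.1) + (1 + (1 + Nat.size j.2.1) + sz j.2.2)) + sz l) (by omega)
    rw [pow_add] at h5
    omega

theorem linear_le_two_pow {G M : ℕ} (h : 2 * G + 8 ≤ M) : G * (M + 3) + 1 ≤ 2 ^ M := by
  obtain ⟨s, rfl⟩ : ∃ s, M = G + (s + 1) := ⟨M - G - 1, by omega⟩
  have h1 : G + 1 ≤ 2 ^ G := Nat.lt_two_pow_self
  have h2 : s + 1 ≤ 2 ^ s := Nat.lt_two_pow_self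
  have h3 : G + (s + 1) + 4 ≤ 2 ^ (s + 1) := by rw [pow_succ]; omega
  rw [pow_add]
  calc G * (G + (s + 1) + 3) + 1 ≤ (G + 1) * (G + (s + 1) + 4) := by nlinarith
    _ ≤ _ := Nat.mul_le_mul h1 h3

theorem approx_of_digits {p ε : ℝ} (hp : 0 < p) (hε : 0 < ε) :
    ∃ P : Prog, IsPolyTimeApprox P (withDigits p) p ((2 ^ p + kappa p) ^ (1 / p) + ε) := by
  have h := approx_of_exponent (α := List (ℕ × ℕ × ℕ) × ℕ) hp rfl hε (jobs := fun x => x.1)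
    (by fun_prop) (input := fun I => (triples I, ⌊p * 2 ^ (encodeInstance I).size⌋₊))
    (fun _ => rfl) (b := 2 + Nat.size ⌈p⌉₊)
    (fun I => by
      rw [sz_pair, sz_nat, show sz (triples I) = (encodeInstance I).size by rw [sz, enc_triples]]
      have h1 : Nat.size ⌊p * 2 ^ (encodeInstance I).size⌋₊ ≤
          Nat.size ⌈p⌉₊ + (encodeInstance I).size := by
        rw [Nat.size_le, pow_add]
        have h2 : (⌈p⌉₊ : ℝ) < (2 ^ Nat.size ⌈p⌉₊ : ℕ) := by exact_mod_cast Nat.lt_size_self _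
        rw [Nat.floor_lt (by positivity)]
        push_cast at h2 ⊢
        exact mul_lt_mul_of_pos_right ((Nat.le_ceil p).trans_lt h2) (by positivity)
      omega)
    (fun G => ⟨fun x => if (unarySize x.1).length < 2 * G + 8 then ⌊p * 2 ^ (2 * G + 8)⌋₊ else x.2,
      fun x => if (unarySize x.1).length < 2 * G + 8 then 2 ^ (2 * G + 8) else
        2 ^ (unarySize x.1).length, ?_, ?_, fun I => ?_⟩)
  · have e : withDigits p =
        fun I => Enc.enc (triples I, ⌊p * 2 ^ (encodeInstance I).size⌋₊) :=
      funext fun I => congrArg₂ Val.pair (enc_triples I).symm rfl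
    rwa [e]
  · have hu : PolyTime fun x : List (ℕ × ℕ × ℕ) × ℕ => unarySize x.1 := by
      unfold unarySize
      fun_prop
    fun_prop
  · have hu : PolyTime fun x : List (ℕ × ℕ × ℕ) × ℕ => unarySize x.1 := by
      unfold unarySize
      fun_prop
    fun_prop
  · -- both cases use the digits of `p` up to a position `M` that exceeds the length of the instance
    have hN : (unarySize (triples I)).length = (encodeInstance I).size := by
      rw [length_unarySize, sz, enc_triples]
    have hK : (horizon (triples I)).length ≤ (encodeInstance I).size := by
      refine (horizon_le _).trans_eq ?_
      rw [sz, enc_triples]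
    have key : ∀ M, 2 * G + 8 ≤ M → (encodeInstance I).size ≤ M →
        ((⌊p * 2 ^ M⌋₊ : ℕ) : ℝ) / ((2 ^ M : ℕ) : ℝ) ≤ p ∧ (p - ⌊p * 2 ^ M⌋₊ / ((2 ^ M : ℕ) : ℝ)) *
          (G * ((horizon (triples I)).length + 3 : ℕ) + 1) ≤ 1 := by
      intro M h1 h2
      have h3 : (0 : ℝ) < ((2 ^ M : ℕ) : ℝ) := by positivity
      have h4 : (⌊p * 2 ^ M⌋₊ : ℝ) ≤ p * 2 ^ M := Nat.floor_le (by positivity)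
      have h5 : p * 2 ^ M < ⌊p * 2 ^ M⌋₊ + 1 := Nat.lt_floor_add_one _
      have h6 : G * ((horizon (triples I)).length + 3) + 1 ≤ 2 ^ M :=
        le_trans (by gcongr; omega) (linear_le_two_pow h1)
      have h7 : (G * ((horizon (triples I)).length + 3 : ℕ) + 1 : ℝ) ≤ ((2 ^ M : ℕ) : ℝ) := by
        exact_mod_cast h6
      refine ⟨by rw [div_le_iff₀ h3]; push_cast; exact h4, ?_⟩
      have h8 : p - ⌊p * 2 ^ M⌋₊ / ((2 ^ M : ℕ) : ℝ) ≤ 1 / ((2 ^ M : ℕ) : ℝ) := by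
        rw [sub_le_iff_le_add, ← add_div, le_div_iff₀ h3]
        push_cast
        linarith
      calc _ ≤ 1 / ((2 ^ M : ℕ) : ℝ) * ((2 ^ M : ℕ) : ℝ) :=
            mul_le_mul h8 h7 (by positivity) (by positivity)
        _ = 1 := one_div_mul_cancel h3.ne'
    simp only [hN]
    split_ifs with hc
    · exact key _ le_rfl hc.le
    · exact key _ (not_lt.1 hc) le_rfl

end FlowTime

theorem mainTheorem2 (p : ℝ) (hp : 0 < p) (ε : ℝ) (hε : 0 < ε) :
    (∃ P : FlowTime.Prog,
      FlowTime.IsPolyTimeApprox P (FlowTime.withDigits p) p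
        (((2 : ℝ) ^ p + (4 : ℝ) ^ p / ((4 : ℝ) ^ p - (3 : ℝ) ^ p)) ^ (1 / p) + ε)) ∧
    ((∃ q : ℚ, (q : ℝ) = p) →
      ∃ P : FlowTime.Prog,
        FlowTime.IsPolyTimeApprox P FlowTime.encodeInstance p
          (((2 : ℝ) ^ p + (4 : ℝ) ^ p / ((4 : ℝ) ^ p - (3 : ℝ) ^ p)) ^ (1 / p) + ε)) ∧
    (∃ P : FlowTime.Prog,
      FlowTime.IsPolyTimeApprox P FlowTime.encodeInstance 1 (6 + ε)) := by
  refine ⟨FlowTime.approx_of_digits hp hε, FlowTime.approx_of_rat hp hε, ?_⟩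
  have h := FlowTime.approx_of_rat one_pos hε ⟨1, Rat.cast_one⟩
  rwa [FlowTime.kappa, Real.rpow_one, Real.rpow_one, Real.rpow_one, div_one, Real.rpow_one,
    show (2 : ℝ) + 4 / (4 - 3) = 6 by norm_num] at h
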